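/- In the single-machine total tardiness problem $1||\sum T_i$ one is given $n$ jobs with processing times $p_i\in\mathbb{Z}_{\ge 0}$ and due dates $d_i\in\mathbb{Z}$, and asks for a sequence $\sigma$ of the jobs, processed without idle time from time $0$, that minimizes $\sum_i \max\{C_i-d_i,0\}$, where $C_i$ is the completion time of job $i$ in $\sigma$. Running times are numbers of steps of a random access machine (unit-cost addition, subtraction, comparison, indirect reading and writing); $O^*(c^n)$ means at most $q(n)\,c^n$ steps on every instance with $n$ jobs, for some polynomial $q$. Polynomial space means that the number of memory cells in use is bounded by a polynomial in $n$ and the binary length of their contents by a polynomial in the binary length of the instance. An instance has $\mathrm{LPT}=\mathrm{EDD}$ if some sequence of its jobs is at once a longest-processing-time-first sequence (ties by non-decreasing due date) and an earliest-due-date-first sequence (ties by non-decreasing processing time). 1. There is an algorithm with an integer parameter $k\ge 2$, and numbers $\epsilon_k$ with $\epsilon_k\to 0$ as $k\to\infty$, such that for every fixed $k\ge 2$ the algorithm solves $1||\sum T_i$ to optimality on all instances, in polynomial space and in $O^*((2+\epsilon_k)^n)$ time. Its running time on $n$ jobs is bounded by some function $T(n)$ (depending on $k$) for which, with some polynomial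 $p$ (depending on $k$), $$T(n)\le 2T(n-1)+(5k-1)\,T(n-k-1)+p(n)\qquad (n\ge 2k).$$ Moreover, up to a polynomial factor, instances with $\mathrm{LPT}=\mathrm{EDD}$ are worst-case instances: for every fixed $k\ge2$ there is a polynomial $q$ such that for every instance with $n$ jobs there is an instance with $n$ jobs and $\mathrm{LPT}=\mathrm{EDD}$ on which the algorithm takes at least a fraction $1/q(n)$ of the number of steps it takes on the given one. 2. Consequently, for every $\epsilon>0$, the problem $1||\sum T_i$ can be solved in $O^*((2+\epsilon)^n)$ time and polynomial space. -/

import Mathlib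

/-! ### The problem: single machine total tardiness -/

/-- An instance with `n` jobs: job `i` has processing time `p i` and due date `d i`. -/
structure TardinessInstance (n : ℕ) where
  p : Fin n → ℕ
  d : Fin n → ℤ

namespace TardinessInstance

variable {n : ℕ}

/-- A sequence is a permutation `σ`, where `σ i` is the job in position `i`.  Jobs are processed
without idle time from time `0`; this is the completion time of the job in position `i`. -/
def completionTime (I : TardinessInstance n) (σ : Equiv.Perm (Fin n)) (i : Fin n) : ℤ :=
  ∑ j ∈ Finset.univ.filter (fun j => j ≤ i), (I.p (σ j) : ℤ)

/-- `∑ max (C - d) 0` over all jobs. -/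
def totalTardiness (I : TardinessInstance n) (σ : Equiv.Perm (Fin n)) : ℤ :=
  ∑ i, max (I.completionTime σ i - I.d (σ i)) 0

def IsOptimal (I : TardinessInstance n) (σ : Equiv.Perm (Fin n)) : Prop :=
  ∀ τ : Equiv.Perm (Fin n), I.totalTardiness σ ≤ I.totalTardiness τ

/-- `π` lists the jobs by longest processing time first, ties by due date. -/
def IsLPT (I : TardinessInstance n) (π : Equiv.Perm (Fin n)) : Prop :=
  ∀ i j, i < j → I.p (π j) < I.p (π i) ∨ (I.p (π i) = I.p (π j) ∧ I.d (π i) ≤ I.d (π j))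

/-- `π` lists the jobs by earliest due date first, ties by processing time. -/
def IsEDD (I : TardinessInstance n) (π : Equiv.Perm (Fin n)) : Prop :=
  ∀ i j, i < j → I.d (π i) < I.d (π j) ∨ (I.d (π i) = I.d (π j) ∧ I.p (π i) ≤ I.p (π j))

/-- Instances with `LPT = EDD`: some sequence is both an LPT and an EDD sequence. -/
def LPTEqEDD (I : TardinessInstance n) : Prop :=
  ∃ π : Equiv.Perm (Fin n), I.IsLPT π ∧ I.IsEDD π

/-- The length of the instance in binary (up to a constant factor). -/
def bitSize (I : TardinessInstance n) : ℕ :=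
  n + ∑ i, (Nat.size (I.p i) + Nat.size (I.d i).natAbs)

end TardinessInstance

/-! ### The machine model: a random access machine

The instructions are those of the classical RAM (constants, addition, subtraction, indirect read,
indirect write, test for positivity), with structured control instead of jumps.  A program names
finitely many registers; the memory is accessed through addresses held in registers. -/

inductive RamProg where
  /-- `R[x] := c` -/
  | const (x : ℕ) (c : ℤ)
  /-- `R[x] := R[y] + R[z]` -/
  | plus (x y z : ℕ)
  /-- `R[x] := R[y] - R[z]` -/
  | minus (x y z : ℕ)
  /-- `R[x] := M[R[y]]` -/
  | load (x y : ℕ)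
  /-- `M[R[x]] := R[y]` -/
  | store (x y : ℕ)
  /-- first `a`, then `b` -/
  | seq (a b : RamProg)
  /-- if `R[x] > 0` then `a` else `b` -/
  | cond (x : ℕ) (a b : RamProg)
  /-- while `R[x] > 0` do `a` -/
  | loop (x : ℕ) (a : RamProg)

/-- Registers and memory. A negative address is read as address `0`. -/
structure RamState where
  reg : ℕ → ℤ
  mem : ℕ → ℤ

def RamState.setReg (s : RamState) (x : ℕ) (v : ℤ) : RamState :=
  { s with reg := Function.update s.reg x v }

def RamState.setMem (s : RamState) (a : ℕ) (v : ℤ) : RamState :=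
  { s with mem := Function.update s.mem a v }

/-- A configuration: the parts of the program that remain to be executed (finite control; this list
never gets longer than the nesting depth of the program allows) and the state. -/
structure RamConfig where
  todo : List RamProg
  state : RamState

/-- One step of the machine; every instruction and every test costs one step. -/
def RamConfig.step : RamConfig → RamConfig
  | ⟨[], s⟩ => ⟨[], s⟩
  | ⟨.const x c :: k, s⟩ => ⟨k, s.setReg x c⟩
  | ⟨.plus x y z :: k, s⟩ => ⟨k, s.setReg x (s.reg y + s.reg z)⟩
  | ⟨.minus x y z :: k, s⟩ => ⟨k, s.setReg x (s.reg y - s.reg z)⟩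
  | ⟨.load x y :: k, s⟩ => ⟨k, s.setReg x (s.mem (s.reg y).toNat)⟩
  | ⟨.store x y :: k, s⟩ => ⟨k, s.setMem (s.reg x).toNat (s.reg y)⟩
  | ⟨.seq a b :: k, s⟩ => ⟨a :: b :: k, s⟩
  | ⟨.cond x a b :: k, s⟩ => ⟨(if 0 < s.reg x then a else b) :: k, s⟩
  | ⟨.loop x a :: k, s⟩ => ⟨if 0 < s.reg x then a :: .loop x a :: k else k, s⟩

namespace RamProg

variable {n : ℕ}

/-- The initial state: the registers hold `n`, then the additional parameters `args`, then zeros;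
the memory holds `p 0, …, p (n-1), d 0, …, d (n-1)`, then zeros. -/
def initState (args : List ℕ) (I : TardinessInstance n) : RamState where
  reg r := ((n :: args).getD r 0 : ℕ)
  mem a :=
    if h : a < n then (I.p ⟨a, h⟩ : ℤ)
    else if h : a - n < n then I.d ⟨a - n, h⟩
    else 0

/-- The configuration after `t` steps on the parameters `args` and the instance `I`. -/
def run (A : RamProg) (args : List ℕ) (I : TardinessInstance n) (t : ℕ) : RamConfig :=
  RamConfig.step^[t] ⟨[A], initState args I⟩

/-- The program has halted after at most `t` steps. -/
def HaltsWithin (A : RamProg) (args : List ℕ) (I : TardinessInstance n) (t : ℕ) : Prop :=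
  (A.run args I t).todo = []

/-- On every instance the program halts with an optimal sequence in the memory cells
`2n, …, 3n-1` (the cell `2n + i` holds the number of the job in position `i`). -/
def SolvesTotalTardiness (A : RamProg) (args : List ℕ) : Prop :=
  ∀ (n : ℕ) (I : TardinessInstance n), ∃ t : ℕ, A.HaltsWithin args I t ∧
    ∃ σ : Equiv.Perm (Fin n), I.IsOptimal σ ∧
      ∀ i : Fin n, (A.run args I t).state.mem (2 * n + i) = ((σ i : ℕ) : ℤ)

/-- Every instance with `n` jobs is processed in at most `T n` steps. -/
def TimeBoundedBy (A : RamProg) (args : List ℕ) (T : ℕ → ℕ) : Prop :=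
  ∀ (n : ℕ) (I : TardinessInstance n), A.HaltsWithin args I (T n)

/-- Running time `O*(c ^ n)`: at most `q(n) * c ^ n` steps on `n` jobs, for a polynomial `q`. -/
def RunsInOStar (A : RamProg) (args : List ℕ) (c : ℝ) : Prop :=
  ∃ q : Polynomial ℕ, ∀ (n : ℕ) (I : TardinessInstance n),
    ∃ t : ℕ, A.HaltsWithin args I t ∧ (t : ℝ) ≤ (q.eval n : ℕ) * c ^ n

/-- Up to a polynomial factor (as in `O*`), the instances with `LPT = EDD` are worst-case instances:
every instance with `n` jobs needs at most `q(n)` times as many steps as some instance with `n` jobs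
and `LPT = EDD`. -/
def WorstCaseLPTEqEDD (A : RamProg) (args : List ℕ) : Prop :=
  ∃ q : Polynomial ℕ, ∀ (n : ℕ) (I : TardinessInstance n),
    ∃ J : TardinessInstance n, J.LPTEqEDD ∧
      ∀ t : ℕ, A.HaltsWithin args J t → A.HaltsWithin args I (q.eval n * t)

/-- Polynomial space: throughout the computation only the first `q(n)` memory cells are in use, and
every register and every cell holds an integer of at most `q(bitSize)` bits. -/
def UsesPolySpace (A : RamProg) (args : List ℕ) : Prop :=
  ∃ q : Polynomial ℕ, ∀ (n : ℕ) (I : TardinessInstance n) (t : ℕ),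
    (∀ a, (A.run args I t).state.mem a ≠ 0 → a < q.eval n) ∧
    (∀ a, ((A.run args I t).state.mem a).natAbs < 2 ^ q.eval I.bitSize) ∧
    (∀ r, ((A.run args I t).state.reg r).natAbs < 2 ^ q.eval I.bitSize)

end RamProg

/-
Lawler's decomposition: some optimal sequence is such that the jobs before its first longest job are
exactly the other jobs due up to some point, an initial segment in the order of due dates. By
induction, the same holds for a segment of that order started at any time: its longest job is
preceded by its left part and followed by its right part, where the left part consists of jobs that
are not longer. Hence the costs of all segments from position `b` on with the longest job `l` follow
from two smaller instances: the jobs from `b` on without `l`, and the jobs after `l`.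
-/

namespace Tardiness

/-! ### Lawler's decomposition -/

section SeqCost

variable {ι : Type*} (p d : ι → ℤ)

/-- The total tardiness of the sequence of jobs `l`, processed without idle time from time `t`. -/
def seqCost : ℤ → List ι → ℤ
  | _, [] => 0
  | t, i :: l => max (t + p i - d i) 0 + seqCost (t + p i) l

theorem seqCost_nonneg (t : ℤ) (l : List ι) : 0 ≤ seqCost p d t l := by
  induction l generalizing t with
  | nil => exact le_rfl
  | cons i l ih => exact add_nonneg (le_max_right _ _) (ih _)

theorem seqCost_append (t : ℤ) (l l' : List ι) :
    seqCost p d t (l ++ l') = seqCost p d t l + seqCost p d (t + (l.map p).sum) l' := by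
  induction l generalizing t with
  | nil => simp [seqCost]
  | cons i l ih => simp [seqCost, ih, add_assoc]

theorem seqCost_mono (l : List ι) : Monotone fun t => seqCost p d t l := by
  intro t t' h
  induction l generalizing t t' with
  | nil => exact le_rfl
  | cons i l ih =>
    exact add_le_add (max_le_max (by linarith) le_rfl) (ih (add_le_add_left h _))

variable {p} (hp : ∀ i, 0 ≤ p i)
include hp

theorem sum_map_nonneg (l : List ι) : 0 ≤ (l.map p).sum :=
  List.sum_nonneg (by simpa using fun i _ => hp i)

theorem seqCost_le_of_sublist (t : ℤ) {l l' : List ι} (h : l.Sublist l') :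
    seqCost p d t l ≤ seqCost p d t l' := by
  induction h generalizing t with
  | slnil => exact le_rfl
  | cons i _ ih =>
    exact (ih t).trans ((seqCost_mono p d _ (le_add_of_nonneg_right (hp i))).trans
      (le_add_of_nonneg_left (le_max_right _ _)))
  | cons_cons i _ ih => exact add_le_add_right (ih _) _

theorem seqCost_le_length_mul (t Δ : ℤ) (l : List ι) (hΔ : 0 ≤ Δ)
    (h : ∀ i ∈ l, t + (l.map p).sum - d i ≤ Δ) : seqCost p d t l ≤ l.length * Δ := by
  induction l generalizing t with
  | nil => simp [seqCost]
  | cons j l ih =>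
    simp only [List.map_cons, List.sum_cons, List.forall_mem_cons] at h
    have hl := ih (t + p j) fun i hi => by linarith [h.2 i hi]
    have hj : max (t + p j - d j) 0 ≤ Δ := max_le (by linarith [h.1, sum_map_nonneg hp l]) hΔ
    simp only [seqCost, List.length_cons, Nat.cast_add, Nat.cast_one]
    linarith

theorem seqCost_eq_zero (t : ℤ) (l : List ι) (h : ∀ i ∈ l, t + (l.map p).sum ≤ d i) :
    seqCost p d t l = 0 :=
  le_antisymm (by simpa using seqCost_le_length_mul d hp t 0 l le_rfl (by simpa using h))
    (seqCost_nonneg p d t l)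

theorem seqCost_exchange_le (t : ℤ) (x i : ι) (l₁ l₂ : List ι) (hi : p i ≤ p x)
    (hd : d i ≤ max (d x) (t + p x)) :
    seqCost p d t (i :: l₁ ++ x :: l₂) ≤ seqCost p d t (x :: l₁ ++ i :: l₂) := by
  have hl₁ := sum_map_nonneg hp l₁
  have hmid : seqCost p d (t + p i) l₁ ≤ seqCost p d (t + p x) l₁ :=
    seqCost_mono p d l₁ (add_le_add_right hi t)
  have hend : t + p i + (l₁.map p).sum + p x = t + p x + (l₁.map p).sum + p i := by ring
  have htwo : max (t + p i - d i) 0 + max (t + p x + (l₁.map p).sum + p i - d x) 0 ≤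
      max (t + p x - d x) 0 + max (t + p x + (l₁.map p).sum + p i - d i) 0 := by
    have := hp i
    rcases le_max_iff.1 hd with h | h <;> omega
  simp only [List.cons_append, seqCost, seqCost_append, hend]
  linarith

/-- Exchanging `x` with a later job that is due before `x` is due or completed moves `x` back, so
this happens only finitely often. -/
theorem exists_perm_forall_lt_due (t : ℤ) (x : ι) (l₁ l₂ : List ι)
    (hx : ∀ i ∈ l₁ ++ x :: l₂, p i ≤ p x) :
    ∃ l₁' l₂', (l₁' ++ x :: l₂').Perm (l₁ ++ x :: l₂) ∧
      (∀ i ∈ l₂', max (d x) (t + (l₁'.map p).sum + p x) < d i) ∧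
      seqCost p d t (l₁' ++ x :: l₂') ≤ seqCost p d t (l₁ ++ x :: l₂) := by
  induction hn : l₂.length using Nat.strong_induction_on generalizing l₁ l₂ with
  | _ n ih =>
  by_cases hlate : ∀ i ∈ l₂, max (d x) (t + (l₁.map p).sum + p x) < d i
  · exact ⟨l₁, l₂, .rfl, hlate, le_rfl⟩
  push Not at hlate
  obtain ⟨i, hi, hdi⟩ := hlate
  obtain ⟨l₃, l₄, rfl⟩ := List.append_of_mem hi
  have hperm : (l₁ ++ i :: l₃ ++ x :: l₄).Perm (l₁ ++ x :: (l₃ ++ i :: l₄)) := by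
    rw [List.append_assoc]
    exact .append_left _ (((List.perm_middle (l₁ := i :: l₃)).trans
      (.cons x List.perm_middle.symm)))
  obtain ⟨l₁', l₂', hperm', hlate', hle⟩ := ih l₄.length (by simp [← hn]; omega) (l₁ ++ i :: l₃) l₄
    (fun j hj => hx j (hperm.subset hj)) rfl
  refine ⟨l₁', l₂', hperm'.trans hperm, hlate', hle.trans ?_⟩
  rw [List.append_assoc, seqCost_append, seqCost_append p d t l₁]
  gcongr
  exact seqCost_exchange_le d hp _ x i l₃ l₄ (hx i (by simp)) hdi

/-- Postponing a job behind `x` costs nothing if it is due after the completion of `x`. -/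
theorem seqCost_postpone_le (t : ℤ) (x : ι) (l₁ l₂ : List ι) {D : ℤ}
    (hD : t + (l₁.map p).sum + p x ≤ D) :
    seqCost p d t (l₁.filter (d · ≤ D) ++ x :: (l₁.filter (¬ d · ≤ D) ++ l₂)) ≤
      seqCost p d t (l₁ ++ x :: l₂) := by
  set early := l₁.filter (d · ≤ D)
  set late := l₁.filter (¬ d · ≤ D)
  have hsum : (early.map p).sum + (late.map p).sum = (l₁.map p).sum := by
    have h := ((List.filter_append_perm (fun i => decide (d i ≤ D)) l₁).map p).sum_eq
    simpa only [List.map_append, List.sum_append, ← decide_not] using h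
  have hpos := sum_map_nonneg hp late
  have hearly : seqCost p d t early ≤ seqCost p d t l₁ :=
    seqCost_le_of_sublist d hp t List.filter_sublist
  have hzero : seqCost p d (t + (early.map p).sum + p x) late = 0 := by
    refine seqCost_eq_zero d hp _ _ fun i hi => ?_
    have hi : ¬ d i ≤ D := by simpa using (List.mem_filter.1 hi).2
    linarith
  have hx : max (t + (early.map p).sum + p x - d x) 0 ≤ max (t + (l₁.map p).sum + p x - d x) 0 :=
    max_le_max (by linarith) le_rfl
  have hend : t + (early.map p).sum + p x + (late.map p).sum = t + (l₁.map p).sum + p x := by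
    linarith
  simp only [seqCost_append, seqCost, hzero, hend, zero_add]
  linarith

theorem exists_perm_split_by_due (t : ℤ) (x : ι) (l₁ l₂ : List ι)
    (hx : ∀ i ∈ l₁ ++ x :: l₂, p i ≤ p x) :
    ∃ D, d x ≤ D ∧ ∃ l₁' l₂', (l₁' ++ x :: l₂').Perm (l₁ ++ x :: l₂) ∧ (∀ i ∈ l₁', d i ≤ D) ∧
      (∀ i ∈ l₂', D < d i) ∧ seqCost p d t (l₁' ++ x :: l₂') ≤ seqCost p d t (l₁ ++ x :: l₂) := by
  obtain ⟨l₁, l₂, hperm, hlate, hle⟩ := exists_perm_forall_lt_due d hp t x l₁ l₂ hx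
  set D := max (d x) (t + (l₁.map p).sum + p x)
  refine ⟨D, le_max_left _ _, l₁.filter (d · ≤ D), l₁.filter (¬ d · ≤ D) ++ l₂, .trans ?_ hperm,
    fun i hi => by simpa using (List.mem_filter.1 hi).2, fun i hi => ?_,
    (seqCost_postpone_le d hp t x l₁ l₂ (le_max_right _ _)).trans hle⟩
  · refine List.perm_middle.trans (.trans (.cons x ?_) List.perm_middle.symm)
    rw [← List.append_assoc]
    simpa only [← decide_not] using
      (List.filter_append_perm (fun i => decide (d i ≤ D)) l₁).append_right l₂
  · rcases List.mem_append.1 hi with hi | hi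
    · simpa using (List.mem_filter.1 hi).2
    · exact hlate i hi

end SeqCost

section OptCost

variable {ι : Type*}

/-- The list `l` is a sequence of the jobs in `S`: it contains each of them once and no others. -/
def Enumerates (S : Finset ι) (l : List ι) : Prop := (l : Multiset ι) = S.val

namespace Enumerates

variable {S : Finset ι} {l l' : List ι}

theorem mem_iff (h : Enumerates S l) {i : ι} : i ∈ l ↔ i ∈ S := by
  rw [← Finset.mem_val, ← h, Multiset.mem_coe]

theorem sum_map (h : Enumerates S l) (p : ι → ℤ) : (l.map p).sum = ∑ i ∈ S, p i := by
  rw [Finset.sum, ← h, Multiset.map_coe, Multiset.sum_coe]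

theorem length_eq (h : Enumerates S l) : l.length = S.card := by
  rw [Finset.card, ← h, Multiset.coe_card]

theorem perm (h : Enumerates S l) (hl : l'.Perm l) : Enumerates S l' :=
  (Multiset.coe_eq_coe.2 hl).trans h

theorem filter (h : Enumerates S l) (q : ι → Prop) [DecidablePred q] :
    Enumerates (S.filter q) (l.filter q) := by
  rw [Enumerates, Finset.filter_val, ← h, Multiset.filter_coe]

theorem cons (h : Enumerates S l) {j : ι} (hj : j ∉ S) : Enumerates (S.cons j hj) (j :: l) := by
  rw [Enumerates, Finset.cons_val, ← h, Multiset.cons_coe]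

variable [DecidableEq ι]

theorem of_cons {j : ι} (h : Enumerates S (j :: l)) : Enumerates (S.erase j) l := by
  rw [Enumerates, Finset.erase_val, ← h, Multiset.coe_erase, List.erase_cons_head]

theorem cons_of_erase {j : ι} (hj : j ∈ S) (h : Enumerates (S.erase j) l) :
    Enumerates S (j :: l) := by
  simpa only [Finset.cons_eq_insert, Finset.insert_erase hj] using h.cons (S.notMem_erase j)

theorem of_append_cons {x : ι} (h : Enumerates S (l ++ x :: l')) :
    Enumerates (S.erase x) (l ++ l') :=
  (h.perm List.perm_middle.symm).of_cons

theorem append_cons {q : ι → Prop} [DecidablePred q] {x : ι} (hx : x ∈ S.filter q)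
    (h : Enumerates ((S.filter q).erase x) l) (h' : Enumerates (S.filter (¬ q ·)) l') :
    Enumerates S (l ++ x :: l') := by
  have hxl := h.cons_of_erase hx
  refine perm ?_ (l' := l ++ x :: l') (l := x :: l ++ l') List.perm_middle
  rw [Enumerates, ← Multiset.coe_add, hxl, h', Finset.filter_val, Finset.filter_val,
    Multiset.filter_add_not]

end Enumerates

theorem enumerates_toList (S : Finset ι) : Enumerates S S.toList := S.coe_toList

variable (p d : ι → ℤ)

/-- The least total tardiness of the jobs in `S`, processed from time `t`. -/
noncomputable def optCost (t : ℤ) (S : Finset ι) : ℤ :=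
  sInf (seqCost p d t '' {l | Enumerates S l})

theorem isLeast_optCost (t : ℤ) (S : Finset ι) :
    IsLeast (seqCost p d t '' {l | Enumerates S l}) (optCost p d t S) := by
  have hbdd : BddBelow (seqCost p d t '' {l | Enumerates S l}) :=
    ⟨0, Set.forall_mem_image.2 fun l _ => seqCost_nonneg p d t l⟩
  exact ⟨Int.csInf_mem ⟨_, S.toList, enumerates_toList S, rfl⟩ hbdd, fun _ hx => csInf_le hbdd hx⟩

theorem exists_seqCost_eq_optCost (t : ℤ) (S : Finset ι) :
    ∃ l, Enumerates S l ∧ seqCost p d t l = optCost p d t S :=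
  (isLeast_optCost p d t S).1

variable {S : Finset ι}

theorem optCost_le_seqCost (t : ℤ) {l : List ι} (h : Enumerates S l) :
    optCost p d t S ≤ seqCost p d t l :=
  (isLeast_optCost p d t S).2 ⟨l, h, rfl⟩

theorem optCost_nonneg (t : ℤ) (S : Finset ι) : 0 ≤ optCost p d t S := by
  obtain ⟨l, -, h⟩ := exists_seqCost_eq_optCost p d t S
  exact h ▸ seqCost_nonneg p d t l

theorem optCost_empty (t : ℤ) : optCost p d t ∅ = 0 :=
  le_antisymm (optCost_le_seqCost p d t (l := []) rfl) (optCost_nonneg p d t ∅)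

theorem optCost_le_card_mul (hp : ∀ i, 0 ≤ p i) (t : ℤ) {Δ : ℤ} (hΔ : 0 ≤ Δ)
    (h : ∀ i ∈ S, t + ∑ j ∈ S, p j - d i ≤ Δ) :
    optCost p d t S ≤ S.card * Δ := by
  have hE := enumerates_toList S
  rw [← hE.length_eq]
  exact (optCost_le_seqCost p d t hE).trans (seqCost_le_length_mul d hp t Δ _ hΔ
    fun i hi => by simpa only [hE.sum_map] using h i (hE.mem_iff.1 hi))

variable [DecidableEq ι]

/-- The least total tardiness of the jobs in `S`, processed from time `t`, if job `j` comes
first. -/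
noncomputable def optCostFirst (t : ℤ) (S : Finset ι) (j : ι) : ℤ :=
  max (t + p j - d j) 0 + optCost p d (t + p j) (S.erase j)

theorem optCostFirst_nonneg (t : ℤ) (S : Finset ι) (j : ι) : 0 ≤ optCostFirst p d t S j :=
  add_nonneg (le_max_right _ _) (optCost_nonneg ..)

theorem optCost_le_optCostFirst (t : ℤ) {j : ι} (hj : j ∈ S) :
    optCost p d t S ≤ optCostFirst p d t S j := by
  obtain ⟨l, hl, h⟩ := exists_seqCost_eq_optCost p d (t + p j) (S.erase j)
  rw [optCostFirst, ← h]
  exact optCost_le_seqCost p d t (hl.cons_of_erase hj)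

theorem isLeast_optCostFirst (t : ℤ) (hS : S.Nonempty) :
    IsLeast (optCostFirst p d t S '' S) (optCost p d t S) := by
  refine ⟨?_, Set.forall_mem_image.2 fun j hj => optCost_le_optCostFirst p d t hj⟩
  obtain ⟨l, hl, h⟩ := exists_seqCost_eq_optCost p d t S
  cases l with
  | nil => exact absurd (Finset.val_eq_zero.1 hl.symm) hS.ne_empty
  | cons j l =>
    have hj : j ∈ S := hl.mem_iff.1 List.mem_cons_self
    refine ⟨j, hj, le_antisymm ?_ (optCost_le_optCostFirst p d t hj)⟩
    rw [← h, seqCost]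
    exact add_le_add_right (optCost_le_seqCost p d _ hl.of_cons) _

theorem optCost_le_split (t : ℤ) {q : ι → Prop} [DecidablePred q] {x : ι} (hx : x ∈ S.filter q) :
    optCost p d t S ≤ optCost p d t ((S.filter q).erase x) +
      max (t + ∑ i ∈ S with q i, p i - d x) 0 +
      optCost p d (t + ∑ i ∈ S with q i, p i) (S.filter (¬ q ·)) := by
  obtain ⟨l, hl, h⟩ := exists_seqCost_eq_optCost p d t ((S.filter q).erase x)
  obtain ⟨l', hl', h'⟩ :=
    exists_seqCost_eq_optCost p d (t + ∑ i ∈ S with q i, p i) (S.filter (¬ q ·))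
  have hsum : t + (l.map p).sum + p x = t + ∑ i ∈ S with q i, p i := by
    rw [hl.sum_map, add_assoc, Finset.sum_erase_add _ _ hx]
  refine (optCost_le_seqCost p d t (hl.append_cons hx hl')).trans (le_of_eq ?_)
  rw [seqCost_append, seqCost, hsum, h, h', add_assoc]

variable {p} (hp : ∀ i, 0 ≤ p i)
include hp

/-- Lawler's decomposition theorem: some optimal sequence has the longest job `x` behind exactly
the other jobs due by some date `D`. -/
theorem exists_optCost_split (t : ℤ) {x : ι} (hx : x ∈ S) (hmax : ∀ i ∈ S, p i ≤ p x) :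
    ∃ D, d x ≤ D ∧ optCost p d t ((S.filter (d · ≤ D)).erase x) +
      max (t + ∑ i ∈ S with d i ≤ D, p i - d x) 0 +
      optCost p d (t + ∑ i ∈ S with d i ≤ D, p i) (S.filter (¬ d · ≤ D)) ≤ optCost p d t S := by
  obtain ⟨l, hl, h⟩ := exists_seqCost_eq_optCost p d t S
  obtain ⟨l₁, l₂, rfl⟩ := List.append_of_mem (hl.mem_iff.2 hx)
  obtain ⟨D, hxD, l₁, l₂, hperm, hl₁, hl₂, hle⟩ :=
    exists_perm_split_by_due d hp t x l₁ l₂ fun i hi => hmax i (hl.mem_iff.1 hi)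
  have hE := hl.perm hperm
  have hbefore : Enumerates (S.filter (d · ≤ D)) (l₁ ++ [x]) := by
    have hl₁ : l₁.filter (d · ≤ D) = l₁ := List.filter_eq_self.2 (by simpa using hl₁)
    have hl₂ : l₂.filter (d · ≤ D) = [] := List.filter_eq_nil_iff.2 (by simpa using hl₂)
    simpa [hl₁, hl₂, hxD] using hE.filter (d · ≤ D)
  have hafter : Enumerates (S.filter (¬ d · ≤ D)) l₂ := by
    have hl₁ : l₁.filter (D < d ·) = [] := List.filter_eq_nil_iff.2 (by simpa using hl₁)
    have hl₂ : l₂.filter (D < d ·) = l₂ := List.filter_eq_self.2 (by simpa using hl₂)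
    simpa [hl₁, hl₂, hxD] using hE.filter (¬ d · ≤ D)
  have hsum : t + (l₁.map p).sum + p x = t + ∑ i ∈ S with d i ≤ D, p i := by
    simp [← hbefore.sum_map, add_assoc]
  have h₁ := optCost_le_seqCost p d t (List.append_nil l₁ ▸ hbefore.of_append_cons)
  have h₂ := optCost_le_seqCost p d (t + ∑ i ∈ S with d i ≤ D, p i) hafter
  refine ⟨D, hxD, le_trans ?_ (hle.trans_eq h)⟩
  rw [seqCost_append, seqCost, hsum]
  linarith

end OptCost

section SegCost

variable (p d : ℕ → ℤ)

/-- The total processing time of the jobs of `A` before `c`. -/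
def prefixSum (A : Finset ℕ) (c : ℕ) : ℤ := ∑ i ∈ Finset.range c with i ∈ A, p i

/-- The jobs of `A` in the interval `[u, v)`. -/
def seg (A : Finset ℕ) (u v : ℕ) : Finset ℕ := {i ∈ A | u ≤ i ∧ i < v}

/-- The least total tardiness of the jobs of `A` in `[u, v)` when the jobs of `A` are processed from
time `t` and those before `u` come first. -/
noncomputable def segCost (t : ℤ) (A : Finset ℕ) (u v : ℕ) : ℤ :=
  optCost p d (t + prefixSum p A u) (seg A u v)

/-- The least total tardiness of the jobs counted by `segCost p d t A u v` when `x` comes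
immediately before the jobs from `c` on. -/
noncomputable def cutCost (t : ℤ) (A : Finset ℕ) (x u v c : ℕ) : ℤ :=
  segCost p d t (A.erase x) u c + max (t + prefixSum p A c - d x) 0 + segCost p d t A c v

variable {A : Finset ℕ} {u v c x : ℕ} {t : ℤ}

theorem mem_seg {i : ℕ} : i ∈ seg A u v ↔ i ∈ A ∧ u ≤ i ∧ i < v := Finset.mem_filter

theorem seg_erase : seg (A.erase x) u v = (seg A u v).erase x := Finset.filter_erase ..

theorem filter_lt_seg (hcv : c ≤ v) : {i ∈ seg A u v | i < c} = seg A u c := by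
  ext i; simp only [Finset.mem_filter, mem_seg]; grind

theorem filter_not_lt_seg (huc : u ≤ c) : {i ∈ seg A u v | ¬ i < c} = seg A c v := by
  ext i; simp only [Finset.mem_filter, mem_seg]; grind

theorem prefixSum_zero (A : Finset ℕ) : prefixSum p A 0 = 0 := rfl

theorem prefixSum_succ (A : Finset ℕ) (c : ℕ) :
    prefixSum p A (c + 1) = prefixSum p A c + if c ∈ A then p c else 0 := by
  simp only [prefixSum, Finset.sum_filter, Finset.sum_range_succ]

theorem prefixSum_add_sum_seg (h : u ≤ c) :
    prefixSum p A u + ∑ i ∈ seg A u c, p i = prefixSum p A c := by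
  have hsum := Finset.sum_filter_add_sum_filter_not ({i ∈ Finset.range c | i ∈ A}) (· < u) p
  rw [prefixSum, prefixSum, ← hsum]
  congr 2 <;> ext i <;> simp only [Finset.mem_filter, Finset.mem_range, mem_seg] <;> grind

theorem prefixSum_erase (h : u ≤ x) : prefixSum p (A.erase x) u = prefixSum p A u := by
  refine Finset.sum_congr (Finset.filter_congr fun i hi => ?_) fun _ _ => rfl
  have := Finset.mem_range.1 hi
  rw [Finset.mem_erase, and_iff_right (by omega)]

theorem segCost_nonneg (t : ℤ) (A : Finset ℕ) (u v : ℕ) : 0 ≤ segCost p d t A u v :=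
  optCost_nonneg ..

theorem segCost_of_seg_eq_empty (h : seg A u v = ∅) : segCost p d t A u v = 0 := by
  rw [segCost, h, optCost_empty]

theorem segCost_erase (hu : u ≤ x) (hv : v ≤ x) :
    segCost p d t (A.erase x) u v = segCost p d t A u v := by
  rw [segCost, segCost, prefixSum_erase p hu, seg_erase, Finset.erase_eq_of_notMem]
  rw [mem_seg]
  omega

theorem segCost_zero_eq_optCost {n : ℕ} (hA : A ⊆ Finset.range n) :
    segCost p d t A 0 n = optCost p d t A := by
  have hseg : seg A 0 n = A :=
    Finset.filter_true_of_mem fun i hi => ⟨i.zero_le, Finset.mem_range.1 (hA hi)⟩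
  rw [segCost, hseg, prefixSum_zero, add_zero]

theorem optCost_split_eq_cutCost (hux : u ≤ x) (hxc : x < c) (hcv : c ≤ v) :
    optCost p d (t + prefixSum p A u) ({i ∈ seg A u v | i < c}.erase x) +
      max (t + prefixSum p A u + ∑ i ∈ seg A u v with i < c, p i - d x) 0 +
      optCost p d (t + prefixSum p A u + ∑ i ∈ seg A u v with i < c, p i)
        {i ∈ seg A u v | ¬ i < c} = cutCost p d t A x u v c := by
  have huc : u ≤ c := hux.trans hxc.le
  rw [filter_lt_seg hcv, filter_not_lt_seg huc, add_assoc t, prefixSum_add_sum_seg p huc,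
    cutCost, segCost, segCost, prefixSum_erase p hux, seg_erase]

variable {p} (hp : ∀ i, 0 ≤ p i)
include hp

theorem segCost_le {n : ℕ} (hA : A ⊆ Finset.range n) {Δ : ℤ} (hΔ : 0 ≤ Δ)
    (h : ∀ i ∈ A, t + ∑ j ∈ A, p j - d i ≤ Δ) : segCost p d t A u v ≤ n * Δ := by
  have hseg : seg A u v ⊆ A := Finset.filter_subset ..
  rcases lt_or_ge v u with huv | huv
  · rw [segCost_of_seg_eq_empty p d (Finset.filter_false_of_mem fun i _ => by omega)]
    positivity
  have hle : prefixSum p A u + ∑ j ∈ seg A u v, p j ≤ ∑ j ∈ A, p j := by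
    rw [prefixSum_add_sum_seg p huv]
    exact Finset.sum_le_sum_of_subset_of_nonneg (fun i hi => (Finset.mem_filter.1 hi).2)
      fun i _ _ => hp i
  refine (optCost_le_card_mul p d hp _ hΔ fun i hi => ?_).trans (mul_le_mul_of_nonneg_right ?_ hΔ)
  · linarith [h i (hseg hi)]
  · exact_mod_cast (Finset.card_le_card (hseg.trans hA)).trans_eq (Finset.card_range n)

/-- When the jobs are numbered by due date, the jobs due by a given date form an initial segment. -/
theorem isLeast_segCost (hd : MonotoneOn d A) (hx : x ∈ seg A u v)
    (hmax : ∀ i ∈ seg A u v, p i ≤ p x) :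
    IsLeast (cutCost p d t A x u v '' Set.Ioc x v) (segCost p d t A u v) := by
  have hux := (mem_seg.1 hx).2.1
  refine ⟨?_, Set.forall_mem_image.2 fun c hc => ?_⟩
  · obtain ⟨D, hxD, hle⟩ := exists_optCost_split d hp (t + prefixSum p A u) hx hmax
    have hxS : x ∈ {i ∈ seg A u v | d i ≤ D} := Finset.mem_filter.2 ⟨hx, hxD⟩
    obtain ⟨y, hy, hymax⟩ := Finset.exists_max_image _ id ⟨x, hxS⟩
    have hyS := mem_seg.1 (Finset.mem_filter.1 hy).1
    have hiff : ∀ i ∈ seg A u v, d i ≤ D ↔ i < y + 1 := fun i hi =>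
      ⟨fun h => Nat.lt_succ_of_le (hymax i (Finset.mem_filter.2 ⟨hi, h⟩)), fun h =>
        (hd (mem_seg.1 hi).1 hyS.1 (Nat.le_of_lt_succ h)).trans (Finset.mem_filter.1 hy).2⟩
    have hxy : x < y + 1 := Nat.lt_succ_of_le (hymax x hxS)
    rw [Finset.filter_congr hiff, Finset.filter_congr fun i hi => (hiff i hi).not,
      optCost_split_eq_cutCost p d hux hxy hyS.2.2] at hle
    refine ⟨y + 1, ⟨hxy, hyS.2.2⟩, hle.antisymm ?_⟩
    rw [← optCost_split_eq_cutCost p d hux hxy hyS.2.2]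
    exact optCost_le_split p d _ (Finset.mem_filter.2 ⟨hx, hxy⟩)
  · rw [← optCost_split_eq_cutCost p d hux hc.1 hc.2]
    exact optCost_le_split p d _ (Finset.mem_filter.2 ⟨hx, hc.1⟩)

end SegCost

end Tardiness

/-! ### Runs of the machine -/

namespace RamProg

/-- Big-step semantics: `a`, started in `s`, halts in `s'` after `t` steps. All states before `s'`
satisfy `G`; it suffices to demand this at the steps that remove a program from the list of things
to do, because the other steps do not change the state. -/
inductive Exec (G : RamState → Prop) : RamProg → RamState → RamState → ℕ → Prop
  | one {a s s'} (h : ∀ k, RamConfig.step ⟨a :: k, s⟩ = ⟨k, s'⟩) (hs : G s) : Exec G a s s' 1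
  | seq {a b s s' s'' t t'} (ha : Exec G a s s' t) (hb : Exec G b s' s'' t') :
      Exec G (.seq a b) s s'' (1 + t + t')
  | cond {x a b s s' t} (h : Exec G (if 0 < s.reg x then a else b) s s' t) :
      Exec G (.cond x a b) s s' (1 + t)
  | round {x a s s' s'' t t'} (hx : 0 < s.reg x) (ha : Exec G a s s' t)
      (hl : Exec G (.loop x a) s' s'' t') : Exec G (.loop x a) s s'' (1 + t + t')

/-- The machine gets from `c` to `c'` in `t` steps, and before that the state satisfies `G` and
more than `l` programs remain to be executed. -/
def Reaches (G : RamState → Prop) (l : ℕ) (c c' : RamConfig) (t : ℕ) : Prop :=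
  RamConfig.step^[t] c = c' ∧
    ∀ i < t, l < (RamConfig.step^[i] c).todo.length ∧ G (RamConfig.step^[i] c).state

variable {G : RamState → Prop} {l : ℕ} {c c' c'' : RamConfig} {t t' : ℕ}

theorem Reaches.trans (h : Reaches G l c c' t) (h' : Reaches G l c' c'' t') :
    Reaches G l c c'' (t + t') := by
  refine ⟨by rw [add_comm, Function.iterate_add_apply, h.1, h'.1], fun i hi => ?_⟩
  rcases lt_or_ge i t with hit | hit
  · exact h.2 i hit
  · obtain ⟨j, rfl⟩ := Nat.exists_eq_add_of_le hit
    rw [add_comm, Function.iterate_add_apply, h.1]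
    exact h'.2 j (by omega)

theorem Reaches.step (hl : l < c.todo.length) (hc : G c.state) (h : RamConfig.step c = c') :
    Reaches G l c c' 1 :=
  ⟨h, fun i hi => by obtain rfl : i = 0 := by omega
                     exact ⟨hl, hc⟩⟩

theorem Reaches.mono (h : Reaches G l c c' t) {l' : ℕ} (hl : l' ≤ l) : Reaches G l' c c' t :=
  ⟨h.1, fun i hi => ⟨hl.trans_lt (h.2 i hi).1, (h.2 i hi).2⟩⟩

namespace Exec

variable {a : RamProg} {s s' : RamState}

theorem guard_start (h : Exec G a s s' t) : G s := by
  induction h <;> assumption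

theorem reaches (h : Exec G a s s' t) (k : List RamProg) :
    Reaches G k.length ⟨a :: k, s⟩ ⟨k, s'⟩ t := by
  induction h generalizing k with
  | one h hs => exact .step (by simp) hs (h k)
  | seq ha _ iha ihb =>
    exact ((Reaches.step (by simp) ha.guard_start rfl).trans ((iha _).mono (by simp))).trans (ihb k)
  | cond h ih => exact (Reaches.step (by simp) h.guard_start rfl).trans (ih k)
  | round hx ha _ iha ihl =>
    exact ((Reaches.step (by simp) ha.guard_start (by simp [RamConfig.step, hx])).trans
      ((iha _).mono (by simp))).trans (ihl k)

end Exec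

theorem iterate_step_nil (s : RamState) (t : ℕ) : RamConfig.step^[t] ⟨[], s⟩ = ⟨[], s⟩ :=
  Function.iterate_fixed rfl t

variable {A : RamProg} {args : List ℕ} {n : ℕ} {I : TardinessInstance n} {s' : RamState}

theorem Exec.run_of_le (h : Exec G A (initState args I) s' t) {T : ℕ} (hT : t ≤ T) :
    A.run args I T = ⟨[], s'⟩ := by
  obtain ⟨i, rfl⟩ := Nat.exists_eq_add_of_le' hT
  rw [run, Function.iterate_add_apply, (h.reaches []).1, iterate_step_nil]

theorem Exec.haltsWithin_iff (h : Exec G A (initState args I) s' t) {T : ℕ} :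
    A.HaltsWithin args I T ↔ t ≤ T := by
  refine ⟨fun hT => ?_, fun hT => by rw [HaltsWithin, h.run_of_le hT]⟩
  by_contra! hlt
  have := ((h.reaches []).2 T hlt).1
  rw [HaltsWithin, run] at hT
  simp [hT] at this

theorem Exec.guard_run (h : Exec G A (initState args I) s' t) (hs' : G s') (T : ℕ) :
    G (A.run args I T).state := by
  rcases lt_or_ge T t with hT | hT
  · exact ((h.reaches []).2 T hT).2
  · rwa [h.run_of_le hT]

end RamProg

section Growth

/-- Only the first `m` memory cells are in use. -/
def SupportedBelow (m : ℕ) (s : RamState) : Prop := ∀ a, m ≤ a → s.mem a = 0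

/-- Registers and memory hold integers of absolute value at most `B`. -/
def BoundedBy (B : ℤ) (s : RamState) : Prop := (∀ r, |s.reg r| ≤ B) ∧ ∀ a, |s.mem a| ≤ B

/-- All constants in the program have absolute value at most `1`. -/
def RamProg.UnitConsts : RamProg → Prop
  | .const _ c => |c| ≤ 1
  | .seq a b => a.UnitConsts ∧ b.UnitConsts
  | .cond _ a b => a.UnitConsts ∧ b.UnitConsts
  | .loop _ a => a.UnitConsts
  | _ => True

/-- The space bound of the algorithm: both `SupportedBelow m` and `BoundedBy B`. -/
def WithinBounds (m : ℕ) (B : ℤ) (s : RamState) : Prop := SupportedBelow m s ∧ BoundedBy B s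

variable {m : ℕ} {B C : ℤ} {s s' : RamState} {t : ℕ} {a : RamProg}

theorem BoundedBy.mono (h : BoundedBy B s) (hBC : B ≤ C) : BoundedBy C s :=
  ⟨fun r => (h.1 r).trans hBC, fun a => (h.2 a).trans hBC⟩

theorem BoundedBy.setReg (h : BoundedBy B s) (x : ℕ) {v : ℤ} (hv : |v| ≤ B) :
    BoundedBy B (s.setReg x v) := by
  refine ⟨fun r => ?_, h.2⟩
  rcases eq_or_ne r x with rfl | hr
  · simpa [RamState.setReg] using hv
  · simpa [RamState.setReg, hr] using h.1 r

theorem BoundedBy.setMem (h : BoundedBy B s) (a : ℕ) {v : ℤ} (hv : |v| ≤ B) :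
    BoundedBy B (s.setMem a v) := by
  refine ⟨h.1, fun r => ?_⟩
  rcases eq_or_ne r a with rfl | hr
  · simpa [RamState.setMem] using hv
  · simpa [RamState.setMem, hr] using h.2 r

theorem BoundedBy.step_singleton (h : BoundedBy B s) (hB : 1 ≤ B) (ha : a.UnitConsts) :
    BoundedBy (2 * B) (RamConfig.step ⟨[a], s⟩).state := by
  have h2 := h.mono (by linarith : B ≤ 2 * B)
  cases a with
  | const x c => exact h2.setReg x (le_trans ha (by linarith))
  | plus x y z => exact h2.setReg x ((abs_add_le _ _).trans (by linarith [h.1 y, h.1 z]))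
  | minus x y z => exact h2.setReg x ((abs_sub _ _).trans (by linarith [h.1 y, h.1 z]))
  | load x y => exact h2.setReg x (h2.2 _)
  | store x y => exact h2.setMem _ (h2.1 y)
  | seq | cond | loop => exact h2

/-- Every step at most doubles the largest absolute value held by the machine. -/
theorem RamProg.Exec.withinBounds (h : Exec (SupportedBelow m) a s s' t) (ha : a.UnitConsts)
    (hB : 1 ≤ B) (hs : BoundedBy B s) (hC : 2 ^ t * B ≤ C) :
    Exec (WithinBounds m C) a s s' t ∧ BoundedBy (2 ^ t * B) s' := by
  have hpow : ∀ {B : ℤ} {t t' : ℕ}, 1 ≤ B → t ≤ t' → 2 ^ t * B ≤ 2 ^ t' * B := fun hB ht =>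
    mul_le_mul_of_nonneg_right (pow_le_pow_right₀ one_le_two ht) (by linarith)
  have hone : ∀ {B : ℤ} {t : ℕ}, 1 ≤ B → 1 ≤ 2 ^ t * B := fun hB =>
    one_le_mul_of_one_le_of_one_le (one_le_pow₀ one_le_two) hB
  have hadd : ∀ {B : ℤ} {t t' : ℕ}, 1 ≤ B → 2 ^ t' * (2 ^ t * B) ≤ 2 ^ (1 + t + t') * B :=
    fun {B t t'} hB => by
      rw [← mul_assoc, ← pow_add]
      exact hpow hB (by omega)
  induction h generalizing B with
  | one h hsupp =>
    rw [pow_one] at hC ⊢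
    have hstep := hs.step_singleton hB ha
    rw [h []] at hstep
    exact ⟨.one h ⟨hsupp, hs.mono (by linarith)⟩, hstep⟩
  | seq _ _ iha ihb =>
    obtain ⟨h₁, hb₁⟩ := iha ha.1 hB hs ((hpow hB (by omega)).trans hC)
    obtain ⟨h₂, hb₂⟩ := ihb ha.2 (hone hB) hb₁ ((hadd hB).trans hC)
    exact ⟨.seq h₁ h₂, hb₂.mono (hadd hB)⟩
  | @cond x a b s _ t _ ih =>
    have ha' : (if 0 < s.reg x then a else b).UnitConsts := by
      split_ifs
      exacts [ha.1, ha.2]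
    obtain ⟨h₁, hb₁⟩ := ih ha' hB hs ((hpow hB (by omega)).trans hC)
    exact ⟨.cond h₁, hb₁.mono (hpow hB (by omega))⟩
  | round hx _ _ iha ihl =>
    obtain ⟨h₁, hb₁⟩ := iha ha hB hs ((hpow hB (by omega)).trans hC)
    obtain ⟨h₂, hb₂⟩ := ihl ha (hone hB) hb₁ ((hadd hB).trans hC)
    exact ⟨.round hx h₁ h₂, hb₂.mono (hadd hB)⟩

end Growth

/-! ### Composing time bounds -/

section Runs

namespace RamProg

/-- `a`, started in `s`, halts with `Q` after at least `lo` and at most `hi` steps, and `G` holds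
throughout. -/
def Runs (G : RamState → Prop) (a : RamProg) (s : RamState) (lo hi : ℕ) (Q : RamState → Prop) :
    Prop :=
  ∃ s' t, Exec G a s s' t ∧ lo ≤ t ∧ t ≤ hi ∧ Q s'

variable {G Q : RamState → Prop} {a b : RamProg} {s s' s'' : RamState} {lo lo' hi hi' x : ℕ}

theorem Runs.mono {Q' : RamState → Prop} (h : Runs G a s lo hi Q) (hlo : lo' ≤ lo)
    (hhi : hi ≤ hi') (hQ : ∀ s, Q s → Q' s) : Runs G a s lo' hi' Q' :=
  let ⟨s', t, he, hl, hh, hq⟩ := h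
  ⟨s', t, he, hlo.trans hl, hh.trans hhi, hQ s' hq⟩

theorem Runs.one (h : ∀ k, RamConfig.step ⟨a :: k, s⟩ = ⟨k, s'⟩) (hs : G s) (hQ : Q s') :
    Runs G a s 0 1 Q :=
  ⟨s', 1, .one h hs, Nat.zero_le _, le_rfl, hQ⟩

theorem Runs.seq {P : RamState → Prop} (h : Runs G a s lo hi P)
    (h' : ∀ s', P s' → Runs G b s' lo' hi' Q) :
    Runs G (.seq a b) s (1 + lo + lo') (1 + hi + hi') Q := by
  obtain ⟨s', t, he, hl, hh, hp⟩ := h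
  obtain ⟨s'', t', he', hl', hh', hq⟩ := h' s' hp
  exact ⟨s'', _, .seq he he', by omega, by omega, hq⟩

theorem Runs.cond (hpos : 0 < s.reg x → Runs G a s lo hi Q)
    (hneg : s.reg x ≤ 0 → Runs G b s lo hi Q) : Runs G (.cond x a b) s lo (1 + hi) Q := by
  have h : Runs G (if 0 < s.reg x then a else b) s lo hi Q := by
    split_ifs with hx
    exacts [hpos hx, hneg (not_lt.1 hx)]
  obtain ⟨s', t, he, hl, hh, hq⟩ := h
  exact ⟨s', _, .cond he, by omega, by omega, hq⟩

theorem Runs.loop {Inv : ℕ → RamState → Prop} {k : ℕ} {lo : ℕ → ℕ}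
    (hx : ∀ i s, Inv i s → s.reg x = i) (hG : ∀ s, Inv 0 s → G s)
    (hstep : ∀ i < k, ∀ s, Inv (i + 1) s → Runs G a s (lo i) hi (Inv i)) (h₀ : Inv k s) :
    Runs G (.loop x a) s (∑ i ∈ Finset.range k, lo i) (1 + k * (1 + hi)) (Inv 0) := by
  induction k generalizing s with
  | zero =>
    have h := hx _ _ h₀
    exact ⟨s, 1, .one (fun k => by simp [RamConfig.step, h]) (hG s h₀), by simp, by simp, h₀⟩
  | succ k ih =>
    obtain ⟨s', t, he, hl, hh, hs'⟩ := hstep k (by omega) s h₀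
    obtain ⟨s'', t', he', hl', hh', hq⟩ := ih (fun i hi => hstep i (by omega)) hs'
    refine ⟨s'', _, .round (by rw [hx _ _ h₀]; positivity) he he', ?_, by linarith, hq⟩
    rw [Finset.sum_range_succ]
    omega

/-- `r` rounds of `loop x a`, of at most `τ` steps each, take the machine from `s` to `s'`. -/
inductive Rounds (G : RamState → Prop) (x : ℕ) (a : RamProg) (τ : ℕ) :
    ℕ → RamState → RamState → Prop
  | refl (s : RamState) : Rounds G x a τ 0 s s
  | head {r : ℕ} {s s' s'' : RamState} (hx : 0 < s.reg x) (h : Runs G a s 0 τ (· = s'))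
      (hr : Rounds G x a τ r s' s'') : Rounds G x a τ (r + 1) s s''

variable {τ r r' : ℕ}

theorem Rounds.trans (h : Rounds G x a τ r s s') (h' : Rounds G x a τ r' s' s'') :
    Rounds G x a τ (r + r') s s'' := by
  induction h with
  | refl => rwa [zero_add]
  | @head r _ _ _ hx ha _ ih =>
    rw [Nat.add_right_comm]
    exact .head hx ha (ih h')

theorem Runs.rounds (hx : 0 < s.reg x) (h : Runs G a s 0 τ Q) :
    ∃ s', Rounds G x a τ 1 s s' ∧ Q s' :=
  let ⟨s', t, he, hl, hh, hq⟩ := h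
  ⟨s', .head hx ⟨s', t, he, hl, hh, rfl⟩ (.refl s'), hq⟩

theorem Rounds.runs_loop (h : Rounds G x a τ r s s') (hx : s'.reg x ≤ 0) (hG : G s') :
    Runs G (.loop x a) s r (1 + r * (1 + τ)) (· = s') := by
  induction h with
  | refl s => exact ⟨s, 1, .one (fun k => by simp [RamConfig.step, hx.not_gt]) hG, by simp⟩
  | head hx' ha _ ih =>
    obtain ⟨_, t, he, -, ht, rfl⟩ := ha
    obtain ⟨s', t', he', hl', hh', hq⟩ := ih hx hG
    exact ⟨s', _, .round hx' he he', by omega, by linarith, hq⟩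

end RamProg

end Runs

/-! ### Weakest preconditions -/

section WeakestPrecondition

namespace RamProg

/-- A bound on the number of steps, provided that no loop inside the program takes more than
`n + 1` rounds; it is a polynomial in `n`. -/
noncomputable def cost : RamProg → Polynomial ℕ
  | .seq a b => 1 + a.cost + b.cost
  | .cond _ a b => 1 + a.cost + b.cost
  | .loop _ a => 1 + (Polynomial.X + 1) * (1 + a.cost)
  | _ => 1

/-- Weakest precondition for `a` to halt with `Q` after at most `N + 1` rounds of each of its loops,
without writing to a memory cell outside `0, …, m - 1`. For a loop this asks for an invariant
indexed by the number of remaining rounds. -/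
def wp (m N : ℕ) : RamProg → (RamState → Prop) → RamState → Prop
  | .const x c, Q, s => Q (s.setReg x c)
  | .plus x y z, Q, s => Q (s.setReg x (s.reg y + s.reg z))
  | .minus x y z, Q, s => Q (s.setReg x (s.reg y - s.reg z))
  | .load x y, Q, s => Q (s.setReg x (s.mem (s.reg y).toNat))
  | .store x y, Q, s => (s.reg x).toNat < m ∧ Q (s.setMem (s.reg x).toNat (s.reg y))
  | .seq a b, Q, s => a.wp m N (b.wp m N Q) s
  | .cond x a b, Q, s => if 0 < s.reg x then a.wp m N Q s else b.wp m N Q s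
  | .loop x a, Q, s => ∃ k ≤ N + 1, ∃ Inv : ℕ → RamState → Prop,
      (∀ i s, Inv i s → s.reg x = i) ∧ Inv k s ∧
      (∀ i < k, ∀ s, Inv (i + 1) s → a.wp m N (Inv i) s) ∧ ∀ s, Inv 0 s → Q s

variable {m N : ℕ} {a b : RamProg} {Q : RamState → Prop} {s : RamState} {x : ℕ}

theorem wp_cond (hpos : 0 < s.reg x → a.wp m N Q s) (hneg : s.reg x ≤ 0 → b.wp m N Q s) :
    (cond x a b).wp m N Q s := by
  rw [wp]
  split_ifs with h
  exacts [hpos h, hneg (not_lt.1 h)]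

/-- The loop rule for a counter: `Inv k` describes the states with `k` rounds to go. -/
theorem wp_loop (k : ℕ) (Inv : ℕ → RamState → Prop) (hk : k ≤ N + 1)
    (hx : ∀ i s, Inv i s → s.reg x = i) (h₀ : Inv k s)
    (hstep : ∀ i < k, ∀ s, Inv (i + 1) s → a.wp m N (Inv i) s) (hend : ∀ s, Inv 0 s → Q s) :
    (loop x a).wp m N Q s :=
  ⟨k, hk, Inv, hx, h₀, hstep, hend⟩

end RamProg

variable {m N : ℕ} {a : RamProg} {Q : RamState → Prop} {s : RamState}

theorem SupportedBelow.setReg (h : SupportedBelow m s) (x : ℕ) (v : ℤ) :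
    SupportedBelow m (s.setReg x v) := h

theorem SupportedBelow.setMem (h : SupportedBelow m s) {x : ℕ} (hx : x < m) (v : ℤ) :
    SupportedBelow m (s.setMem x v) := fun y hy =>
  (Function.update_of_ne (by omega) _ _).trans (h y hy)

namespace RamProg

theorem wp.runs_supportedBelow (h : a.wp m N Q s) (hs : SupportedBelow m s) :
    Runs (SupportedBelow m) a s 0 (a.cost.eval N) fun s' => SupportedBelow m s' ∧ Q s' := by
  induction a generalizing Q s with
  | const | plus | minus | load =>
    simpa [cost] using Runs.one (fun _ => rfl) hs ⟨hs.setReg _ _, h⟩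
  | store => simpa [cost] using Runs.one (fun _ => rfl) hs ⟨hs.setMem h.1 _, h.2⟩
  | seq a b iha ihb =>
    exact ((iha h hs).seq fun s' h' => ihb h'.2 h'.1).mono (Nat.zero_le _) (by simp [cost])
      fun _ => id
  | cond x a b iha ihb =>
    rw [wp] at h
    refine (Runs.cond (hi := a.cost.eval N + b.cost.eval N) (lo := 0) (fun hx => ?_)
      fun hx => ?_).mono le_rfl (by simp [cost, add_assoc]) fun _ => id
    · exact (iha (by rwa [if_pos hx] at h) hs).mono le_rfl (by omega) fun _ => id
    · exact (ihb (by rwa [if_neg hx.not_gt] at h) hs).mono le_rfl (by omega) fun _ => id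
  | loop x a ih =>
    obtain ⟨k, hk, Inv, hx, h₀, hstep, hend⟩ := h
    refine (Runs.loop (lo := 0) (Inv := fun i s => SupportedBelow m s ∧ Inv i s)
      (fun i s hs => hx i s hs.2) (fun s hs => hs.1)
      (fun i hi s hs => ih (hstep i hi s hs.2) hs.1) ⟨hs, h₀⟩).mono
      (Nat.zero_le _) ?_ fun s hs => ⟨hs.1, hend s hs.2⟩
    simpa [cost] using Nat.mul_le_mul_right (1 + a.cost.eval N) hk

/-- By `Exec.withinBounds`, a program with `τ` steps needs at most `τ` additional bits. -/
theorem wp.runs {B C : ℤ} (h : a.wp m N Q s) (ha : a.UnitConsts) (hB : 1 ≤ B)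
    (hs : WithinBounds m B s) (hC : 2 ^ a.cost.eval N * B ≤ C) :
    Runs (WithinBounds m C) a s 0 (a.cost.eval N) fun s' => SupportedBelow m s' ∧ Q s' := by
  obtain ⟨s', t, he, -, ht, hQ⟩ := h.runs_supportedBelow hs.1
  have : (2 : ℤ) ^ t * B ≤ 2 ^ a.cost.eval N * B :=
    mul_le_mul_of_nonneg_right (pow_le_pow_right₀ one_le_two ht) (by linarith)
  exact ⟨s', t, (he.withinBounds ha hB hs.2 (this.trans hC)).1, Nat.zero_le _, ht, hQ⟩

end RamProg

end WeakestPrecondition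

/-! ### Memory layout -/

namespace Tardiness

/-- The first address of the `r`-th row. The memory consists of `3 * n` cells for input and output,
followed by `n + 8` rows of `n + 1` cells each. -/
def rowBase (n r : ℕ) : ℕ := 3 * n + r * (n + 1)

/-- The number of memory cells that the algorithm uses. -/
def memSize (n : ℕ) : ℕ := rowBase n (n + 8)

section rowBase

variable {n r r' i i' : ℕ}

theorem rowBase_add_lt (hr : r < n + 8) (hi : i ≤ n) : rowBase n r + i < memSize n := by
  have := Nat.mul_le_mul_right (n + 1) hr
  rw [memSize, rowBase, rowBase]
  linarith

theorem rowBase_add_inj (hi : i ≤ n) (hi' : i' ≤ n) :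
    rowBase n r + i = rowBase n r' + i' ↔ r = r' ∧ i = i' := by
  have key : ∀ {r i}, i ≤ n →
      (rowBase n r + i - 3 * n) / (n + 1) = r ∧ (rowBase n r + i - 3 * n) % (n + 1) = i := by
    intro r i hi
    rw [rowBase, add_assoc, Nat.add_sub_cancel_left, Nat.div_mod_unique n.succ_pos]
    exact ⟨by rw [mul_comm, add_comm, Nat.succ_eq_add_one], by omega⟩
  refine ⟨fun h => ?_, by rintro ⟨rfl, rfl⟩; rfl⟩
  have hkey := key hi (r := r)
  rw [h, (key hi').1, (key hi').2] at hkey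
  exact ⟨hkey.1.symm, hkey.2.symm⟩

theorem lt_or_exists_eq_rowBase_add {a : ℕ} (ha : a < memSize n) :
    a < 3 * n ∨ ∃ r < n + 8, ∃ i ≤ n, a = rowBase n r + i := by
  refine (lt_or_ge a (3 * n)).imp_right fun h => ⟨(a - 3 * n) / (n + 1), ?_, (a - 3 * n) % (n + 1),
    Nat.le_of_lt_succ (Nat.mod_lt _ n.succ_pos), ?_⟩
  · rw [memSize, rowBase] at ha
    exact Nat.div_lt_of_lt_mul (by linarith [Nat.sub_add_cancel h])
  · rw [rowBase, add_assoc, Nat.div_add_mod', Nat.add_sub_of_le h]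

end rowBase

/-- The contents of the memory: the cells for input and output, seven rows, and a table whose lines
are the remaining rows. The rows are

* `0`, `1`, `2`: processing time, due date and number of each job, in order of due dates;
* `3`: which jobs are alive, that is, remain to be scheduled;
* `4`, `5`: the stack, a job `l` and a line `b` in each entry;
* `6`: the addresses of the lines of the table. -/
structure Memory where
  inp : ℕ → ℤ
  row : ℕ → ℕ → ℤ
  tab : ℕ → ℕ → ℤ

namespace Memory

def setInp (M : Memory) (a : ℕ) (x : ℤ) : Memory :=
  { M with inp := Function.update M.inp a x }

def setRow (M : Memory) (r i : ℕ) (x : ℤ) : Memory :=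
  { M with row := fun r' i' => if r' = r ∧ i' = i then x else M.row r' i' }

def setTab (M : Memory) (u v : ℕ) (x : ℤ) : Memory :=
  { M with tab := fun u' v' => if u' = u ∧ v' = v then x else M.tab u' v' }

/-- `mem` has the contents `M` in the layout for `n` jobs. -/
structure Describes (n : ℕ) (M : Memory) (mem : ℕ → ℤ) : Prop where
  inp : ∀ a < 3 * n, mem a = M.inp a
  row : ∀ r < 7, ∀ i ≤ n, mem (rowBase n r + i) = M.row r i
  tab : ∀ u ≤ n, ∀ v ≤ n, mem (rowBase n (7 + u) + v) = M.tab u v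

namespace Describes

variable {n r i u v : ℕ} {M : Memory} {mem : ℕ → ℤ} {x : ℤ}

theorem setInp (h : Describes n M mem) (hi : i < 3 * n) :
    Describes n (M.setInp i x) (Function.update mem i x) where
  inp a ha := by simp only [Function.update_apply, Memory.setInp, h.inp a ha]
  row r hr i hi := by
    rw [Function.update_of_ne (by rw [rowBase]; omega), h.row r hr i hi, Memory.setInp]
  tab u hu v hv := by
    rw [Function.update_of_ne (by rw [rowBase]; omega), h.tab u hu v hv, Memory.setInp]

theorem setRow (h : Describes n M mem) (hr : r < 7) (hi : i ≤ n) :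
    Describes n (M.setRow r i x) (Function.update mem (rowBase n r + i) x) where
  inp a ha := by rw [Function.update_of_ne (by rw [rowBase]; omega), h.inp a ha, Memory.setRow]
  row r' hr' i' hi' := by
    simp only [Function.update_apply, Memory.setRow, h.row r' hr' i' hi', rowBase_add_inj hi' hi]
  tab u hu v hv := by
    rw [Function.update_of_ne, h.tab u hu v hv, Memory.setRow]
    rw [Ne, rowBase_add_inj hv hi]
    omega

theorem setTab (h : Describes n M mem) (hv : v ≤ n) :
    Describes n (M.setTab u v x) (Function.update mem (rowBase n (7 + u) + v) x) where
  inp a ha := by rw [Function.update_of_ne (by rw [rowBase]; omega), h.inp a ha, Memory.setTab]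
  row r hr i hi := by
    rw [Function.update_of_ne, h.row r hr i hi, Memory.setTab]
    rw [Ne, rowBase_add_inj hi hv]
    omega
  tab u' hu' v' hv' := by
    simp only [Function.update_apply, Memory.setTab, h.tab u' hu' v' hv', rowBase_add_inj hv' hv,
      Nat.add_left_cancel_iff]

end Describes

end Memory

/-! ### The program -/

open RamProg

/- Registers: the number of jobs, constants, the addresses of the rows, and the length of a row. -/
local notation "nᵣ" => 0
local notation "oneᵣ" => 1
local notation "zeroᵣ" => 2
local notation "Pᵣ" => 3
local notation "Dᵣ" => 4
local notation "Iᵣ" => 5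
local notation "Aᵣ" => 6
local notation "Lᵣ" => 7
local notation "Bᵣ" => 8
local notation "Xᵣ" => 9
local notation "wᵣ" => 10

/- The outer loops: remaining positions, start time of the present position, candidate for it,
least cost and best candidate so far. -/
local notation "posᵣ" => 11
local notation "startᵣ" => 12
local notation "jᵣ" => 13
local notation "bestᵣ" => 14
local notation "bestjᵣ" => 15

/- The recursion: start time, first line to compute, height of the stack, mode (`1` when a call
begins, `0` when it returns). -/
local notation "stᵣ" => 16
local notation "bᵣ" => 17
local notation "hᵣ" => 18
local notation "mᵣ" => 19

/- Scratch registers, reset to `0` between the rounds of the outer loops and of the recursion. -/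
local notation "addrᵣ" => 20
local notation "lᵣ" => 21
local notation "cuᵣ" => 22
local notation "uᵣ" => 23
local notation "ubᵣ" => 24
local notation "cvᵣ" => 25
local notation "vᵣ" => 26
local notation "xᵣ" => 27
local notation "ccᵣ" => 28
local notation "cᵣ" => 29
local notation "yᵣ" => 30
local notation "iᵣ" => 31
local notation "sᵣ" => 32
local notation "zᵣ" => 33
local notation "dlᵣ" => 34

infixr:60 " ⨾ " => RamProg.seq

def skip : RamProg := .const addrᵣ 0

def copy (x y : ℕ) : RamProg := .plus x y zeroᵣ

def incr (x : ℕ) : RamProg := .plus x x oneᵣ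

def decr (x : ℕ) : RamProg := .minus x x oneᵣ

/-- `R[x] := M[R[b] + R[i]]` -/
def readAt (x b i : ℕ) : RamProg := .plus addrᵣ b i ⨾ .load x addrᵣ

/-- `M[R[b] + R[i]] := R[x]` -/
def writeAt (b i x : ℕ) : RamProg := .plus addrᵣ b i ⨾ .store addrᵣ x

/-- Replaces `R[x]` by `max R[x] 0`. -/
def posPart (x : ℕ) : RamProg := .cond x skip (.const x 0)

/-- Updates a running minimum with the value `R[y]` and executes `a` if it decreases. The minimum
plus one is kept in `R[x]`, so that `0` can stand for the minimum of no values. -/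
def keepMin (x y : ℕ) (a : RamProg) : RamProg :=
  incr y ⨾ .cond x (.minus zᵣ x y ⨾ .cond zᵣ (copy x y ⨾ a) skip) (copy x y ⨾ a)

def zeroRegs (l : List ℕ) : RamProg := l.foldr (fun x a => .const x 0 ⨾ a) skip

def scratch : List ℕ :=
  [addrᵣ, lᵣ, cuᵣ, uᵣ, ubᵣ, cvᵣ, vᵣ, xᵣ, ccᵣ, cᵣ, yᵣ, iᵣ, sᵣ, zᵣ, dlᵣ]

def resetScratch : RamProg := zeroRegs scratch

/-- Finds the first longest alive job `R[l]` in line `R[b]` or later. Its processing time plus one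
is left in `R[x]`; if there is no such job, `R[x]` is `0`. -/
def findLongest : RamProg :=
  .const xᵣ 0 ⨾ .minus iᵣ nᵣ bᵣ ⨾ .loop iᵣ
    (decr iᵣ ⨾ .plus cᵣ bᵣ iᵣ ⨾ readAt zᵣ Aᵣ cᵣ ⨾ .cond zᵣ
      (readAt yᵣ Pᵣ cᵣ ⨾ incr yᵣ ⨾ .plus sᵣ yᵣ oneᵣ ⨾ .minus sᵣ sᵣ xᵣ ⨾
        .cond sᵣ (copy xᵣ yᵣ ⨾ copy lᵣ cᵣ) skip)
      skip)

/-- Fills the table with `0` from line `R[b]` on. -/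
def clearTable : RamProg :=
  .const mᵣ 0 ⨾ .minus cuᵣ wᵣ bᵣ ⨾ .loop cuᵣ
    (decr cuᵣ ⨾ .plus uᵣ bᵣ cuᵣ ⨾ readAt ubᵣ Xᵣ uᵣ ⨾ copy cvᵣ wᵣ ⨾ .loop cvᵣ
      (decr cvᵣ ⨾ writeAt ubᵣ cvᵣ zeroᵣ))

/-- Begins the call that computes the table without job `R[l]`. -/
def pushLongest : RamProg :=
  writeAt Aᵣ lᵣ zeroᵣ ⨾ writeAt Lᵣ hᵣ lᵣ ⨾ writeAt Bᵣ hᵣ bᵣ ⨾ incr hᵣ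

/-- `R[s] := R[st] +` the total processing time of the alive jobs below `R[c]`. -/
def sumBelow : RamProg :=
  copy sᵣ stᵣ ⨾ copy iᵣ cᵣ ⨾ .loop iᵣ
    (decr iᵣ ⨾ readAt zᵣ Aᵣ iᵣ ⨾ .cond zᵣ (readAt zᵣ Pᵣ iᵣ ⨾ .plus sᵣ sᵣ zᵣ) skip)

/-- `R[y]` becomes the cost of cutting the segment between `R[u]` and `R[v]` at `R[c]`. -/
def evalCut : RamProg :=
  sumBelow ⨾ .minus yᵣ sᵣ dlᵣ ⨾ posPart yᵣ ⨾ readAt zᵣ ubᵣ cᵣ ⨾ .plus yᵣ yᵣ zᵣ ⨾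
    readAt zᵣ Xᵣ cᵣ ⨾ readAt zᵣ zᵣ vᵣ ⨾ .plus yᵣ yᵣ zᵣ

def tryCut : RamProg := .plus cᵣ lᵣ ccᵣ ⨾ evalCut ⨾ keepMin xᵣ yᵣ skip ⨾ decr ccᵣ

/-- Computes the entry in line `R[u]` and column `R[v]` of the table from the table without job
`R[l]`. -/
def combineEntry : RamProg :=
  .plus vᵣ lᵣ cvᵣ ⨾ .const xᵣ 0 ⨾ copy ccᵣ cvᵣ ⨾ .loop ccᵣ tryCut ⨾ decr xᵣ ⨾
    writeAt ubᵣ vᵣ xᵣ ⨾ decr cvᵣ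

def combineLine : RamProg :=
  decr cuᵣ ⨾ .plus uᵣ bᵣ cuᵣ ⨾ readAt ubᵣ Xᵣ uᵣ ⨾ .minus cvᵣ nᵣ lᵣ ⨾ .loop cvᵣ combineEntry

/-- Computes the table with job `R[l]` from the table without it. -/
def combine : RamProg :=
  readAt dlᵣ Dᵣ lᵣ ⨾ .minus cuᵣ lᵣ bᵣ ⨾ incr cuᵣ ⨾ .loop cuᵣ combineLine

/-- Begins the call that recomputes the lines after `R[l]`, which contain job `R[l]` no more. -/
def resumeAfter : RamProg :=
  writeAt Aᵣ lᵣ oneᵣ ⨾ incr hᵣ ⨾ .plus bᵣ lᵣ oneᵣ ⨾ .const mᵣ 1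

/-- The job on top of the stack is alive again when the second call returns. -/
def ascend : RamProg :=
  decr hᵣ ⨾ .cond hᵣ
    (readAt lᵣ Lᵣ hᵣ ⨾ readAt bᵣ Bᵣ hᵣ ⨾ readAt zᵣ Aᵣ lᵣ ⨾ .cond zᵣ combine resumeAfter) skip

def descend : RamProg := findLongest ⨾ .cond xᵣ pushLongest clearTable

def solveRound : RamProg := .cond mᵣ descend ascend ⨾ resetScratch

def solve : RamProg := .loop hᵣ solveRound

def beginTry : RamProg :=
  writeAt Aᵣ jᵣ zeroᵣ ⨾ readAt zᵣ Pᵣ jᵣ ⨾ .plus stᵣ startᵣ zᵣ ⨾ .const hᵣ 1 ⨾ resetScratch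

def endTry : RamProg :=
  writeAt Aᵣ jᵣ oneᵣ ⨾ readAt yᵣ Dᵣ jᵣ ⨾ .minus yᵣ stᵣ yᵣ ⨾ posPart yᵣ ⨾ readAt zᵣ Xᵣ zeroᵣ ⨾
    readAt zᵣ zᵣ nᵣ ⨾ .plus yᵣ yᵣ zᵣ ⨾ keepMin bestᵣ yᵣ (copy bestjᵣ jᵣ) ⨾ resetScratch

/-- `R[m]` becomes `1` if the next candidate `R[j]` is alive and `0` otherwise. -/
def nextJob : RamProg := decr jᵣ ⨾ .plus stᵣ Aᵣ jᵣ ⨾ .load mᵣ stᵣ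

def tryJob : RamProg := nextJob ⨾ .cond mᵣ (beginTry ⨾ solve ⨾ endTry) skip

def chooseBest : RamProg :=
  writeAt Aᵣ bestjᵣ zeroᵣ ⨾ readAt zᵣ Pᵣ bestjᵣ ⨾ .plus startᵣ startᵣ zᵣ ⨾
    readAt zᵣ Iᵣ bestjᵣ ⨾ .minus addrᵣ Pᵣ posᵣ ⨾ .store addrᵣ zᵣ ⨾ decr posᵣ ⨾ resetScratch

def beginPosition : RamProg := .const bestᵣ 0 ⨾ copy jᵣ nᵣ

def fillPosition : RamProg := beginPosition ⨾ .loop jᵣ tryJob ⨾ chooseBest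

def initConstants : RamProg :=
  .const oneᵣ 1 ⨾ .const zeroᵣ 0 ⨾ .plus wᵣ nᵣ oneᵣ ⨾ .plus Pᵣ nᵣ nᵣ ⨾ .plus Pᵣ Pᵣ nᵣ ⨾
    .plus Dᵣ Pᵣ wᵣ ⨾ .plus Iᵣ Dᵣ wᵣ ⨾ .plus Aᵣ Iᵣ wᵣ ⨾ .plus Lᵣ Aᵣ wᵣ ⨾ .plus Bᵣ Lᵣ wᵣ ⨾
    .plus Xᵣ Bᵣ wᵣ

def initLines : RamProg :=
  .plus ubᵣ Xᵣ wᵣ ⨾ .const uᵣ 0 ⨾ copy cuᵣ wᵣ ⨾ .loop cuᵣ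
    (writeAt Xᵣ uᵣ ubᵣ ⨾ .plus ubᵣ ubᵣ wᵣ ⨾ incr uᵣ ⨾ decr cuᵣ)

/-- `R[u]` becomes the rank of the job `R[cu]`, whose due date is `R[dl]`, in the order of due
dates. -/
def computeRank : RamProg :=
  .const uᵣ 0 ⨾ copy iᵣ nᵣ ⨾ .loop iᵣ
    (decr iᵣ ⨾ readAt zᵣ nᵣ iᵣ ⨾ .minus sᵣ dlᵣ zᵣ ⨾ .cond sᵣ (incr uᵣ)
      (incr sᵣ ⨾ .cond sᵣ (.minus yᵣ cuᵣ iᵣ ⨾ .cond yᵣ (incr uᵣ) skip) skip))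

def sortJobs : RamProg :=
  copy cuᵣ nᵣ ⨾ .loop cuᵣ
    (decr cuᵣ ⨾ readAt dlᵣ nᵣ cuᵣ ⨾ computeRank ⨾ readAt zᵣ zeroᵣ cuᵣ ⨾ writeAt Pᵣ uᵣ zᵣ ⨾
      writeAt Dᵣ uᵣ dlᵣ ⨾ writeAt Iᵣ uᵣ cuᵣ ⨾ writeAt Aᵣ uᵣ oneᵣ)

def prepare : RamProg :=
  initConstants ⨾ initLines ⨾ sortJobs ⨾ copy posᵣ nᵣ ⨾ resetScratch

/-- The algorithm: fill the positions from first to last, each time with a job for which the least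
cost is minimal. -/
def tardinessProgram : RamProg := prepare ⨾ .loop posᵣ fillPosition

/-! ### Symbolic execution -/

section Execution

variable {n r i u v : ℕ} {M : Memory} {s s' s'' : RamState} {F F' : List ℕ}

@[simp]
theorem reg_setReg (s : RamState) (x r : ℕ) (v : ℤ) :
    (s.setReg x v).reg r = if r = x then v else s.reg r := Function.update_apply _ _ _ _

@[simp]
theorem mem_setReg (s : RamState) (x : ℕ) (v : ℤ) : (s.setReg x v).mem = s.mem := rfl

@[simp]
theorem reg_setMem (s : RamState) (x : ℕ) (v : ℤ) : (s.setMem x v).reg = s.reg := rfl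

@[simp]
theorem mem_setMem (s : RamState) (x : ℕ) (v : ℤ) :
    (s.setMem x v).mem = Function.update s.mem x v := rfl

@[simp]
theorem setMem_setReg (s : RamState) (x a : ℕ) (v w : ℤ) :
    (s.setReg x v).setMem a w = (s.setMem a w).setReg x v := rfl

/-- The registers of `s'` and `s` agree except possibly for those in the list `F`. -/
def AgreeOff (F : List ℕ) (s' s : RamState) : Prop := ∀ r, r ∉ F → s'.reg r = s.reg r

theorem AgreeOff.reg (h : AgreeOff F s' s) : ∀ r, r ∉ F → s'.reg r = s.reg r := h

@[simp]
theorem AgreeOff.refl (F : List ℕ) (s : RamState) : AgreeOff F s s := fun _ _ => rfl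

theorem AgreeOff.trans (h' : AgreeOff F s'' s') (h : AgreeOff F s' s) : AgreeOff F s'' s :=
  fun r hr => (h' r hr).trans (h r hr)

theorem AgreeOff.mono (h : AgreeOff F s' s) (hF : F ⊆ F') : AgreeOff F' s' s :=
  fun r hr => h r fun hr' => hr (hF hr')

@[simp]
theorem agreeOff_setReg {x : ℕ} {v : ℤ} (hx : x ∈ F) :
    AgreeOff F (s'.setReg x v) s ↔ AgreeOff F s' s :=
  forall₂_congr fun r hr => by rw [reg_setReg, if_neg fun h : r = x => hr (h ▸ hx)]

@[simp]
theorem agreeOff_setMem {x : ℕ} {v : ℤ} : AgreeOff F (s'.setMem x v) s ↔ AgreeOff F s' s := Iff.rfl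

theorem _root_.BoundedBy.of_agreeOff {B : ℤ} (hs : BoundedBy B s) (h : AgreeOff F s' s)
    (hF : ∀ r ∈ F, |s'.reg r| ≤ B) (hmem : ∀ a, |s'.mem a| ≤ B) : BoundedBy B s' :=
  ⟨fun r => if hr : r ∈ F then hF r hr else h r hr ▸ hs.1 r, hmem⟩

/-- The registers `nᵣ, …, wᵣ` and the memory are set up for `n` jobs, with memory contents `M`. -/
structure Loaded (n : ℕ) (M : Memory) (s : RamState) : Prop where
  reg_n : s.reg nᵣ = n
  reg_one : s.reg oneᵣ = 1
  reg_zero : s.reg zeroᵣ = 0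
  reg_P : s.reg Pᵣ = rowBase n 0
  reg_D : s.reg Dᵣ = rowBase n 1
  reg_I : s.reg Iᵣ = rowBase n 2
  reg_A : s.reg Aᵣ = rowBase n 3
  reg_L : s.reg Lᵣ = rowBase n 4
  reg_B : s.reg Bᵣ = rowBase n 5
  reg_X : s.reg Xᵣ = rowBase n 6
  reg_w : s.reg wᵣ = n + 1
  mem : M.Describes n s.mem

namespace Loaded

theorem of_agreeOff (h : Loaded n M s) (hs : AgreeOff F s' s) (hF : ∀ r ∈ F, 11 ≤ r)
    {M' : Memory} (hM : M'.Describes n s'.mem) : Loaded n M' s' := by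
  have hs : ∀ r < 11, s'.reg r = s.reg r := fun r hr => hs r fun h => by have := hF r h; omega
  constructor
  case mem => exact hM
  all_goals rw [hs _ (by norm_num)]
  exacts [h.reg_n, h.reg_one, h.reg_zero, h.reg_P, h.reg_D, h.reg_I, h.reg_A, h.reg_L, h.reg_B,
    h.reg_X, h.reg_w]

theorem mem_row (h : Loaded n M s) (hr : r < 7) (hi : i ≤ n) :
    s.mem ((rowBase n r : ℤ) + i).toNat = M.row r i :=
  h.mem.row r hr i hi

theorem mem_tab (h : Loaded n M s) (hu : u ≤ n) (hv : v ≤ n) :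
    s.mem ((rowBase n (7 + u) : ℤ) + v).toNat = M.tab u v :=
  h.mem.tab u hu v hv

@[simp]
theorem setReg {x : ℕ} {v : ℤ} (hx : 11 ≤ x) : Loaded n M (s.setReg x v) ↔ Loaded n M s := by
  have hs : AgreeOff [x] (s.setReg x v) s := by simp
  exact ⟨fun h => h.of_agreeOff (fun r hr => (hs r hr).symm) (by simpa) h.mem,
    fun h => h.of_agreeOff hs (by simpa) h.mem⟩

theorem setMem (h : Loaded n M s) {M' : Memory} {x : ℕ} {v : ℤ}
    (hM : M'.Describes n (Function.update s.mem x v)) : Loaded n M' (s.setMem x v) :=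
  h.of_agreeOff (s' := s.setMem x v) (F := []) (fun _ _ => rfl) (by simp) hM

theorem setMem_row (h : Loaded n M s) (hr : r < 7) (hi : i ≤ n) (x : ℤ) :
    Loaded n (M.setRow r i x) (s.setMem ((rowBase n r : ℤ) + i).toNat x) :=
  h.setMem (h.mem.setRow hr hi)

theorem setMem_tab (h : Loaded n M s) (hv : v ≤ n) (x : ℤ) :
    Loaded n (M.setTab u v x) (s.setMem ((rowBase n (7 + u) : ℤ) + v).toNat x) :=
  h.setMem (h.mem.setTab hv)

end Loaded

theorem toNat_rowBase_add_lt (hr : r < n + 8) (hi : i ≤ n) :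
    ((rowBase n r : ℤ) + i).toNat < memSize n :=
  rowBase_add_lt hr hi

/-- The memory holds the processing times `p` and the due dates `d` of the jobs, in order of due
dates, the set `A` of alive jobs, and the addresses of the lines of the table. -/
structure Memory.Stores (n : ℕ) (p d : ℕ → ℤ) (A : Finset ℕ) (M : Memory) : Prop where
  p : ∀ i < n, M.row 0 i = p i
  d : ∀ i < n, M.row 1 i = d i
  alive : ∀ i < n, M.row 3 i = if i ∈ A then 1 else 0
  line : ∀ u ≤ n, M.row 6 u = rowBase n (7 + u)

namespace Memory

theorem Stores.congr {p d : ℕ → ℤ} {A : Finset ℕ} {M' : Memory} (h : M.Stores n p d A)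
    (hrow : M'.row = M.row) : M'.Stores n p d A := by
  constructor <;> rw [hrow]
  exacts [h.p, h.d, h.alive, h.line]

open Classical in
/-- The contents `M` with the table replaced by `f` on the entries in `S`. -/
noncomputable def fill (M : Memory) (S : Set (ℕ × ℕ)) (f : ℕ → ℕ → ℤ) : Memory :=
  { M with tab := fun u v => if (u, v) ∈ S then f u v else M.tab u v }

variable {S : Set (ℕ × ℕ)} {f : ℕ → ℕ → ℤ}

theorem fill_empty : M.fill ∅ f = M := by simp [fill]

theorem setTab_fill : (M.fill S f).setTab u v (f u v) = M.fill (insert (u, v) S) f := by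
  simp only [setTab, fill, mk.injEq, true_and]
  ext u' v'
  grind

theorem fill_fill {S' : Set (ℕ × ℕ)} : (M.fill S f).fill S' f = M.fill (S' ∪ S) f := by
  simp only [fill, mk.injEq, true_and]
  ext u v
  grind

theorem fill_tab_of_mem (h : (u, v) ∈ S) : (M.fill S f).tab u v = f u v := if_pos h

theorem fill_tab_of_notMem (h : (u, v) ∉ S) : (M.fill S f).tab u v = M.tab u v := if_neg h

end Memory

end Execution

section Blocks

attribute [local simp] RamProg.wp readAt writeAt copy incr decr skip

variable {n m N c u v : ℕ} {M : Memory} {s : RamState} {Q : RamState → Prop} {p d : ℕ → ℤ}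
  {A : Finset ℕ}

theorem wp_posPart (hQ : ∀ s', AgreeOff [addrᵣ, yᵣ] s' s → s'.mem = s.mem →
    s'.reg yᵣ = max (s.reg yᵣ) 0 → Q s') : (posPart yᵣ).wp m N Q s := by
  refine wp_cond (fun hy => ?_) fun hy => ?_
  · exact hQ _ (by simp) rfl (by simp [hy.le])
  · exact hQ _ (by simp) rfl (by simp [hy])

theorem wp_sumBelow (h : Loaded n M s) (hM : M.Stores n p d A) (hc : s.reg cᵣ = c) (hcn : c ≤ n)
    (hQ : ∀ s', AgreeOff [addrᵣ, iᵣ, sᵣ, zᵣ] s' s → s'.mem = s.mem →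
      s'.reg sᵣ = s.reg stᵣ + prefixSum p A c → Q s') :
    sumBelow.wp m n Q s := by
  refine wp_loop c (fun k s' => AgreeOff [addrᵣ, iᵣ, sᵣ, zᵣ] s' s ∧ s'.mem = s.mem ∧
      s'.reg iᵣ = k ∧ s'.reg sᵣ + prefixSum p A k = s.reg stᵣ + prefixSum p A c)
    (by omega) (fun _ _ h => h.2.2.1) (by simp [h.reg_zero, hc]) ?_ fun s' h' =>
      hQ s' h'.1 h'.2.1 (by simpa [prefixSum_zero] using h'.2.2.2)
  rintro k hk s' ⟨hs', hmem, hi, hs⟩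
  have hkn : k < n := by omega
  by_cases hkA : k ∈ A <;>
    simp_all [hs'.reg, h.reg_one, h.reg_A, h.reg_P, h.mem_row, hkn.le, hM.p, hM.alive,
      prefixSum_succ]
  linarith

theorem wp_evalCut (h : Loaded n M s) (hM : M.Stores n p d A) (hc : s.reg cᵣ = c) (hcn : c ≤ n)
    (hu : s.reg ubᵣ = rowBase n (7 + u)) (hun : u ≤ n) (hv : s.reg vᵣ = v) (hvn : v ≤ n)
    (hQ : ∀ s', AgreeOff [addrᵣ, yᵣ, iᵣ, sᵣ, zᵣ] s' s → s'.mem = s.mem →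
      s'.reg yᵣ = M.tab u c + max (s.reg stᵣ + prefixSum p A c - s.reg dlᵣ) 0 + M.tab c v → Q s') :
    evalCut.wp m n Q s := by
  refine wp_sumBelow h hM hc hcn fun s₁ h₁ hm₁ hs₁ => wp_posPart fun s₂ h₂ hm₂ hy₂ => ?_
  have hcol := h.mem_tab hun hcn
  have hline := h.mem_row (r := 6) (by norm_num) hcn
  have hrow := h.mem_tab hcn hvn
  rw [hM.line c hcn] at hline
  refine hQ _ ?_ ?_ ?_
  · have h₁' := h₁.mono (F' := [addrᵣ, yᵣ, iᵣ, sᵣ, zᵣ]) (by simp)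
    simpa using (h₂.mono (by simp)).trans (by simpa using h₁')
  · simp_all
  · simp_all [h₂.reg, h₁.reg, h.reg_X]
    linarith

end Blocks

section RunningMin

/-- `x` encodes the minimum of a set of nonnegative numbers: it is `0` if the set is empty, and the
minimum plus one otherwise. -/
def RunningMin (V : Set ℤ) (x : ℤ) : Prop := (V = ∅ ∧ x = 0) ∨ (0 < x ∧ IsLeast V (x - 1))

variable {V : Set ℤ} {x y : ℤ}

theorem runningMin_empty : RunningMin ∅ 0 := .inl ⟨rfl, rfl⟩

theorem RunningMin.isLeast (h : RunningMin V x) (hV : V.Nonempty) : IsLeast V (x - 1) :=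
  (h.resolve_left fun h' => hV.ne_empty h'.1).2

theorem RunningMin.insert_of_lt (h : RunningMin V x) (hy : 0 ≤ y) (hlt : 0 < x → y + 1 < x) :
    RunningMin (insert y V) (y + 1) := by
  refine .inr ⟨by omega, ?_⟩
  rw [add_sub_cancel_right]
  rcases h with ⟨rfl, -⟩ | ⟨hx, hV⟩
  · simp
  · simpa [show y ≤ x - 1 by have := hlt hx; omega] using hV.insert y

theorem RunningMin.insert_of_le (h : RunningMin V x) (hx : 0 < x) (hle : x ≤ y + 1) :
    RunningMin (insert y V) x := by
  have hV := (h.resolve_left fun h' => hx.ne' h'.2).2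
  exact .inr ⟨hx, by simpa [show x - 1 ≤ y by omega] using hV.insert y⟩

end RunningMin

section Combine

attribute [local simp] RamProg.wp readAt writeAt copy incr decr skip

variable {n m N b l c u v x : ℕ} {M : Memory} {s : RamState} {a : RamProg} {Q : RamState → Prop}
  {p d : ℕ → ℤ} {A : Finset ℕ} {V : Set ℤ}

theorem wp_keepMin (hx : x ∉ [oneᵣ, zeroᵣ, addrᵣ, yᵣ, zᵣ]) (h₁ : s.reg oneᵣ = 1)
    (h₀ : s.reg zeroᵣ = 0) (hV : RunningMin V (s.reg x)) (hy : 0 ≤ s.reg yᵣ)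
    (hlt : ∀ s', AgreeOff [addrᵣ, x, yᵣ, zᵣ] s' s → s'.mem = s.mem →
      s'.reg x = s.reg yᵣ + 1 → RunningMin (insert (s.reg yᵣ) V) (s'.reg x) → a.wp m N Q s')
    (hle : ∀ s', AgreeOff [addrᵣ, x, yᵣ, zᵣ] s' s → s'.mem = s.mem → s'.reg x = s.reg x →
      0 < s.reg x → RunningMin (insert (s.reg yᵣ) V) (s'.reg x) → Q s') :
    (keepMin x yᵣ a).wp m N Q s := by
  simp only [List.mem_cons, List.not_mem_nil, or_false, not_or] at hx
  obtain ⟨hx₁, hx₀, hxa, hxy, hxz⟩ := hx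
  refine wp_cond (fun hpos => wp_cond (fun hz => hlt _ ?_ ?_ ?_ ?_) fun hz => hle _ ?_ ?_ ?_ ?_ ?_)
    fun hneg => hlt _ ?_ ?_ ?_ ?_
  all_goals simp_all [Ne.symm]
  · exact hV.insert_of_lt hy fun _ => hz
  · exact hV.insert_of_le hpos (by omega)
  · exact hV.insert_of_lt hy fun _ => by omega

theorem wp_tryCut {y : ℤ} (h : Loaded n M s) (hM : M.Stores n p d A) (hd : s.reg dlᵣ = d l)
    (hu : s.reg ubᵣ = rowBase n (7 + u)) (hun : u ≤ n) (hv : s.reg vᵣ = v) (hvn : v ≤ n)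
    (hc : s.reg lᵣ + s.reg ccᵣ = c) (hcn : c ≤ n)
    (hcut : M.tab u c + max (s.reg stᵣ + prefixSum p A c - d l) 0 + M.tab c v = y) (hy : 0 ≤ y)
    (hV : RunningMin V (s.reg xᵣ))
    (hQ : ∀ s', AgreeOff [addrᵣ, xᵣ, ccᵣ, cᵣ, yᵣ, iᵣ, sᵣ, zᵣ] s' s → s'.mem = s.mem →
      s'.reg ccᵣ = s.reg ccᵣ - 1 → RunningMin (insert y V) (s'.reg xᵣ) → Q s') :
    tryCut.wp m n Q s := by
  refine wp_evalCut (c := c) (u := u) (v := v) (M := M) (by simpa) hM (by simpa) hcn (by simpa) hun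
    (by simpa) hvn fun s₁ h₁ hm₁ hy₁ => ?_
  have hagree : AgreeOff [addrᵣ, xᵣ, ccᵣ, cᵣ, yᵣ, iᵣ, sᵣ, zᵣ] s₁ s :=
    (h₁.mono (by simp)).trans (by simp)
  obtain rfl : s₁.reg yᵣ = y := by simpa [hd, hcut] using hy₁
  refine wp_keepMin (by decide) (by simp [hagree.reg, h.reg_one]) (by simp [hagree.reg, h.reg_zero])
    (by simpa [h₁.reg] using hV) hy (fun s₂ h₂ hm₂ _ hV₂ => ?_) fun s₂ h₂ hm₂ _ _ hV₂ => ?_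
  all_goals
    have hagree₂ := (h₂.mono (by simp)).trans hagree
    refine hQ _ (by simpa using hagree₂) (by simp [hm₂, hm₁]) ?_ (by simpa using hV₂)
    simp [h₂.reg, h₁.reg, h.reg_one]

theorem wp_combineEntry {k : ℕ} {y : ℤ} (h : Loaded n M s) (hM : M.Stores n p d A)
    (hl : s.reg lᵣ = l) (hd : s.reg dlᵣ = d l) (hu : s.reg ubᵣ = rowBase n (7 + u)) (hun : u ≤ n)
    (hk : s.reg cvᵣ = k) (hv : v = l + k) (hvn : v ≤ n) (hlv : l < v)
    (hleft : ∀ c ∈ Set.Ioc l v, M.tab u c = segCost p d (s.reg stᵣ) (A.erase l) u c)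
    (hright : ∀ c ∈ Set.Ioc l v, M.tab c v = segCost p d (s.reg stᵣ) A c v)
    (hy : IsLeast (cutCost p d (s.reg stᵣ) A l u v '' Set.Ioc l v) y)
    (hQ : ∀ s', AgreeOff [addrᵣ, cvᵣ, vᵣ, xᵣ, ccᵣ, cᵣ, yᵣ, iᵣ, sᵣ, zᵣ] s' s →
      Loaded n (M.setTab u v y) s' → s'.reg cvᵣ = k - 1 → Q s') :
    combineEntry.wp (memSize n) n Q s := by
  refine wp_loop k (fun i s' => AgreeOff [addrᵣ, vᵣ, xᵣ, ccᵣ, cᵣ, yᵣ, iᵣ, sᵣ, zᵣ] s' s ∧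
      s'.mem = s.mem ∧ s'.reg vᵣ = v ∧ s'.reg ccᵣ = i ∧
      RunningMin (cutCost p d (s.reg stᵣ) A l u v '' Set.Ioc (l + i) v) (s'.reg xᵣ))
    (by omega) (fun _ _ h => h.2.2.2.1)
    (by simp [h.reg_zero, hl, hk, hv, runningMin_empty]) ?_ ?_
  · rintro i hi s₁ ⟨h₁, hm₁, hv₁, hi₁, hx₁⟩
    have hIoc : Set.Ioc (l + i) v = insert (l + (i + 1)) (Set.Ioc (l + (i + 1)) v) := by
      ext; simp only [Set.mem_insert_iff, Set.mem_Ioc]; omega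
    have hc : l + (i + 1) ∈ Set.Ioc l v := ⟨by omega, by omega⟩
    refine wp_tryCut (l := l) (u := u) (h.of_agreeOff h₁ (by decide) (hm₁ ▸ h.mem)) hM
      (by simp [h₁.reg, hd]) (by simp [h₁.reg, hu]) hun hv₁ hvn (by simp [h₁.reg, hl, hi₁])
      (hc.2.trans hvn)
      (y := cutCost p d (s.reg stᵣ) A l u v (l + (i + 1))) ?_ ?_ hx₁ fun s₂ h₂ hm₂ hi₂ hx₂ => ?_
    · simp [h₁.reg, cutCost, hleft _ hc, hright _ hc]
    · exact add_nonneg (add_nonneg (segCost_nonneg ..) (le_max_right _ _)) (segCost_nonneg ..)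
    · refine ⟨(h₂.mono (by simp)).trans h₁, hm₂.trans hm₁, by simp [h₂.reg, hv₁], ?_, ?_⟩
      · simp [hi₂, hi₁]
      · rwa [hIoc, Set.image_insert_eq]
  · rintro s₁ ⟨h₁, hm₁, hv₁, -, hx₁⟩
    have hL₁ : Loaded n M s₁ := h.of_agreeOff h₁ (by decide) (hm₁ ▸ h.mem)
    have hxy : s₁.reg xᵣ - 1 = y := by
      simpa using (hx₁.isLeast ⟨_, Set.mem_image_of_mem _ ⟨hlv, le_rfl⟩⟩).unique hy
    have hmem := hL₁.setMem_tab (u := u) hvn y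
    refine ⟨?_, hQ _ ?_ ?_ ?_⟩
    · simpa [h₁.reg, hu, hv₁] using toNat_rowBase_add_lt (by omega) hvn
    · simpa using h₁.mono (by simp)
    · simpa [h₁.reg, hu, hv₁, h.reg_one, hxy] using hmem
    · simp [h₁.reg, hk, h.reg_one]

theorem wp_combineLine {k : ℕ} {f : ℕ → ℕ → ℤ} (h : Loaded n M s) (hM : M.Stores n p d A)
    (hl : s.reg lᵣ = l) (hd : s.reg dlᵣ = d l) (hb : s.reg bᵣ = b)
    (hk : s.reg cuᵣ = (k + 1 : ℕ)) (hu : u = b + k) (hul : u ≤ l) (hln : l ≤ n)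
    (hleft : ∀ c ∈ Set.Ioc l n, M.tab u c = segCost p d (s.reg stᵣ) (A.erase l) u c)
    (hright : ∀ c ∈ Set.Ioc l n, ∀ v ∈ Set.Ioc l n, M.tab c v = segCost p d (s.reg stᵣ) A c v)
    (hf : ∀ v ∈ Set.Ioc l n, IsLeast (cutCost p d (s.reg stᵣ) A l u v '' Set.Ioc l v) (f u v))
    (hQ : ∀ s', AgreeOff [addrᵣ, cuᵣ, uᵣ, ubᵣ, cvᵣ, vᵣ, xᵣ, ccᵣ, cᵣ, yᵣ, iᵣ, sᵣ, zᵣ] s' s →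
      Loaded n (M.fill {q | q.1 = u ∧ q.2 ∈ Set.Ioc l n} f) s' → s'.reg cuᵣ = k → Q s') :
    combineLine.wp (memSize n) n Q s := by
  have hun : u ≤ n := hul.trans hln
  have hline := h.mem_row (r := 6) (by norm_num) hun
  rw [hM.line u hun, hu] at hline
  push_cast at hline
  refine wp_loop (n - l) (fun j s' =>
      AgreeOff [addrᵣ, cuᵣ, uᵣ, ubᵣ, cvᵣ, vᵣ, xᵣ, ccᵣ, cᵣ, yᵣ, iᵣ, sᵣ, zᵣ] s' s ∧
      Loaded n (M.fill {q | q.1 = u ∧ q.2 ∈ Set.Ioc (l + j) n} f) s' ∧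
      s'.reg cuᵣ = k ∧ s'.reg ubᵣ = rowBase n (7 + u) ∧ s'.reg cvᵣ = j)
    (by omega) (fun _ _ h => h.2.2.2.2) ?_ ?_
    fun s₁ h₁ => hQ s₁ h₁.1 (by simpa using h₁.2.1) h₁.2.2.1
  · have : {q : ℕ × ℕ | q.1 = u ∧ q.2 ∈ Set.Ioc (l + (n - l)) n} = ∅ := by
      ext; simp; omega
    rw [this, Memory.fill_empty]
    simp [h, h.reg_one, h.reg_X, h.reg_n, hb, hk, hl, hline, hu, hln]
  · rintro j hj s₁ ⟨h₁, hL₁, hk₁, hub₁, hj₁⟩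
    obtain ⟨v, hv⟩ : ∃ v, v = l + (j + 1) := ⟨_, rfl⟩
    have hvn : v ≤ n := by omega
    refine wp_combineEntry (v := v) hL₁ (hM.congr rfl) (by simp [h₁.reg, hl]) (by simp [h₁.reg, hd])
      hub₁ hun hj₁ hv hvn (by omega) ?_ ?_ (y := f u v)
      (by simpa [h₁.reg] using hf v ⟨by omega, hvn⟩) fun s₂ h₂ hL₂ hj₂ => ?_
    · intro c hc
      rw [Memory.fill_tab_of_notMem fun hmem => by have := hc.2; have := hmem.2.1; omega,
        hleft c ⟨hc.1, hc.2.trans hvn⟩, h₁ _ (by decide)]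
    · intro c hc
      rw [Memory.fill_tab_of_notMem fun hmem => by have := hc.1; have := hmem.1; omega,
        hright c ⟨hc.1, hc.2.trans hvn⟩ v ⟨by omega, hvn⟩, h₁ _ (by decide)]
    · have hS : {q : ℕ × ℕ | q.1 = u ∧ q.2 ∈ Set.Ioc (l + j) n} =
          insert (u, v) {q | q.1 = u ∧ q.2 ∈ Set.Ioc (l + (j + 1)) n} := by
        ext ⟨u', v'⟩; simp; omega
      rw [Memory.setTab_fill, ← hS] at hL₂
      exact ⟨(h₂.mono (by simp)).trans h₁, hL₂, by simp [h₂.reg, hk₁], by simp [h₂.reg, hub₁],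
        by simp [hj₂]⟩

theorem wp_combine {f : ℕ → ℕ → ℤ} (h : Loaded n M s) (hM : M.Stores n p d A)
    (hl : s.reg lᵣ = l) (hb : s.reg bᵣ = b) (hbl : b ≤ l) (hln : l < n)
    (hleft : ∀ u ∈ Set.Icc b l, ∀ c ∈ Set.Ioc l n,
      M.tab u c = segCost p d (s.reg stᵣ) (A.erase l) u c)
    (hright : ∀ c ∈ Set.Ioc l n, ∀ v ∈ Set.Ioc l n, M.tab c v = segCost p d (s.reg stᵣ) A c v)
    (hf : ∀ u ∈ Set.Icc b l, ∀ v ∈ Set.Ioc l n,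
      IsLeast (cutCost p d (s.reg stᵣ) A l u v '' Set.Ioc l v) (f u v))
    (hQ : ∀ s', AgreeOff [addrᵣ, cuᵣ, uᵣ, ubᵣ, cvᵣ, vᵣ, xᵣ, ccᵣ, cᵣ, yᵣ, iᵣ, sᵣ, zᵣ, dlᵣ] s' s →
      Loaded n (M.fill (Set.Icc b l ×ˢ Set.Ioc l n) f) s' → Q s') :
    combine.wp (memSize n) n Q s := by
  refine wp_loop (l - b + 1) (fun k s' =>
      AgreeOff [addrᵣ, cuᵣ, uᵣ, ubᵣ, cvᵣ, vᵣ, xᵣ, ccᵣ, cᵣ, yᵣ, iᵣ, sᵣ, zᵣ, dlᵣ] s' s ∧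
      Loaded n (M.fill (Set.Icc (b + k) l ×ˢ Set.Ioc l n) f) s' ∧
      s'.reg dlᵣ = d l ∧ s'.reg cuᵣ = k)
    (by omega) (fun _ _ h => h.2.2.2) ?_ ?_ fun s₁ h₁ => hQ s₁ h₁.1 h₁.2.1
  · rw [Set.Icc_eq_empty (by omega), Set.empty_prod, Memory.fill_empty]
    simp [h, h.reg_one, h.reg_D, h.mem_row, hln.le, hM.d l hln, hb, hl, hbl]
  · rintro k hk s₁ ⟨h₁, hL₁, hd₁, hk₁⟩
    obtain ⟨u, hu⟩ : ∃ u, u = b + k := ⟨_, rfl⟩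
    have hubl : u ∈ Set.Icc b l := ⟨by omega, by omega⟩
    refine wp_combineLine (b := b) hL₁ (hM.congr rfl) (by simp [h₁.reg, hl]) hd₁
      (by simp [h₁.reg, hb]) hk₁ hu hubl.2 hln.le ?_ ?_ (by simpa [h₁.reg] using hf u hubl)
      fun s₂ h₂ hL₂ hk₂ => ?_
    · intro c hc
      rw [Memory.fill_tab_of_notMem fun hmem => by have := hmem.1.1; omega, hleft u hubl c hc,
        h₁ _ (by decide)]
    · intro c hc v hv
      rw [Memory.fill_tab_of_notMem fun hmem => by have := hmem.1.2; have := hc.1; omega,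
        hright c hc v hv, h₁ _ (by decide)]
    · have hS : Set.Icc (b + k) l ×ˢ Set.Ioc l n = {q : ℕ × ℕ | q.1 = u ∧ q.2 ∈ Set.Ioc l n} ∪
          Set.Icc (b + (k + 1)) l ×ˢ Set.Ioc l n := by
        ext ⟨u', v'⟩; simp; omega
      rw [Memory.fill_fill, ← hS] at hL₂
      exact ⟨(h₂.mono (by simp)).trans h₁, hL₂, by simp [h₂.reg, hd₁], hk₂⟩

end Combine

namespace Memory

variable {n l h b : ℕ} {p d : ℕ → ℤ} {A : Finset ℕ} {M : Memory}

/-- The contents `M` with job `l` removed from the alive jobs and `(l, b)` put on the stack in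
position `h`. -/
def push (M : Memory) (l h b : ℕ) : Memory :=
  ((M.setRow 3 l 0).setRow 4 h l).setRow 5 h b

namespace Stores

theorem setRow {r i : ℕ} {x : ℤ} (hM : M.Stores n p d A) (hr : r ∉ [0, 1, 3, 6]) :
    (M.setRow r i x).Stores n p d A := by
  have hrow : ∀ r' ∈ [0, 1, 3, 6], (M.setRow r i x).row r' = M.row r' := fun r' hr' => by
    ext i'
    exact if_neg fun h : r' = r ∧ i' = i => hr (h.1 ▸ hr')
  constructor <;> rw [hrow _ (by decide)]
  exacts [hM.p, hM.d, hM.alive, hM.line]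

theorem erase (hM : M.Stores n p d A) (l : ℕ) : (M.setRow 3 l 0).Stores n p d (A.erase l) where
  p := hM.p
  d := hM.d
  alive i hi := by
    have := hM.alive i hi
    grind [Memory.setRow]
  line := hM.line

theorem insert (hM : M.Stores n p d A) (l : ℕ) :
    (M.setRow 3 l 1).Stores n p d (Insert.insert l A) where
  p := hM.p
  d := hM.d
  alive i hi := by
    have := hM.alive i hi
    grind [Memory.setRow]
  line := hM.line

theorem push (hM : M.Stores n p d A) (l h b : ℕ) : (M.push l h b).Stores n p d (A.erase l) :=
  ((hM.erase l).setRow (by decide)).setRow (by decide)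

end Stores

end Memory

section Rounds

attribute [local simp] RamProg.wp readAt writeAt copy incr decr skip

variable {n m N b l : ℕ} {M : Memory} {s s₀ : RamState} {Q : RamState → Prop}
  {p d : ℕ → ℤ} {A : Finset ℕ} {F : List ℕ}

theorem wp_zeroRegs {L : List ℕ}
    (hQ : ∀ s', (∀ r, s'.reg r = if r ∈ addrᵣ :: L then 0 else s.reg r) → s'.mem = s.mem → Q s') :
    (zeroRegs L).wp m N Q s := by
  induction L generalizing s with
  | nil => exact hQ _ (by simp) rfl
  | cons x L ih =>
    refine ih fun s' h' hm' => hQ s' (fun r => ?_) hm'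
    rw [h', reg_setReg]
    grind

theorem wp_resetScratch (h₀ : ∀ r, 20 ≤ r → s₀.reg r = 0) (h : AgreeOff (F ++ scratch) s s₀)
    (hQ : ∀ s', AgreeOff F s' s₀ → s'.mem = s.mem → (∀ r < 20, s'.reg r = s.reg r) → Q s') :
    resetScratch.wp m N Q s := by
  refine wp_zeroRegs fun s' h' hm => hQ s' (fun r hr => ?_) hm fun r hr => ?_
  · rw [h']
    by_cases hrs : r ∈ scratch
    · rw [if_pos (by simp [hrs]), h₀]
      simp [scratch] at hrs
      omega
    · rw [if_neg (by simp_all [scratch]), h _ (by simp [hr, hrs])]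
  · rw [h', if_neg]
    simp [scratch]
    omega

/-- `l` is the first longest job of `A` in line `b` or later. -/
structure IsFirstLongest (p : ℕ → ℤ) (A : Finset ℕ) (b l : ℕ) : Prop where
  mem : l ∈ A
  le : b ≤ l
  le_apply : ∀ i ∈ A, b ≤ i → p i ≤ p l
  lt_apply : ∀ i ∈ A, b ≤ i → i < l → p i < p l

namespace IsFirstLongest

variable {c : ℕ}

theorem of_lt (hc : c ∈ A) (h : ∀ i ∈ A, i < c + 1) : IsFirstLongest p A c c where
  mem := hc
  le := le_rfl
  le_apply i hi hci := by rw [le_antisymm (Nat.le_of_lt_succ (h i hi)) hci]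
  lt_apply i _ hci hic := absurd hic hci.not_gt

theorem of_le_apply (h : IsFirstLongest p A (c + 1) l) (hc : c ∈ A) (hle : p l ≤ p c) :
    IsFirstLongest p A c c where
  mem := hc
  le := le_rfl
  le_apply i hi hci := by
    obtain rfl | hci := hci.eq_or_lt
    exacts [le_rfl, (h.le_apply i hi hci).trans hle]
  lt_apply i _ hci hic := absurd hic hci.not_gt

theorem of_succ (h : IsFirstLongest p A (c + 1) l) (hlt : c ∈ A → p c < p l) :
    IsFirstLongest p A c l where
  mem := h.mem
  le := (Nat.le_succ c).trans h.le
  le_apply i hi hci := by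
    obtain rfl | hci := hci.eq_or_lt
    exacts [(hlt hi).le, h.le_apply i hi hci]
  lt_apply i hi hci hil := by
    obtain rfl | hci := hci.eq_or_lt
    exacts [hlt hi, h.lt_apply i hi hci hil]

theorem unique (h : IsFirstLongest p A b l) (h' : IsFirstLongest p A b c) : l = c :=
  le_antisymm
    (not_lt.1 fun hlt => (h'.le_apply l h.mem h.le).not_gt (h.lt_apply c h'.mem h'.le hlt))
    (not_lt.1 fun hlt => (h.le_apply c h'.mem h'.le).not_gt (h'.lt_apply l h.mem h.le hlt))

end IsFirstLongest

attribute [local simp] scratch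

theorem wp_findLongest (h : Loaded n M s) (hM : M.Stores n p d A) (hp : ∀ i, 0 ≤ p i)
    (hA : A ⊆ Finset.range n) (hb : s.reg bᵣ = b) (hbn : b ≤ n)
    (hQ : ∀ s', AgreeOff scratch s' s → s'.mem = s.mem → s'.reg xᵣ ≤ 0 → (∀ i ∈ A, i < b) → Q s')
    (hQ' : ∀ s' l, AgreeOff scratch s' s → s'.mem = s.mem → 0 < s'.reg xᵣ → s'.reg lᵣ = (l : ℕ) →
      IsFirstLongest p A b l → Q s') :
    findLongest.wp m n Q s := by
  refine wp_loop (n - b) (fun k s' => AgreeOff scratch s' s ∧ s'.mem = s.mem ∧ s'.reg iᵣ = k ∧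
      ((s'.reg xᵣ = 0 ∧ ∀ i ∈ A, i < b + k) ∨
        ∃ l : ℕ, s'.reg xᵣ = p l + 1 ∧ s'.reg lᵣ = l ∧ IsFirstLongest p A (b + k) l))
    (by omega) (fun _ _ h => h.2.2.1) ?_ ?_ ?_
  · simp only [scratch, reg_setReg, OfNat.zero_ne_ofNat, ↓reduceIte, h.reg_n, Nat.reduceEqDiff,
      hb, List.mem_cons, Nat.succ_ne_self, List.not_mem_nil, or_self, or_false, or_true,
      agreeOff_setReg, AgreeOff.refl, mem_setReg, hbn, Nat.cast_sub, add_tsub_cancel_of_le,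
      true_and]
    exact .inl fun i hi => by simpa using hA hi
  · rintro k hk s₁ ⟨h₁, hm₁, hk₁, hs₁⟩
    obtain ⟨c, hc⟩ : ∃ c, c = b + k := ⟨_, rfl⟩
    have hck : s.reg bᵣ + k = c := by rw [hb, hc, Nat.cast_add]
    have hcn : c < n := by omega
    have hflag := h.mem_row (r := 3) (by norm_num) hcn.le
    have htime := h.mem_row (r := 0) (by norm_num) hcn.le
    rw [hM.alive c hcn] at hflag
    rw [hM.p c hcn] at htime
    rw [← add_assoc, ← hc] at hs₁
    rw [← hc]
    rcases em (c ∈ A), em (s₁.reg xᵣ ≤ p c + 1) with ⟨hcA | hcA, hle | hle⟩ <;>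
      simp only [wp, decr, readAt, incr, reg_setReg, ↓reduceIte, Nat.reduceEqDiff, Int.sub_pos,
        copy, scratch, List.mem_cons, Nat.succ_ne_self, List.not_mem_nil, or_self, or_false,
        or_true, agreeOff_setReg, mem_setReg, skip, OfNat.one_ne_ofNat, hk₁, Nat.cast_add,
        Nat.cast_one, not_false_eq_true, h₁.reg, h.reg_one, add_sub_cancel_right, h.reg_A, hck,
        hm₁, hflag, hcA, zero_lt_one, lt_self_iff_false, h.reg_P, htime, Order.lt_add_one_iff,
        hle, h.reg_zero, add_zero, add_left_inj, Nat.cast_inj, ↓existsAndEq, true_and]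
    · obtain ⟨-, hnone⟩ | ⟨l, hx, -, hlong⟩ := hs₁
      · exact ⟨h₁, .inr (.of_lt hcA hnone)⟩
      · exact ⟨h₁, .inr (hlong.of_le_apply hcA (by omega))⟩
    · obtain ⟨hx, -⟩ | ⟨l, hx, hl, hlong⟩ := hs₁
      · linarith [hp c]
      · exact ⟨h₁, .inr ⟨l, hx, hl, hlong.of_succ fun _ => by omega⟩⟩
    all_goals
      refine ⟨h₁, hs₁.imp (fun hs₁ => ⟨hs₁.1, fun i hi => ?_⟩) fun ⟨l, hx, hl, hlong⟩ =>
        ⟨l, hx, hl, hlong.of_succ fun hcA' => absurd hcA' hcA⟩⟩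
      exact (Nat.le_of_lt_succ (hs₁.2 i hi)).lt_of_ne fun hic => hcA (hic ▸ hi)
  · rintro s₁ ⟨h₁, hm₁, -, ⟨hx, hlt⟩ | ⟨l, hx, hl, hlong⟩⟩
    · exact hQ s₁ h₁ hm₁ hx.le hlt
    · exact hQ' s₁ l h₁ hm₁ (by rw [hx]; linarith [hp l]) hl hlong

theorem wp_clearTable (h : Loaded n M s) (hM : M.Stores n p d A) (hb : s.reg bᵣ = b) (hbn : b ≤ n)
    (hQ : ∀ s', AgreeOff (mᵣ :: scratch) s' s →
      Loaded n (M.fill (Set.Icc b n ×ˢ Set.Iic n) 0) s' → s'.reg mᵣ = 0 → Q s') :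
    clearTable.wp (memSize n) n Q s := by
  refine wp_loop (n + 1 - b) (fun k s' => AgreeOff (mᵣ :: scratch) s' s ∧
      Loaded n (M.fill (Set.Icc (b + k) n ×ˢ Set.Iic n) 0) s' ∧ s'.reg mᵣ = 0 ∧ s'.reg cuᵣ = k)
    (by omega) (fun _ _ h => h.2.2.2) ?_ ?_ fun s₁ h₁ => hQ s₁ h₁.1 h₁.2.1 h₁.2.2.1
  · rw [Set.Icc_eq_empty (by omega), Set.empty_prod, Memory.fill_empty]
    simp [h, scratch, h.reg_w, hb, Nat.cast_sub (by omega : b ≤ n + 1)]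
  · rintro k hk s₁ ⟨h₁, hL₁, hm₁, hk₁⟩
    obtain ⟨u, hu⟩ : ∃ u, u = b + k := ⟨_, rfl⟩
    have hun : u ≤ n := by omega
    have hline := hL₁.mem_row (r := 6) (by norm_num) hun
    have hub : s₁.reg bᵣ + k = u := by simp [h₁.reg, hb, hu]
    rw [show (M.fill _ 0).row = M.row from rfl, hM.line u hun] at hline
    refine wp_loop (n + 1) (fun j s' => AgreeOff (mᵣ :: scratch) s' s ∧
        Loaded n (M.fill ({u} ×ˢ Set.Icc j n ∪ Set.Icc (b + (k + 1)) n ×ˢ Set.Iic n) 0) s' ∧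
        s'.reg mᵣ = 0 ∧ s'.reg cuᵣ = k ∧ s'.reg ubᵣ = rowBase n (7 + u) ∧ s'.reg cvᵣ = j)
      le_rfl (fun _ _ h => h.2.2.2.2.2) ?_ ?_ ?_
    · simp only [scratch, hk₁, Nat.cast_add, Nat.cast_one, hL₁.reg_one, add_sub_cancel_right,
        reg_setReg, Nat.reduceEqDiff, ↓reduceIte, hub, hL₁.reg_X, mem_setReg, hline, hL₁.reg_w,
        hL₁.reg_zero, add_zero, List.mem_cons, Nat.succ_ne_self, List.not_mem_nil, or_self,
        or_false, or_true, agreeOff_setReg, add_le_iff_nonpos_right, nonpos_iff_eq_zero,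
        one_ne_zero, not_false_eq_true, Set.Icc_eq_empty, Set.prod_empty, Set.empty_union,
        Nat.reduceLeDiff, Loaded.setReg, hL₁, hm₁, and_self, and_true]
      exact h₁
    · rintro j hj s₂ ⟨h₂, hL₂, hm₂, hk₂, hub₂, hj₂⟩
      have hjn : j ≤ n := by omega
      have hmem := hL₂.setMem_tab (u := u) hjn 0
      have hS : insert (u, j) ({u} ×ˢ Set.Icc (j + 1) n ∪ Set.Icc (b + (k + 1)) n ×ˢ Set.Iic n) =
          ({u} ×ˢ Set.Icc j n ∪ Set.Icc (b + (k + 1)) n ×ˢ Set.Iic n) := by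
        ext ⟨u', v'⟩
        simp only [Set.mem_insert_iff, Set.mem_union, Set.mem_prod, Set.mem_singleton_iff,
          Set.mem_Icc, Set.mem_Iic, Prod.mk.injEq]
        omega
      rw [show (0 : ℤ) = (0 : ℕ → ℕ → ℤ) u j from rfl, Memory.setTab_fill, hS] at hmem
      have hlt := toNat_rowBase_add_lt (n := n) (r := 7 + u) (by omega) hjn
      simp_all [hL₂.reg_one, hL₂.reg_zero]
    · rintro s₂ ⟨h₂, hL₂, hm₂, hk₂, -, -⟩
      refine ⟨h₂, ?_, hm₂, hk₂⟩
      convert hL₂ using 2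
      ext ⟨u', v'⟩
      simp
      omega

/-- The state at the beginning of a round of `solve` that computes, or has just computed, the lines
`b, …, n` of the table for the alive jobs `A` and the start time `t`, at stack height `h`. The mode
`m` is `1` when the computation begins and `0` when it is complete. -/
structure Frame (n : ℕ) (p d : ℕ → ℤ) (t : ℤ) (A : Finset ℕ) (b h : ℕ) (m : ℤ) (M : Memory)
    (s : RamState) : Prop extends Loaded n M s where
  clean : ∀ r, 20 ≤ r → s.reg r = 0
  stores : M.Stores n p d A
  subset : A ⊆ Finset.range n
  le : b ≤ n
  reg_st : s.reg stᵣ = t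
  reg_b : s.reg bᵣ = b
  reg_h : s.reg hᵣ = h
  reg_m : s.reg mᵣ = m

variable {t : ℤ} {m' : ℤ} {b' h h' : ℕ} {A' : Finset ℕ} {M' : Memory}

theorem Frame.wp_resetScratch {μ t' : ℤ} (hs : Frame n p d t A b h m' M s₀)
    (hs₀ : AgreeOff (F ++ scratch) s s₀) (hF : ∀ r ∈ F, 11 ≤ r ∧ r < 20)
    (hM' : M'.Describes n s.mem) (hstores : M'.Stores n p d A') (hA' : A' ⊆ Finset.range n)
    (hb'n : b' ≤ n) (ht' : s.reg stᵣ = t') (hb' : s.reg bᵣ = b') (hh' : s.reg hᵣ = h')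
    (hμ : s.reg mᵣ = μ)
    (hQ : ∀ s', AgreeOff F s' s₀ → Frame n p d t' A' b' h' μ M' s' →
      (∀ r < 20, s'.reg r = s.reg r) → Q s') :
    resetScratch.wp m N Q s := by
  refine Tardiness.wp_resetScratch hs.clean hs₀ fun s' h₁ hm₁ hr₁ => hQ s' h₁
    { hs.of_agreeOff h₁ (fun r hr => (hF r hr).1) (hm₁ ▸ hM') with
      clean := fun r hr => (h₁ r fun h => hr.not_gt (hF r h).2).trans (hs.clean r hr)
      stores := hstores
      subset := hA'
      le := hb'n
      reg_st := by rw [hr₁ _ (by decide), ht']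
      reg_b := by rw [hr₁ _ (by decide), hb']
      reg_h := by rw [hr₁ _ (by decide), hh']
      reg_m := by rw [hr₁ _ (by decide), hμ] } hr₁

theorem Frame.wp_solveRound_of_forall_lt (hs : Frame n p d t A b h 1 M s) (hp : ∀ i, 0 ≤ p i)
    (hlt : ∀ i ∈ A, i < b) :
    solveRound.wp (memSize n) n (fun s' => AgreeOff [bᵣ, hᵣ, mᵣ] s' s ∧
      Frame n p d t A b h 0 (M.fill (Set.Icc b n ×ˢ Set.Iic n) 0) s') s := by
  refine wp_cond (fun _ => wp_findLongest hs.toLoaded hs.stores hp hs.subset hs.reg_b hs.le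
    (fun s₁ h₁ hm₁ hx _ => ?_) fun s₁ l _ _ _ _ hl => absurd hl.le (hlt l hl.mem).not_ge)
    fun hm => by simp [hs.reg_m] at hm
  have hL₁ : Loaded n M s₁ := hs.of_agreeOff h₁ (by decide) (hm₁ ▸ hs.mem)
  refine wp_cond (fun hx' => absurd hx' hx.not_gt) fun _ =>
    wp_clearTable hL₁ hs.stores (by simp [h₁.reg, hs.reg_b]) hs.le fun s₂ h₂ hL₂ hm₂ => ?_
  exact hs.wp_resetScratch ((h₂.mono (by simp)).trans (h₁.mono (by simp))) (by decide) hL₂.mem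
    (hs.stores.congr rfl) hs.subset hs.le (by simp [h₂.reg, h₁.reg, hs.reg_st])
    (by simp [h₂.reg, h₁.reg, hs.reg_b]) (by simp [h₂.reg, h₁.reg, hs.reg_h]) hm₂
    fun _ h₁ h₂ _ => ⟨h₁, h₂⟩

/-- The first recursive call begins: the longest job `l` is removed. -/
theorem Frame.wp_solveRound_of_isFirstLongest (hs : Frame n p d t A b h 1 M s)
    (hp : ∀ i, 0 ≤ p i) (hhn : h ≤ n) (hl : IsFirstLongest p A b l) :
    solveRound.wp (memSize n) n (fun s' => AgreeOff [bᵣ, hᵣ, mᵣ] s' s ∧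
      Frame n p d t (A.erase l) b (h + 1) 1 (M.push l h b) s') s := by
  have hln : l < n := by simpa using hs.subset hl.mem
  refine wp_cond (fun _ => wp_findLongest hs.toLoaded hs.stores hp hs.subset hs.reg_b hs.le
    (fun s₁ _ _ _ hlt => absurd hl.le (hlt l hl.mem).not_ge) fun s₁ l' h₁ hm₁ hx hl₁ hl' => ?_)
    fun hm => by simp [hs.reg_m] at hm
  obtain rfl := hl.unique hl'
  have hL₁ : Loaded n M s₁ := hs.of_agreeOff h₁ (by decide) (hm₁ ▸ hs.mem)
  refine wp_cond (fun _ => ?_) fun hx' => absurd hx hx'.not_gt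
  have hL₂ := ((hL₁.setMem_row (r := 3) (by norm_num) hln.le 0).setMem_row (r := 4) (by norm_num)
    hhn l).setMem_row (r := 5) (by norm_num) hhn b
  have hlt : ∀ r < 7, ∀ i ≤ n, ((rowBase n r : ℤ) + i).toNat < memSize n := fun r hr i =>
    toNat_rowBase_add_lt (by omega)
  simp only [pushLongest, writeAt, incr, wp, scratch, List.mem_cons, Nat.reduceEqDiff,
    List.not_mem_nil, or_self, not_false_eq_true, h₁.reg, hs.reg_A, hl₁, reg_setReg, ↓reduceIte,
    Nat.reduceLT, hln.le, hlt, hs.reg_zero, setMem_setReg, reg_setMem, hs.reg_L, hs.reg_h, hhn,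
    Nat.succ_ne_self, hs.reg_B, hs.reg_b, OfNat.one_ne_ofNat, hs.reg_one, true_and]
  exact hs.wp_resetScratch (by simpa using h₁.mono (by simp)) (by decide) hL₂.mem
    (hs.stores.push _ _ _) ((Finset.erase_subset _ _).trans hs.subset) hs.le
    (by simp [h₁.reg, hs.reg_st]) (by simp [h₁.reg, hs.reg_b]) (by simp)
    (by simp [h₁.reg, hs.reg_m]) fun _ h₁ h₂ _ => ⟨h₁, h₂⟩

/-- The first recursive call returns, and the second one begins, after job `l`. -/
theorem Frame.wp_solveRound_resume (hs : Frame n p d t A b' (h + 1) 0 M s) (hh : 0 < h)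
    (hhn : h ≤ n) (hln : l < n) (hrowl : M.row 4 h = l) (hrowb : M.row 5 h = b) (hl : l ∉ A) :
    solveRound.wp (memSize n) n (fun s' => AgreeOff [bᵣ, hᵣ, mᵣ] s' s ∧
      Frame n p d t (insert l A) (l + 1) (h + 1) 1 (M.setRow 3 l 1) s') s := by
  have hflag := hs.mem_row (r := 3) (by norm_num) hln.le
  have htop := hs.mem_row (r := 4) (by norm_num) hhn
  have hline := hs.mem_row (r := 5) (by norm_num) hhn
  rw [hs.stores.alive l hln, if_neg hl] at hflag
  simp only [solveRound, ascend, decr, readAt, resumeAfter, writeAt, incr, skip, wp, hs.reg_m,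
    lt_self_iff_false, ↓reduceIte, hs.reg_h, Nat.cast_add, Nat.cast_one, hs.reg_one,
    add_sub_cancel_right, reg_setReg, Int.natCast_pos, hh, Nat.reduceEqDiff, hs.reg_L,
    mem_setReg, htop, hrowl, hs.reg_B, hline, hrowb, hs.reg_A, Nat.succ_ne_self, hflag,
    OfNat.one_ne_ofNat, setMem_setReg, reg_setMem]
  have hL := hs.setMem_row (r := 3) (by norm_num) hln.le 1
  exact ⟨toNat_rowBase_add_lt (by omega) hln.le, hs.wp_resetScratch (by simp) (by decide)
    hL.mem (hs.stores.insert _) (Finset.insert_subset (by simpa) hs.subset) hln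
    (by simp [hs.reg_st]) (by simp) (by simp) (by simp) fun _ h₁ h₂ _ => ⟨h₁, h₂⟩⟩

/-- The second recursive call returns, and its table is combined with that of the first one. -/
theorem Frame.wp_solveRound_combine {f : ℕ → ℕ → ℤ} (hs : Frame n p d t A b' (h + 1) 0 M s)
    (hh : 0 < h) (hhn : h ≤ n) (hln : l < n) (hbl : b ≤ l) (hrowl : M.row 4 h = l)
    (hrowb : M.row 5 h = b) (hl : l ∈ A)
    (hleft : ∀ u ∈ Set.Icc b l, ∀ c ∈ Set.Ioc l n, M.tab u c = segCost p d t (A.erase l) u c)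
    (hright : ∀ c ∈ Set.Ioc l n, ∀ v ∈ Set.Ioc l n, M.tab c v = segCost p d t A c v)
    (hf : ∀ u ∈ Set.Icc b l, ∀ v ∈ Set.Ioc l n,
      IsLeast (cutCost p d t A l u v '' Set.Ioc l v) (f u v)) :
    solveRound.wp (memSize n) n (fun s' => AgreeOff [bᵣ, hᵣ, mᵣ] s' s ∧
      Frame n p d t A b h 0 (M.fill (Set.Icc b l ×ˢ Set.Ioc l n) f) s') s := by
  have hflag := hs.mem_row (r := 3) (by norm_num) hln.le
  have htop := hs.mem_row (r := 4) (by norm_num) hhn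
  have hline := hs.mem_row (r := 5) (by norm_num) hhn
  rw [hs.stores.alive l hln, if_pos hl] at hflag
  simp only [solveRound, ascend, decr, readAt, skip, wp, hs.reg_m, lt_self_iff_false,
    ↓reduceIte, hs.reg_h, Nat.cast_add, Nat.cast_one, hs.reg_one, add_sub_cancel_right,
    reg_setReg, Int.natCast_pos, hh, Nat.reduceEqDiff, hs.reg_L, mem_setReg, htop, hrowl,
    hs.reg_B, hline, hrowb, hs.reg_A, Nat.succ_ne_self, hflag, zero_lt_one]
  obtain rfl := hs.reg_st
  refine wp_combine (b := b) (l := l) (f := f) (by simpa using hs.toLoaded) hs.stores (by simp)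
    (by simp) hbl hln (by simpa using hleft) (by simpa using hright) (by simpa using hf)
    fun s₂ h₂ hL₂ => ?_
  exact hs.wp_resetScratch ((h₂.mono (by simp)).trans (by simp)) (by decide) hL₂.mem
    (hs.stores.congr rfl) hs.subset (hbl.trans hln.le) (by simp [h₂.reg]) (by simp [h₂.reg])
    (by simp [h₂.reg]) (by simp [h₂.reg, hs.reg_m]) fun _ h₁ h₂ _ => ⟨h₁, h₂⟩

theorem Frame.wp_solveRound_finish (hs : Frame n p d t A b 1 0 M s) :
    solveRound.wp (memSize n) n (fun s' => AgreeOff [bᵣ, hᵣ, mᵣ] s' s ∧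
      Frame n p d t A b 0 0 M s') s := by
  simp only [solveRound, ascend, decr, readAt, skip, wp, hs.reg_m, lt_self_iff_false,
    ↓reduceIte, hs.reg_h, Nat.cast_one, hs.reg_one, sub_self, reg_setReg]
  exact hs.wp_resetScratch (by simp) (by decide) hs.mem hs.stores hs.subset hs.le
    (by simp [hs.reg_st]) (by simp [hs.reg_b]) (by simp) (by simp [hs.reg_m])
    fun _ h₁ h₂ _ => ⟨h₁, h₂⟩

end Rounds

/-! ### The recursion -/

namespace Memory

variable {n r i l h b : ℕ} {t x B : ℤ} {p d : ℕ → ℤ} {A : Finset ℕ} {M M' M₁ M₂ : Memory}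
  {S : Set (ℕ × ℕ)} {f : ℕ → ℕ → ℤ} {s : RamState}

/-- All entries of `M` that belong to the layout for `n` jobs have absolute value at most `B`. -/
structure Bounded (n : ℕ) (B : ℤ) (M : Memory) : Prop where
  inp : ∀ a < 3 * n, |M.inp a| ≤ B
  row : ∀ r < 7, ∀ i ≤ n, |M.row r i| ≤ B
  tab : ∀ u ≤ n, ∀ v ≤ n, |M.tab u v| ≤ B

theorem Describes.bounded (h : M.Describes n s.mem) (hs : BoundedBy B s) : M.Bounded n B where
  inp a ha := h.inp a ha ▸ hs.2 _
  row r hr i hi := h.row r hr i hi ▸ hs.2 _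
  tab u hu v hv := h.tab u hu v hv ▸ hs.2 _

theorem Describes.abs_mem_le (h : M.Describes n s.mem) (hM : M.Bounded n B)
    (hs : SupportedBelow (memSize n) s) (hB : 0 ≤ B) (a : ℕ) : |s.mem a| ≤ B := by
  rcases le_or_gt (memSize n) a with ha | ha
  · simpa [hs a ha] using hB
  obtain ha | ⟨r, hr, i, hi, rfl⟩ := lt_or_exists_eq_rowBase_add ha
  · exact h.inp a ha ▸ hM.inp a ha
  rcases lt_or_ge r 7 with hr7 | hr7
  · exact h.row r hr7 i hi ▸ hM.row r hr7 i hi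
  · obtain ⟨u, rfl⟩ := Nat.exists_eq_add_of_le hr7
    exact h.tab u (by omega) i hi ▸ hM.tab u (by omega) i hi

namespace Bounded

theorem setInp {a : ℕ} (hM : M.Bounded n B) (hx : |x| ≤ B) : (M.setInp a x).Bounded n B where
  inp a' ha' := by
    simp only [Memory.setInp, Function.update_apply]
    split_ifs
    exacts [hx, hM.inp a' ha']
  row := hM.row
  tab := hM.tab

theorem setRow (hM : M.Bounded n B) (hx : |x| ≤ B) : (M.setRow r i x).Bounded n B where
  inp := hM.inp
  row r' hr' i' hi' := by
    dsimp only [Memory.setRow]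
    split_ifs
    exacts [hx, hM.row r' hr' i' hi']
  tab := hM.tab

theorem push (hM : M.Bounded n B) (hB : (n : ℤ) ≤ B) (hl : l ≤ n) (hb : b ≤ n) :
    (M.push l h b).Bounded n B := by
  have hnat : ∀ k ≤ n, |(k : ℤ)| ≤ B := fun k hk => by rw [Nat.abs_cast]; omega
  exact ((hM.setRow (by simp; omega)).setRow (hnat l hl)).setRow (hnat b hb)

theorem fill (hM : M.Bounded n B) (hf : ∀ u v, (u, v) ∈ S → |f u v| ≤ B) :
    (M.fill S f).Bounded n B where
  inp := hM.inp
  row := hM.row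
  tab u hu v hv := by
    dsimp only [Memory.fill]
    split_ifs with h
    exacts [hf u v h, hM.tab u hu v hv]

end Bounded

theorem setRow_row_of_ne {r' i' : ℕ} (h : r' ≠ r ∨ i' ≠ i) :
    (M.setRow r i x).row r' i' = M.row r' i' :=
  if_neg (by tauto)

/-- The effect of a call that computes the lines `b, …, n` of the table at stack height `h`. -/
structure SolvedFrom (n : ℕ) (p d : ℕ → ℤ) (t : ℤ) (A : Finset ℕ) (b h : ℕ) (M M' : Memory) :
    Prop where
  inp : M'.inp = M.inp
  number : M'.row 2 = M.row 2
  stack : ∀ r ∈ [4, 5], ∀ i < h, M'.row r i = M.row r i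
  tab_of_lt : ∀ u < b, M'.tab u = M.tab u
  tab : ∀ u ∈ Set.Icc b n, ∀ v ≤ n, M'.tab u v = segCost p d t A u v

theorem solvedFrom_of_forall_lt (hA : ∀ i ∈ A, i < b) :
    SolvedFrom n p d t A b h M (M.fill (Set.Icc b n ×ˢ Set.Iic n) 0) where
  inp := rfl
  number := rfl
  stack _ _ _ _ := rfl
  tab_of_lt u hu := by
    ext v
    exact fill_tab_of_notMem fun h => hu.not_ge h.1.1
  tab u hu v hv := by
    have huv : (u, v) ∈ Set.Icc b n ×ˢ Set.Iic n := ⟨hu, hv⟩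
    refine (fill_tab_of_mem huv).trans (segCost_of_seg_eq_empty p d ?_).symm
    exact Finset.filter_false_of_mem fun i hi h => (hA i hi).not_ge (hu.1.trans h.1)

theorem SolvedFrom.row_four (h₁ : SolvedFrom n p d t A b (h + 1) (M.push l h r) M₁) :
    M₁.row 4 h = l := by
  rw [h₁.stack 4 (by decide) h h.lt_succ_self]
  simp [Memory.push, Memory.setRow]

theorem SolvedFrom.row_five (h₁ : SolvedFrom n p d t A b (h + 1) (M.push l h r) M₁) :
    M₁.row 5 h = r := by
  rw [h₁.stack 5 (by decide) h h.lt_succ_self]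
  simp [Memory.push, Memory.setRow]

/-- Without job `l`, the lines up to `l` are right in the columns up to `l`, and they serve to
compute the other columns; the lines after `l` do not depend on job `l`, but are overwritten by the
second call. -/
theorem SolvedFrom.combine (hbl : b ≤ l)
    (h₁ : SolvedFrom n p d t (A.erase l) b (h + 1) (M.push l h b) M₁)
    (h₂ : SolvedFrom n p d t A (l + 1) (h + 1) (M₁.setRow 3 l 1) M₂) :
    SolvedFrom n p d t A b h M (M₂.fill (Set.Icc b l ×ˢ Set.Ioc l n) (segCost p d t A)) where
  inp := h₂.inp.trans h₁.inp
  number := h₂.number.trans h₁.number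
  stack r hr i hi := by
    have hr3 : r ≠ 3 := ne_of_mem_of_not_mem hr (by decide)
    refine (h₂.stack r hr i (by omega)).trans ?_
    rw [setRow_row_of_ne (.inl hr3), h₁.stack r hr i (by omega),
      Memory.push, setRow_row_of_ne (.inr hi.ne), setRow_row_of_ne (.inr hi.ne),
      setRow_row_of_ne (.inl hr3)]
  tab_of_lt u hu := by
    ext v
    rw [fill_tab_of_notMem fun h => hu.not_ge h.1.1, h₂.tab_of_lt u (by omega)]
    exact congrFun (h₁.tab_of_lt u hu) v
  tab u hu v hv := by
    rcases le_or_gt u l with hul | hul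
    · rcases le_or_gt v l with hvl | hvl
      · rw [fill_tab_of_notMem fun h => hvl.not_gt h.2.1, h₂.tab_of_lt u (by omega)]
        exact (h₁.tab u hu v hv).trans (segCost_erase _ _ hul hvl)
      · exact fill_tab_of_mem ⟨⟨hu.1, hul⟩, hvl, hv⟩
    · rw [fill_tab_of_notMem fun h => hul.not_ge h.1.2]
      exact h₂.tab u ⟨hul, hu.2⟩ v hv

end Memory

section Recursion

variable {n b h b' h' k l : ℕ} {p d : ℕ → ℤ} {t m m' B C : ℤ} {A A' : Finset ℕ} {M M' : Memory}
  {s s' s'' : RamState}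

theorem exists_isFirstLongest (p : ℕ → ℤ) (h : ∃ i ∈ A, b ≤ i) : ∃ l, IsFirstLongest p A b l := by
  obtain ⟨i, hi, hbi⟩ := h
  obtain ⟨j, hj, hmax⟩ := Finset.exists_max_image {i ∈ A | b ≤ i} p ⟨i, by simp [hi, hbi]⟩
  have hex : ∃ l, (l ∈ A ∧ b ≤ l) ∧ p j ≤ p l := ⟨j, by simpa using hj, le_rfl⟩
  classical
  obtain ⟨⟨hl, hbl⟩, hle⟩ := Nat.find_spec hex
  exact ⟨_, hl, hbl, fun i hi hbi => (hmax i (by simp [hi, hbi])).trans hle, fun i hi hbi hlt =>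
    lt_of_not_ge fun hge => Nat.find_min hex hlt ⟨⟨hi, hbi⟩, hle.trans hge⟩⟩

namespace IsFirstLongest

theorem card_filter_erase_add_one (h : IsFirstLongest p A b l) :
    Finset.card {i ∈ A.erase l | b ≤ i} + 1 = Finset.card {i ∈ A | b ≤ i} := by
  rw [Finset.filter_erase, Finset.card_erase_add_one (by simp [h.mem, h.le])]

theorem filter_succ_subset (h : IsFirstLongest p A b l) :
    {i ∈ A | l + 1 ≤ i} ⊆ {i ∈ A.erase l | b ≤ i} := fun i hi => by
  have hle := h.le
  simp only [Finset.mem_filter, Finset.mem_erase] at hi ⊢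
  exact ⟨⟨by omega, hi.1⟩, by omega⟩

theorem filter_succ_eq (h : IsFirstLongest p A b l) (hp : ∀ i, p i = 0) :
    {i ∈ A | l + 1 ≤ i} = {i ∈ A.erase l | b ≤ i} := by
  refine h.filter_succ_subset.antisymm fun i hi => ?_
  simp only [Finset.mem_filter, Finset.mem_erase] at hi ⊢
  refine ⟨hi.1.2, lt_of_le_of_ne (not_lt.1 fun hlt => ?_) (Ne.symm hi.1.1)⟩
  exact absurd (h.lt_apply i hi.1.2 hi.2 hlt) (by simp [hp])

end IsFirstLongest

/-- The parts of the algorithm that run from one checkpoint to the next. At the checkpoints the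
registers and the memory hold numbers that occur in the recursion; the chunks are so short that
intermediate results can be estimated by `Exec.withinBounds`. -/
def chunks : List RamProg :=
  [prepare, beginPosition, nextJob, beginTry, solveRound, endTry, chooseBest]

/-- A bound on the number of steps of each chunk. -/
noncomputable def chunkCost : Polynomial ℕ := (chunks.map RamProg.cost).sum

theorem unitConsts_of_mem_chunks {a : RamProg} (ha : a ∈ chunks) : a.UnitConsts := by
  simp only [chunks, List.mem_cons, List.not_mem_nil, or_false] at ha
  obtain rfl | rfl | rfl | rfl | rfl | rfl | rfl := ha <;>
    simp [prepare, initConstants, initLines, sortJobs, computeRank, beginPosition, nextJob,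
      beginTry, solveRound, descend, ascend, findLongest, pushLongest, clearTable, combine,
      combineLine, combineEntry, tryCut, evalCut, sumBelow, keepMin, posPart, resumeAfter,
      resetScratch, zeroRegs, scratch, endTry, chooseBest, readAt, writeAt, copy, incr, decr, skip,
      UnitConsts]

theorem cost_le_chunkCost {a : RamProg} (ha : a ∈ chunks) :
    a.cost.eval n ≤ chunkCost.eval n := by
  have h := List.single_le_sum (l := chunks.map (·.cost.eval n)) (fun _ _ => Nat.zero_le _) _
    (List.mem_map_of_mem ha)
  rwa [chunkCost, ← Polynomial.coe_evalRingHom, map_list_sum, List.map_map]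

theorem runs_chunk {a : RamProg} {Q : RamState → Prop} (ha : a ∈ chunks) (hB : 1 ≤ B)
    (hC : 2 ^ chunkCost.eval n * B ≤ C) (hs : WithinBounds (memSize n) B s)
    (h : a.wp (memSize n) n Q s) :
    Runs (WithinBounds (memSize n) C) a s 0 (chunkCost.eval n)
      fun s' => SupportedBelow (memSize n) s' ∧ Q s' := by
  have hcost := cost_le_chunkCost (n := n) ha
  refine (h.runs (unitConsts_of_mem_chunks ha) hB hs (le_trans ?_ hC)).mono le_rfl hcost fun _ => id
  exact mul_le_mul_of_nonneg_right (pow_le_pow_right₀ one_le_two hcost) (by omega)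

theorem runs_chunk_of_agreeOff {a : RamProg} {Q : RamState → Prop} {F : List ℕ} (ha : a ∈ chunks)
    (hB : 1 ≤ B) (hC : 2 ^ chunkCost.eval n * B ≤ C) (hs : WithinBounds (memSize n) B s)
    (h : a.wp (memSize n) n (fun s' => AgreeOff F s' s ∧ Q s') s)
    (hreg : ∀ s', Q s' → ∀ r ∈ F, |s'.reg r| ≤ B)
    (hmem : ∀ s', Q s' → ∃ M : Memory, M.Describes n s'.mem ∧ M.Bounded n B) :
    Runs (WithinBounds (memSize n) C) a s 0 (chunkCost.eval n)
      fun s' => WithinBounds (memSize n) B s' ∧ AgreeOff F s' s ∧ Q s' := by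
  refine (runs_chunk ha hB hC hs h).mono le_rfl le_rfl
    fun s' ⟨hsupp, hF, hQ⟩ => ⟨⟨hsupp, ?_⟩, hF, hQ⟩
  obtain ⟨M, hM, hMB⟩ := hmem s' hQ
  exact hs.2.of_agreeOff hF (hreg s' hQ) (hM.abs_mem_le hMB hsupp (by omega))

/-- `r` rounds of `solve` take the machine from `s` to `s'`, and the bound `B` on the contents of
the machine holds again in the end. -/
structure RoundsTo (n : ℕ) (B C : ℤ) (r : ℕ) (s s' : RamState) : Prop where
  rounds : Rounds (WithinBounds (memSize n) C) hᵣ solveRound (chunkCost.eval n) r s s'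
  agreeOff : AgreeOff [bᵣ, hᵣ, mᵣ] s' s
  withinBounds : WithinBounds (memSize n) B s'

theorem RoundsTo.trans {r r' : ℕ} (h : RoundsTo n B C r s s') (h' : RoundsTo n B C r' s' s'') :
    RoundsTo n B C (r + r') s s'' where
  rounds := h.rounds.trans h'.rounds
  agreeOff := h'.agreeOff.trans h.agreeOff
  withinBounds := h'.withinBounds

section Round

variable (hB : n + 1 ≤ B) (hC : 2 ^ chunkCost.eval n * B ≤ C)
include hB hC

theorem Frame.exists_roundsTo_one (hs : Frame n p d t A b h m M s)
    (hsB : WithinBounds (memSize n) B s) (hh : 0 < h)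
    (hwp : solveRound.wp (memSize n) n (fun s' => AgreeOff [bᵣ, hᵣ, mᵣ] s' s ∧
      Frame n p d t A' b' h' m' M' s') s)
    (hM' : M.Bounded n B → M'.Bounded n B) (hh' : h' ≤ n + 1) (hm' : |m'| ≤ 1) :
    ∃ s', RoundsTo n B C 1 s s' ∧ Frame n p d t A' b' h' m' M' s' := by
  have hrun := runs_chunk_of_agreeOff (by simp [chunks]) (by omega) hC hsB hwp (fun s' hs' => ?_)
    fun s' hs' => ⟨M', hs'.mem, hM' (hs.mem.bounded hsB.2)⟩
  · obtain ⟨s', hround, hsB', hagree, hs'⟩ :=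
      Runs.rounds (by rw [hs.reg_h]; exact_mod_cast hh) hrun
    exact ⟨s', ⟨hround, hagree, hsB'⟩, hs'⟩
  · have := hs'.le
    simp [hs'.reg_b, hs'.reg_h, hs'.reg_m]
    omega

theorem Frame.exists_roundsTo_one_combine {M₁ M₂ : Memory} (hp : ∀ i, 0 ≤ p i)
    (hd : MonotoneOn d (Finset.range n)) (hs : Frame n p d t A b' (h + 1) 0 M₂ s)
    (hsB : WithinBounds (memSize n) B s) (hh : 0 < h) (hhn : h ≤ n) (hl : IsFirstLongest p A b l)
    (h₁ : Memory.SolvedFrom n p d t (A.erase l) b (h + 1) (M.push l h b) M₁)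
    (h₂ : Memory.SolvedFrom n p d t A (l + 1) (h + 1) (M₁.setRow 3 l 1) M₂)
    (hseg : ∀ A' ⊆ A, ∀ u v, segCost p d t A' u v ≤ B) :
    ∃ s', RoundsTo n B C 1 s s' ∧ Frame n p d t A b h 0
      (M₂.fill (Set.Icc b l ×ˢ Set.Ioc l n) (segCost p d t A)) s' := by
  have hln : l < n := by simpa using hs.subset hl.mem
  have hstack : ∀ r ∈ [4, 5], M₂.row r h = M₁.row r h := fun r hr =>
    (h₂.stack r hr h h.lt_succ_self).trans
      (Memory.setRow_row_of_ne (.inl (ne_of_mem_of_not_mem hr (by decide))))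
  refine hs.exists_roundsTo_one hB hC hsB h.succ_pos (hs.wp_solveRound_combine hh hhn hln hl.le
    ((hstack 4 (by decide)).trans h₁.row_four) ((hstack 5 (by decide)).trans h₁.row_five) hl.mem
    (fun u hu c hc => ?_) (fun c hc v hv => ?_) fun u hu v hv => ?_) (·.fill fun u v _ => ?_)
    (by omega) (by simp)
  · rw [h₂.tab_of_lt u (Nat.lt_succ_of_le hu.2)]
    exact h₁.tab u ⟨hu.1, hu.2.trans hln.le⟩ c hc.2
  · exact h₂.tab c ⟨hc.1, hc.2⟩ v hv.2
  · refine isLeast_segCost d hp (hd.mono hs.subset) (mem_seg.2 ⟨hl.mem, hu.2, hv.1⟩) fun i hi => ?_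
    exact hl.le_apply i (mem_seg.1 hi).1 (hu.1.trans (mem_seg.1 hi).2.1)
  · rw [abs_of_nonneg (segCost_nonneg ..)]
    exact hseg A subset_rfl u v

/-- One call of the recursion. The number `R k` of rounds for `k` jobs satisfies
`R (k + 1) = 3 + R k + R k'`, where `k' ≤ k` is the number of the jobs after the first longest one;
for jobs of length `0` this is the first job, hence `k' = k`. -/
theorem Frame.exists_roundsTo (hp : ∀ i, 0 ≤ p i) (hd : MonotoneOn d (Finset.range n))
    (hcard : Finset.card {i ∈ A | b ≤ i} = k) (hs : Frame n p d t A b h 1 M s)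
    (hsB : WithinBounds (memSize n) B s) (hh : 0 < h) (hhk : h + k ≤ n + 1)
    (hseg : ∀ A' ⊆ A, ∀ u v, segCost p d t A' u v ≤ B) :
    ∃ r M' s', RoundsTo n B C r s s' ∧ Frame n p d t A b h 0 M' s' ∧
      Memory.SolvedFrom n p d t A b h M M' ∧ r + 3 ≤ 4 * 2 ^ k ∧ ((∀ i, p i = 0) → 2 ^ k ≤ r) := by
  induction k using Nat.strong_induction_on generalizing A b h M s with
  | _ k ih =>
  obtain hlt | hex : (∀ i ∈ A, i < b) ∨ ∃ i ∈ A, b ≤ i := by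
    by_contra! hcon
    obtain ⟨⟨i, hi, hbi⟩, hlt⟩ := hcon
    exact (hlt i hi).not_ge hbi
  · obtain ⟨s₁, h₁, hs₁⟩ := hs.exists_roundsTo_one hB hC hsB hh
      (hs.wp_solveRound_of_forall_lt hp hlt) (·.fill fun _ _ _ => by simp; omega) (by omega)
      (by simp)
    rw [Finset.filter_false_of_mem fun i hi => (hlt i hi).not_ge, Finset.card_empty] at hcard
    subst hcard
    exact ⟨1, _, s₁, h₁, hs₁, Memory.solvedFrom_of_forall_lt hlt, by simp, by simp⟩
  obtain ⟨l, hl⟩ := exists_isFirstLongest p hex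
  have hln : l < n := by simpa using hs.subset hl.mem
  have hk₁ := hl.card_filter_erase_add_one.trans hcard
  have hk₂ := Finset.card_le_card hl.filter_succ_subset
  obtain ⟨s₁, h₁, hs₁⟩ := hs.exists_roundsTo_one hB hC hsB hh
    (hs.wp_solveRound_of_isFirstLongest hp (by omega) hl)
    (·.push (by omega) hln.le hs.le) (by omega) (by simp)
  obtain ⟨r₁, M₂, s₂, h₂, hs₂, hM₂, hr₁, hr₁'⟩ := ih _ (by omega) rfl hs₁ h₁.withinBounds
    h.succ_pos (by omega) fun A' hA' => hseg A' (hA'.trans (Finset.erase_subset _ _))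
  obtain ⟨s₃, h₃, hs₃⟩ := hs₂.exists_roundsTo_one hB hC h₂.withinBounds h.succ_pos
    (hs₂.wp_solveRound_resume hh (by omega) hln hM₂.row_four hM₂.row_five (by simp))
    (·.setRow (by simp; omega)) (by omega) (by simp)
  rw [Finset.insert_erase hl.mem] at hs₃
  obtain ⟨r₂, M₄, s₄, h₄, hs₄, hM₄, hr₂, hr₂'⟩ := ih _ (by omega) rfl hs₃ h₃.withinBounds
    h.succ_pos (by omega) hseg
  obtain ⟨s₅, h₅, hs₅⟩ := hs₄.exists_roundsTo_one_combine hB hC hp hd h₄.withinBounds hh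
    (by omega) hl hM₂ hM₄ hseg
  refine ⟨_, _, s₅, (((h₁.trans h₂).trans h₃).trans h₄).trans h₅, hs₅, hM₂.combine hl.le hM₄,
    ?_, fun h₀ => ?_⟩
  · have := Nat.pow_le_pow_right two_pos hk₂
    rw [← hk₁, pow_succ]
    omega
  · have h₁' := hr₁' h₀
    have h₂' := hr₂' h₀
    rw [hl.filter_succ_eq h₀] at h₂'
    rw [← hk₁, pow_succ]
    omega

end Round

end Recursion

/-! ### The outer loops -/

section Outer

variable {n : ℕ} {p d : ℕ → ℤ} {t B C : ℤ} {A : Finset ℕ} {M : Memory} {s s' : RamState}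

theorem sub_le_sum_add_abs {i : ℕ} (hi : i < n) (ht : t ≤ ∑ i ∈ Finset.range n, p i) :
    t - d i ≤ ∑ i ∈ Finset.range n, (p i + |d i|) := by
  have hd := Finset.single_le_sum (f := fun i => |d i|) (fun i _ => abs_nonneg (d i))
    (Finset.mem_range.2 hi)
  rw [Finset.sum_add_distrib]
  linarith [neg_abs_le (d i)]

/-- The standing assumptions on the jobs, sorted by due date, and on the size `B` of the numbers at
the checkpoints and `C` of all numbers. -/
structure Setting (n : ℕ) (p d : ℕ → ℤ) (B C : ℤ) : Prop where
  nonneg : ∀ i, 0 ≤ p i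
  monotoneOn : MonotoneOn d (Finset.range n)
  le : memSize n + (n + 1) * ∑ i ∈ Finset.range n, (p i + |d i|) ≤ B
  pow_mul_le : 2 ^ chunkCost.eval n * B ≤ C

namespace Setting

variable (h : Setting n p d B C)
include h

theorem sum_nonneg : 0 ≤ ∑ i ∈ Finset.range n, (p i + |d i|) :=
  Finset.sum_nonneg fun i _ => add_nonneg (h.nonneg i) (abs_nonneg _)

theorem memSize_le : memSize n ≤ B :=
  le_trans (le_add_of_nonneg_right (mul_nonneg (by positivity) h.sum_nonneg)) h.le

theorem add_one_le : n + 1 ≤ B := by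
  have := h.memSize_le
  have : n + 1 ≤ memSize n := by rw [memSize, rowBase]; nlinarith
  omega

theorem le_right : B ≤ C :=
  (le_mul_of_one_le_left (by linarith [h.add_one_le]) (one_le_pow₀ one_le_two)).trans h.pow_mul_le

theorem sum_le : ∑ i ∈ Finset.range n, p i ≤ B := by
  have := Finset.sum_nonneg fun i (_ : i ∈ Finset.range n) => abs_nonneg (d i)
  have hle := h.le
  rw [Finset.sum_add_distrib] at hle
  have := Finset.sum_nonneg fun i (_ : i ∈ Finset.range n) => h.nonneg i
  nlinarith [(memSize n).cast_nonneg (α := ℤ)]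

theorem segCost_le (hA : A ⊆ Finset.range n)
    (ht : t + ∑ i ∈ A, p i ≤ ∑ i ∈ Finset.range n, p i) (u v : ℕ) : segCost p d t A u v ≤ B := by
  refine (Tardiness.segCost_le d h.nonneg hA h.sum_nonneg fun i hi =>
    sub_le_sum_add_abs (Finset.mem_range.1 (hA hi)) ht).trans ?_
  linarith [h.le, h.sum_nonneg, (memSize n).cast_nonneg (α := ℤ)]

theorem optCostFirst_lt (hA : A ⊆ Finset.range n) {j : ℕ} (hj : j ∈ A)
    (ht : t + ∑ i ∈ A, p i ≤ ∑ i ∈ Finset.range n, p i) : optCostFirst p d t A j < B := by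
  have hsum : t + p j + ∑ i ∈ A.erase j, p i ≤ ∑ i ∈ Finset.range n, p i := by
    rwa [add_assoc, Finset.add_sum_erase _ _ hj]
  have hnonneg := Finset.sum_nonneg fun i (_ : i ∈ A.erase j) => h.nonneg i
  have hopt := optCost_le_card_mul p d h.nonneg (t + p j) h.sum_nonneg fun i hi =>
    sub_le_sum_add_abs (Finset.mem_range.1 (hA (Finset.mem_of_mem_erase hi))) hsum
  have hmax := max_le (sub_le_sum_add_abs (Finset.mem_range.1 (hA hj)) (t := t + p j) (by linarith))
    h.sum_nonneg
  have hcard : (Finset.card (A.erase j) : ℤ) ≤ n := by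
    exact_mod_cast (Finset.card_le_card ((Finset.erase_subset j A).trans hA)).trans_eq (by simp)
  have := h.le
  have := mul_le_mul_of_nonneg_right hcard h.sum_nonneg
  have : 0 < memSize n := by rw [memSize, rowBase]; positivity
  rw [optCostFirst]
  linarith

end Setting

open Classical in
/-- A lower bound on the number of rounds of the recursion for `k` jobs, only of interest for jobs
of length `0`. -/
noncomputable def minRounds (p : ℕ → ℤ) (k : ℕ) : ℕ := if ∀ i, p i = 0 then 2 ^ k else 0

theorem Frame.runs_solve (h : Setting n p d B C) (hs : Frame n p d t A 0 1 1 M s)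
    (hsB : WithinBounds (memSize n) B s) (ht : t + ∑ i ∈ A, p i ≤ ∑ i ∈ Finset.range n, p i) :
    Runs (WithinBounds (memSize n) C) solve s (minRounds p A.card)
      (1 + 4 * 2 ^ A.card * (1 + chunkCost.eval n)) fun s' => WithinBounds (memSize n) B s' ∧
        AgreeOff [bᵣ, hᵣ, mᵣ] s' s ∧ ∃ M', Frame n p d t A 0 0 0 M' s' ∧ M'.inp = M.inp ∧
          M'.row 2 = M.row 2 ∧ M'.tab 0 n = optCost p d t A := by
  have hcard : A.card ≤ n := by simpa using Finset.card_le_card hs.subset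
  have hseg : ∀ A' ⊆ A, ∀ u v, segCost p d t A' u v ≤ B := fun A' hA' =>
    h.segCost_le (hA'.trans hs.subset) <| ht.trans' <| add_le_add_right
      (Finset.sum_le_sum_of_subset_of_nonneg hA' fun i _ _ => h.nonneg i) _
  obtain ⟨r, M₁, s₁, h₁, hs₁, hM₁, hr, hr'⟩ := hs.exists_roundsTo h.add_one_le h.pow_mul_le
    h.nonneg h.monotoneOn (k := A.card) (by simp) hsB one_pos (by omega) hseg
  obtain ⟨s₂, h₂, hs₂⟩ := hs₁.exists_roundsTo_one h.add_one_le h.pow_mul_le h₁.withinBounds one_pos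
    hs₁.wp_solveRound_finish id (by omega) (by simp)
  have h₁₂ := h₁.trans h₂
  refine (h₁₂.rounds.runs_loop (by simp [hs₂.reg_h]) ⟨h₂.withinBounds.1,
    h₂.withinBounds.2.mono h.le_right⟩).mono ?_ ?_ ?_
  · rw [minRounds]
    split_ifs with h₀
    exacts [(hr' h₀).trans (by omega), Nat.zero_le _]
  · gcongr
    omega
  · rintro _ rfl
    refine ⟨h₂.withinBounds, h₁₂.agreeOff, M₁, hs₂, hM₁.inp, hM₁.number, ?_⟩
    rw [hM₁.tab 0 ⟨le_rfl, Nat.zero_le n⟩ n le_rfl, segCost_zero_eq_optCost p d hs.subset]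

end Outer

section OuterChunks

attribute [local simp] RamProg.wp readAt writeAt copy incr decr skip

variable {n m N j k : ℕ} {p d f : ℕ → ℤ} {t : ℤ} {A : Finset ℕ} {S : Set ℕ} {M : Memory}
  {s : RamState}

theorem Memory.Stores.setInp {i : ℕ} {x : ℤ} (h : M.Stores n p d A) :
    (M.setInp i x).Stores n p d A :=
  h.congr rfl

/-- The best of the candidates `S` tried so far, where `f j` is the value of the candidate `j`: the
register `R[best]` holds one more than its value, or `0` if there is none. -/
structure RunningBest (f : ℕ → ℤ) (S : Set ℕ) (s : RamState) : Prop where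
  min : RunningMin (f '' S) (s.reg bestᵣ)
  arg : 0 < s.reg bestᵣ → ∃ i ∈ S, s.reg bestjᵣ = i ∧ f i + 1 = s.reg bestᵣ

theorem RunningBest.congr {s' : RamState} (h : RunningBest f S s)
    (hbest : s'.reg bestᵣ = s.reg bestᵣ) (hbestj : s'.reg bestjᵣ = s.reg bestjᵣ) :
    RunningBest f S s' :=
  ⟨hbest ▸ h.min, by simpa only [hbest, hbestj] using h.arg⟩

theorem wp_beginPosition (hs : Loaded n M s) :
    beginPosition.wp m N (fun s' => AgreeOff [bestᵣ, jᵣ] s' s ∧ s'.mem = s.mem ∧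
      s'.reg bestᵣ = 0 ∧ s'.reg jᵣ = n) s := by
  simp [beginPosition, hs.reg_n, hs.reg_zero]

theorem Frame.wp_nextJob (hs : Frame n p d t A 0 0 0 M s) (hj : s.reg jᵣ = j + 1) (hjn : j < n) :
    nextJob.wp (memSize n) N (fun s' => AgreeOff [jᵣ, stᵣ, mᵣ] s' s ∧ s'.reg jᵣ = j ∧
      Frame n p d (rowBase n 3 + j) A 0 0 (if j ∈ A then 1 else 0) M s') s := by
  have halive := hs.mem_row (r := 3) (by norm_num) hjn.le
  rw [hs.stores.alive j hjn] at halive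
  simp only [nextJob, decr, wp, hj, hs.reg_one, add_sub_cancel_right, reg_setReg,
    Nat.reduceEqDiff, ↓reduceIte, hs.reg_A, mem_setReg, halive, List.mem_cons, List.not_mem_nil,
    or_false, or_true, agreeOff_setReg, or_self, AgreeOff.refl, true_and]
  exact { hs.of_agreeOff (F := [jᵣ, stᵣ, mᵣ]) (by simp) (by decide) hs.mem with
    clean := fun r hr => by
      have hr' : r ≠ jᵣ ∧ r ≠ stᵣ ∧ r ≠ mᵣ := by omega
      simp [hr', hs.clean r hr]
    stores := hs.stores
    subset := hs.subset
    le := hs.le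
    reg_st := by simp
    reg_b := by simp [hs.reg_b]
    reg_h := by simp [hs.reg_h]
    reg_m := by simp }

theorem Frame.wp_beginTry (hs : Frame n p d t A 0 0 1 M s) (hj : s.reg jᵣ = j) (hjn : j < n) :
    beginTry.wp (memSize n) n (fun s' => AgreeOff [stᵣ, hᵣ] s' s ∧
      Frame n p d (s.reg startᵣ + p j) (A.erase j) 0 1 1 (M.setRow 3 j 0) s') s := by
  have hlt : ∀ r < 7, ∀ i ≤ n, ((rowBase n r : ℤ) + i).toNat < memSize n := fun r hr i =>
    toNat_rowBase_add_lt (by omega)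
  have hL := hs.setMem_row (r := 3) (by norm_num) hjn.le 0
  have htime := hL.mem_row (r := 0) (by norm_num) hjn.le
  rw [(hs.stores.erase j).p j hjn] at htime
  simp only [mem_setMem, beginTry, writeAt, readAt, wp, hs.reg_A, hj, reg_setReg, ↓reduceIte,
    Nat.reduceLT, hjn.le, hlt, Nat.reduceEqDiff, hs.reg_zero, setMem_setReg, reg_setMem,
    hs.reg_P, mem_setReg, true_and] at htime ⊢
  exact hs.wp_resetScratch (by simp [scratch]) (by decide) hL.mem (hs.stores.erase j)
    ((Finset.erase_subset _ _).trans hs.subset) (Nat.zero_le n) (by simp [htime])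
    (by simp [hs.reg_b]) (by simp) (by simp [hs.reg_m]) fun _ h₁ h₂ _ => ⟨h₁, h₂⟩

theorem wp_keepBest {Q : RamState → Prop} (hs : Loaded n M s) (hj : s.reg jᵣ = j)
    (hy : s.reg yᵣ = f j) (hf : 0 ≤ f j) (hbest : RunningBest f S s)
    (hQ : ∀ s', AgreeOff [addrᵣ, bestᵣ, bestjᵣ, yᵣ, zᵣ] s' s → s'.mem = s.mem →
      RunningBest f (insert j S) s' → Q s') :
    (keepMin bestᵣ yᵣ (copy bestjᵣ jᵣ)).wp m N Q s := by
  refine wp_keepMin (by decide) hs.reg_one hs.reg_zero hbest.min (hy ▸ hf)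
    (fun s' h hm hx hV => ?_) fun s' h hm hx hpos hV => ?_
  all_goals rw [hy] at hV; rw [← Set.image_insert_eq] at hV
  · refine hQ _ (by simpa using h.mono (by simp)) hm ⟨by simpa using hV, fun _ => ⟨j, by simp, ?_⟩⟩
    simp [h.reg, hs.reg_zero, hj, hx, hy]
  · refine hQ _ (h.mono (by simp)) hm ⟨hV, fun _ => ?_⟩
    obtain ⟨i, hi, harg, hval⟩ := hbest.arg hpos
    exact ⟨i, Set.mem_insert_of_mem _ hi, by rwa [h.reg _ (by decide)], by rw [hval, hx]⟩

theorem Frame.wp_endTry (hs : Frame n p d t (A.erase j) 0 0 0 M s) (hjA : j ∈ A)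
    (hA : A ⊆ Finset.range n) (hj : s.reg jᵣ = j) (hf : max (t - d j) 0 + M.tab 0 n = f j)
    (hf₀ : 0 ≤ f j) (hbest : RunningBest f S s) :
    endTry.wp (memSize n) n (fun s' => AgreeOff [bestᵣ, bestjᵣ] s' s ∧
      Frame n p d t A 0 0 0 (M.setRow 3 j 1) s' ∧ RunningBest f (insert j S) s') s := by
  have hjn : j < n := Finset.mem_range.1 (hA hjA)
  have hlt : ∀ r < 7, ∀ i ≤ n, ((rowBase n r : ℤ) + i).toNat < memSize n := fun r hr i =>
    toNat_rowBase_add_lt (by omega)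
  have hL := hs.setMem_row (r := 3) (by norm_num) hjn.le 1
  have hM := hs.stores.insert j
  rw [Finset.insert_erase hjA] at hM
  have hdue := hL.mem_row (r := 1) (by norm_num) hjn.le
  have hline := hL.mem_row (r := 6) (by norm_num) n.zero_le
  have htab := hL.mem_tab n.zero_le le_rfl
  rw [hM.d j hjn] at hdue
  rw [hM.line 0 n.zero_le] at hline
  simp only [mem_setMem, CharP.cast_eq_zero, add_zero, Int.toNat_natCast, endTry, writeAt,
    readAt, copy, wp, hs.reg_A, hj, reg_setReg, ↓reduceIte, Nat.reduceLT, hjn.le, hlt,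
    mem_setReg, OfNat.zero_ne_ofNat, Nat.reduceEqDiff, OfNat.one_ne_ofNat, hs.reg_one,
    setMem_setReg, reg_setMem, hs.reg_D, true_and] at hdue hline htab ⊢
  refine wp_posPart fun s₁ h₁ hm₁ hy₁ => ?_
  simp only [List.mem_cons, Nat.reduceEqDiff, List.not_mem_nil, or_self, not_false_eq_true, h₁.reg,
    hdue, hs.reg_st, reg_setReg, ↓reduceIte, reg_setMem, hs.reg_X, hs.reg_zero, add_zero,
    Int.toNat_natCast, hm₁, mem_setReg, mem_setMem, hline, OfNat.zero_ne_ofNat, hs.reg_n, htab, hy₁]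
  have hL₁ : Loaded n (M.setRow 3 j 1) s₁ := hL.of_agreeOff (F := [addrᵣ, yᵣ])
    (h₁.trans (by simp)) (by decide) (hm₁ ▸ hL.mem)
  refine wp_keepBest (f := f) (S := S) (M := M.setRow 3 j 1) (by simpa) (by simp [h₁.reg, hj])
    (by simpa [Memory.setRow] using hf) hf₀ (hbest.congr (by simp [h₁.reg]) (by simp [h₁.reg]))
    fun s₂ h₂ hm₂ hbest₂ => ?_
  have h₂₁ : AgreeOff ([bestᵣ, bestjᵣ] ++ scratch) s₂ s :=
    (h₂.mono (by simp [scratch])).trans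
      (by simpa [scratch] using (h₁.mono (by simp)).trans (by simp))
  exact hs.wp_resetScratch h₂₁ (by decide) (hm₂ ▸ hL₁.mem) hM hA (Nat.zero_le n)
    (by simp [h₂.reg, h₁.reg, hs.reg_st]) (by simp [h₂.reg, h₁.reg, hs.reg_b])
    (by simp [h₂.reg, h₁.reg, hs.reg_h]) (by simp [h₂.reg, h₁.reg, hs.reg_m])
    fun s' h hs' hreg => ⟨h, hs', hbest₂.congr (hreg _ (by decide)) (hreg _ (by decide))⟩

theorem Frame.wp_chooseBest (hs : Frame n p d t A 0 0 0 M s) (hj : s.reg bestjᵣ = j) (hjn : j < n)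
    (hk : s.reg posᵣ = k + 1) (hkn : k < n) :
    chooseBest.wp (memSize n) n (fun s' => AgreeOff [startᵣ, posᵣ] s' s ∧
      Frame n p d t (A.erase j) 0 0 0
        ((M.setRow 3 j 0).setInp (3 * n - (k + 1)) (M.row 2 j)) s' ∧
      s'.reg startᵣ = s.reg startᵣ + p j ∧ s'.reg posᵣ = k) s := by
  have hlt : ∀ r < 7, ∀ i ≤ n, ((rowBase n r : ℤ) + i).toNat < memSize n := fun r hr i =>
    toNat_rowBase_add_lt (by omega)
  have hL := hs.setMem_row (r := 3) (by norm_num) hjn.le 0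
  have htime := hL.mem_row (r := 0) (by norm_num) hjn.le
  have hnumber := hL.mem_row (r := 2) (by norm_num) hjn.le
  rw [(hs.stores.erase j).p j hjn] at htime
  rw [Memory.setRow_row_of_ne (by simp)] at hnumber
  have hout : ((rowBase n 0 : ℤ) - (k + 1)).toNat = 3 * n - (k + 1) := by rw [rowBase]; omega
  have hout_lt : 3 * n - (k + 1) < memSize n := by rw [memSize, rowBase]; omega
  simp only [mem_setMem, chooseBest, writeAt, readAt, decr, wp, hs.reg_A, hj, reg_setReg,
    ↓reduceIte, Nat.reduceLT, hjn.le, hlt, Nat.reduceEqDiff, hs.reg_zero, setMem_setReg,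
    reg_setMem, hs.reg_P, mem_setReg, hs.reg_I, hk, hout, hout_lt, OfNat.one_ne_ofNat,
    hs.reg_one, add_sub_cancel_right, true_and] at htime hnumber ⊢
  refine hs.wp_resetScratch (F := [startᵣ, posᵣ]) (by simp [scratch]) (by decide) ?_
    (hs.stores.erase j).setInp ((Finset.erase_subset _ _).trans hs.subset) (Nat.zero_le n)
    (by simp [hs.reg_st]) (by simp [hs.reg_b]) (by simp [hs.reg_h]) (by simp [hs.reg_m])
    fun s' h₁ h₂ hreg => ⟨h₁, h₂, by simp [hreg, htime], by simp [hreg]⟩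
  simpa [hnumber] using hL.mem.setInp (i := 3 * n - (k + 1)) (x := M.row 2 j) (by omega)

end OuterChunks

section OuterLoops

variable {n j : ℕ} {p d f : ℕ → ℤ} {t B C : ℤ} {A : Finset ℕ} {S : Set ℕ} {M : Memory}
  {s : RamState}

theorem RunningBest.abs_le (h : RunningBest f S s) (hS : S.Nonempty)
    (hf : ∀ i ∈ S, 0 ≤ f i ∧ f i < B) (hn : ∀ i ∈ S, i ≤ B) :
    |s.reg bestᵣ| ≤ B ∧ |s.reg bestjᵣ| ≤ B := by
  obtain ⟨i, hi, hval⟩ := (h.min.isLeast (hS.image f)).1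
  obtain ⟨i', hi', harg, -⟩ := h.arg (by linarith [(hf i hi).1])
  rw [harg, Nat.abs_cast, abs_of_nonneg (by linarith [(hf i hi).1])]
  exact ⟨by linarith [(hf i hi).2], hn i' hi'⟩

theorem Frame.runs_beginTry (h : Setting n p d B C) (hs : Frame n p d t A 0 0 1 M s)
    (hsB : WithinBounds (memSize n) B s) (hj : s.reg jᵣ = j) (hjn : j < n)
    (h₀ : 0 ≤ s.reg startᵣ + p j) (hB : s.reg startᵣ + p j ≤ B) :
    Runs (WithinBounds (memSize n) C) beginTry s 0 (chunkCost.eval n) fun s' =>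
      WithinBounds (memSize n) B s' ∧ AgreeOff [stᵣ, hᵣ] s' s ∧
        Frame n p d (s.reg startᵣ + p j) (A.erase j) 0 1 1 (M.setRow 3 j 0) s' := by
  have hnB := h.add_one_le
  refine runs_chunk_of_agreeOff (by simp [chunks]) (by omega) h.pow_mul_le hsB
    (hs.wp_beginTry hj hjn) (fun s' hs' => ?_) fun s' hs' =>
      ⟨_, hs'.mem, (hs.mem.bounded hsB.2).setRow (by simp; omega)⟩
  simp [hs'.reg_st, hs'.reg_h, abs_of_nonneg h₀, hB]
  omega

theorem Frame.runs_endTry (h : Setting n p d B C) (hs : Frame n p d t (A.erase j) 0 0 0 M s)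
    (hsB : WithinBounds (memSize n) B s) (hA : A ⊆ Finset.range n) (hjS : insert j S ⊆ (A : Set ℕ))
    (hj : s.reg jᵣ = j) (hfj : max (t - d j) 0 + M.tab 0 n = f j)
    (hf : ∀ i ∈ insert j S, 0 ≤ f i ∧ f i < B) (hbest : RunningBest f S s) :
    Runs (WithinBounds (memSize n) C) endTry s 0 (chunkCost.eval n) fun s' =>
      WithinBounds (memSize n) B s' ∧ AgreeOff [bestᵣ, bestjᵣ] s' s ∧
        Frame n p d t A 0 0 0 (M.setRow 3 j 1) s' ∧ RunningBest f (insert j S) s' := by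
  have hnB := h.add_one_le
  have hj' := Set.mem_insert j S
  refine runs_chunk_of_agreeOff (by simp [chunks]) (by omega) h.pow_mul_le hsB
    (hs.wp_endTry (hjS hj') hA hj hfj (hf j hj').1 hbest) (fun s' hs' => ?_) fun s' hs' =>
      ⟨_, hs'.1.mem, (hs.mem.bounded hsB.2).setRow (by simp; omega)⟩
  simpa using hs'.2.abs_le ⟨j, hj'⟩ hf fun i hi => by
    have := Finset.mem_range.1 (hA (hjS hi))
    omega

theorem Frame.runs_evaluate (h : Setting n p d B C) (hs : Frame n p d t A 0 0 1 M s)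
    (hsB : WithinBounds (memSize n) B s) (hj : s.reg jᵣ = j) (hjA : j ∈ A) (h₀ : 0 ≤ s.reg startᵣ)
    (hle : s.reg startᵣ + ∑ i ∈ A, p i ≤ ∑ i ∈ Finset.range n, p i) (hS : S ⊆ A)
    (hbest : RunningBest (optCostFirst p d (s.reg startᵣ) A) S s) :
    Runs (WithinBounds (memSize n) C) (beginTry ⨾ solve ⨾ endTry) s (minRounds p (A.card - 1))
      (3 + 2 * chunkCost.eval n + 4 * 2 ^ (A.card - 1) * (1 + chunkCost.eval n)) fun s' =>
        WithinBounds (memSize n) B s' ∧ AgreeOff [bestᵣ, bestjᵣ, stᵣ, bᵣ, hᵣ, mᵣ] s' s ∧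
          (∃ t' M', Frame n p d t' A 0 0 0 M' s' ∧ M'.inp = M.inp ∧ M'.row 2 = M.row 2) ∧
            RunningBest (optCostFirst p d (s.reg startᵣ) A) (insert j S) s' := by
  have hjn : j < n := Finset.mem_range.1 (hs.subset hjA)
  have hjS : insert j S ⊆ (A : Set ℕ) := Set.insert_subset (by simpa) hS
  have hsum : s.reg startᵣ + p j + ∑ i ∈ A.erase j, p i ≤ ∑ i ∈ Finset.range n, p i := by
    rwa [add_assoc, Finset.add_sum_erase _ _ hjA]
  have hnonneg := Finset.sum_nonneg fun i (_ : i ∈ A.erase j) => h.nonneg i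
  rw [← Finset.card_erase_of_mem hjA]
  refine ((hs.runs_beginTry h hsB hj hjn (add_nonneg h₀ (h.nonneg j)) (by linarith [h.sum_le])).seq
    fun s₁ ⟨hs₁B, h₁, hs₁⟩ => (hs₁.runs_solve h hs₁B hsum).seq
    fun s₂ ⟨hs₂B, h₂, M₂, hs₂, hinp, hnumber, htab⟩ => (hs₂.runs_endTry h hs₂B hs.subset hjS
      (by rw [h₂.reg _ (by decide), h₁.reg _ (by decide), hj]) (by rw [htab, optCostFirst])
      (fun i hi => ⟨optCostFirst_nonneg .., h.optCostFirst_lt hs.subset (hjS hi) hle⟩)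
      (hbest.congr (by rw [h₂.reg _ (by decide), h₁.reg _ (by decide)])
        (by rw [h₂.reg _ (by decide), h₁.reg _ (by decide)]))).mono le_rfl le_rfl
    fun s₃ ⟨hs₃B, h₃, hs₃, hbest₃⟩ => ⟨hs₃B, ?_, ⟨_, _, hs₃, hinp, ?_⟩, hbest₃⟩).mono
      (by omega) (by omega) fun _ => id
  · exact (h₃.mono (by simp)).trans ((h₂.mono (by simp)).trans (h₁.mono (by simp)))
  · ext i
    rw [Memory.setRow_row_of_ne (by simp), hnumber, Memory.setRow_row_of_ne (by simp)]

end OuterLoops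

section FillPosition

variable {n j k : ℕ} {p d : ℕ → ℤ} {t B C : ℤ} {A : Finset ℕ} {M : Memory} {s s' : RamState}
  {inp ν : ℕ → ℤ}

/-- A checkpoint of the outer loops: no call is active, the jobs `A` are alive, and `inp` and `ν`
are the contents of the input and output cells and of the row of job numbers. -/
structure Idle (n : ℕ) (p d : ℕ → ℤ) (A : Finset ℕ) (B : ℤ) (inp ν : ℕ → ℤ) (s : RamState) :
    Prop where
  frame : ∃ t M, Frame n p d t A 0 0 0 M s ∧ M.inp = inp ∧ M.row 2 = ν
  withinBounds : WithinBounds (memSize n) B s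

theorem Frame.runs_nextJob (h : Setting n p d B C) (hs : Frame n p d t A 0 0 0 M s)
    (hsB : WithinBounds (memSize n) B s) (hj : s.reg jᵣ = j + 1) (hjn : j < n) :
    Runs (WithinBounds (memSize n) C) nextJob s 0 (chunkCost.eval n) fun s' =>
      WithinBounds (memSize n) B s' ∧ AgreeOff [jᵣ, stᵣ, mᵣ] s' s ∧ s'.reg jᵣ = j ∧
        Frame n p d (rowBase n 3 + j) A 0 0 (if j ∈ A then 1 else 0) M s' := by
  have hnB := h.add_one_le
  have hmB := h.memSize_le
  have hlt : rowBase n 3 + j < memSize n := rowBase_add_lt (by omega) hjn.le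
  refine runs_chunk_of_agreeOff (by simp [chunks]) (by omega) h.pow_mul_le hsB
    (hs.wp_nextJob hj hjn) (fun s' ⟨hj', hs'⟩ => ?_) fun s' hs' =>
      ⟨_, hs'.2.mem, hs.mem.bounded hsB.2⟩
  simp only [List.forall_mem_cons, hj', hs'.reg_st, hs'.reg_m]
  refine ⟨?_, ?_, ?_, by simp⟩
  · rw [Nat.abs_cast]; omega
  · rw [← Nat.cast_add, Nat.abs_cast]; omega
  · split_ifs <;> simp <;> omega

theorem runs_skip {G : RamState → Prop} (hs : s.reg addrᵣ = 0) (hG : G s) :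
    Runs G skip s 0 1 (· = s) :=
  .one (fun k => by rw [skip, RamConfig.step, RamState.setReg, ← hs, Function.update_eq_self])
    hG rfl

theorem Idle.runs_tryJob (h : Setting n p d B C) (hs : Idle n p d A B inp ν s)
    (hj : s.reg jᵣ = j + 1) (hjn : j < n) (h₀ : 0 ≤ s.reg startᵣ)
    (hle : s.reg startᵣ + ∑ i ∈ A, p i ≤ ∑ i ∈ Finset.range n, p i)
    (hbest : RunningBest (optCostFirst p d (s.reg startᵣ) A) {i | i ∈ A ∧ j + 1 ≤ i} s) :
    Runs (WithinBounds (memSize n) C) tryJob s (if j ∈ A then minRounds p (A.card - 1) else 0)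
      (9 * (2 ^ n * (1 + chunkCost.eval n))) fun s' => Idle n p d A B inp ν s' ∧
        AgreeOff [jᵣ, bestᵣ, bestjᵣ, stᵣ, bᵣ, hᵣ, mᵣ] s' s ∧ s'.reg jᵣ = j ∧
          RunningBest (optCostFirst p d (s.reg startᵣ) A) {i | i ∈ A ∧ j ≤ i} s' := by
  obtain ⟨⟨t, M, hM, rfl, rfl⟩, hsB⟩ := hs
  have hcard : A.card - 1 ≤ n := by have := Finset.card_le_card hM.subset; simp at this; omega
  have hpow : 2 ^ (A.card - 1) ≤ 2 ^ n := Nat.pow_le_pow_right two_pos hcard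
  have hpos := Nat.one_le_two_pow (n := n)
  refine ((hM.runs_nextJob h hsB hj hjn).seq fun s₁ ⟨hs₁B, h₁, hj₁, hM₁⟩ =>
    Runs.cond (lo := if j ∈ A then minRounds p (A.card - 1) else 0)
      (hi := 3 + 2 * chunkCost.eval n + 4 * 2 ^ (A.card - 1) * (1 + chunkCost.eval n))
      (fun hm => ?_) fun hm => ?_).mono (by omega) (by nlinarith) fun _ => id
  all_goals
    have hstart : s₁.reg startᵣ = s.reg startᵣ := h₁.reg _ (by decide)
    have hbest₁ := hbest.congr (h₁.reg bestᵣ (by decide)) (h₁.reg bestjᵣ (by decide))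
    rw [hM₁.reg_m] at hm
  · have hjA : j ∈ A := by by_contra hjA; simp [hjA] at hm
    have hset : insert j {i | i ∈ A ∧ j + 1 ≤ i} = {i | i ∈ A ∧ j ≤ i} := by
      ext i; simp only [Set.mem_insert_iff, Set.mem_ofPred_eq]; grind
    rw [if_pos hjA] at hM₁ ⊢
    rw [← hstart] at h₀ hle hbest₁ ⊢
    exact (hM₁.runs_evaluate h hs₁B hj₁ hjA h₀ hle (fun i hi => hi.1) hbest₁).mono le_rfl le_rfl
      fun s₂ ⟨hs₂B, h₂, ⟨t', M', hM', hinp, hν⟩, hbest₂⟩ => ⟨⟨⟨t', M', hM', hinp, hν⟩, hs₂B⟩,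
        (h₂.mono (by simp)).trans (h₁.mono (by simp)), by rw [h₂.reg _ (by decide), hj₁],
        hset ▸ hbest₂⟩
  · have hjA : j ∉ A := fun hjA => by simp [hjA] at hm
    have hset : {i | i ∈ A ∧ j + 1 ≤ i} = {i | i ∈ A ∧ j ≤ i} := by
      ext i; simp only [Set.mem_ofPred_eq]; grind
    rw [if_neg hjA] at hM₁ ⊢
    refine (runs_skip (hM₁.clean _ le_rfl) ⟨hs₁B.1, hs₁B.2.mono h.le_right⟩).mono le_rfl
      (by omega) ?_
    rintro _ rfl
    exact ⟨⟨⟨_, M, hM₁, rfl, rfl⟩, hs₁B⟩, h₁.mono (by simp), hj₁, hset ▸ hbest₁⟩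

theorem Frame.runs_chooseBest (h : Setting n p d B C) (hs : Frame n p d t A 0 0 0 M s)
    (hsB : WithinBounds (memSize n) B s) (hj : s.reg bestjᵣ = j) (hjA : j ∈ A)
    (hk : s.reg posᵣ = k + 1) (hkn : k < n) (h₀ : 0 ≤ s.reg startᵣ)
    (hle : s.reg startᵣ + ∑ i ∈ A, p i ≤ ∑ i ∈ Finset.range n, p i) :
    Runs (WithinBounds (memSize n) C) chooseBest s 0 (chunkCost.eval n) fun s' =>
      Idle n p d (A.erase j) B (Function.update M.inp (3 * n - (k + 1)) (M.row 2 j)) (M.row 2) s' ∧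
        s'.reg startᵣ = s.reg startᵣ + p j ∧ s'.reg posᵣ = k := by
  have hjn : j < n := Finset.mem_range.1 (hs.subset hjA)
  have hnB := h.add_one_le
  have hMB := hs.mem.bounded hsB.2
  have hpj := h.nonneg j
  have hstart : s.reg startᵣ + p j ≤ B := by
    linarith [h.sum_le, Finset.single_le_sum (fun i _ => h.nonneg i) hjA]
  refine (runs_chunk_of_agreeOff (by simp [chunks]) (by omega) h.pow_mul_le hsB
    (hs.wp_chooseBest hj hjn hk hkn) (fun s' ⟨_, hstart', hpos'⟩ => ?_) fun s' hs' =>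
      ⟨_, hs'.1.mem, (hMB.setRow (by simp; omega)).setInp (hMB.row 2 (by norm_num) j hjn.le)⟩).mono
    le_rfl le_rfl fun s' ⟨hsB', _, hs', hstart', hpos'⟩ =>
      ⟨⟨⟨t, _, hs', rfl, funext fun i => ?_⟩, hsB'⟩, hstart', hpos'⟩
  · simp [hstart', hpos', abs_of_nonneg (add_nonneg h₀ hpj), hstart]
    omega
  · simp [Memory.setInp, Memory.setRow]

theorem Idle.runs_tryJobs (h : Setting n p d B C) (hs : Idle n p d A B inp ν s)
    (hA : A.Nonempty) (hj : s.reg jᵣ = n) (hbest : s.reg bestᵣ = 0) (h₀ : 0 ≤ s.reg startᵣ)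
    (hle : s.reg startᵣ + ∑ i ∈ A, p i ≤ ∑ i ∈ Finset.range n, p i) :
    Runs (WithinBounds (memSize n) C) (.loop jᵣ tryJob) s (minRounds p (A.card - 1))
      (1 + n * (1 + 9 * (2 ^ n * (1 + chunkCost.eval n)))) fun s' =>
        Idle n p d A B inp ν s' ∧ AgreeOff [jᵣ, bestᵣ, bestjᵣ, stᵣ, bᵣ, hᵣ, mᵣ] s' s ∧
          RunningBest (optCostFirst p d (s.reg startᵣ) A) A s' := by
  have hsub : A ⊆ Finset.range n := by
    obtain ⟨t, M, hM, -⟩ := hs.frame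
    exact hM.subset
  have hlo : ∑ j ∈ Finset.range n, (if j ∈ A then minRounds p (A.card - 1) else 0) =
      A.card * minRounds p (A.card - 1) := by
    rw [Finset.sum_ite_mem, Finset.inter_eq_right.2 hsub, Finset.sum_const, smul_eq_mul]
  have hempty : {i | i ∈ A ∧ n ≤ i} = ∅ := by
    ext i
    simpa using fun hi => Finset.mem_range.1 (hsub hi)
  refine (Runs.loop (Inv := fun j s' => Idle n p d A B inp ν s' ∧
    AgreeOff [jᵣ, bestᵣ, bestjᵣ, stᵣ, bᵣ, hᵣ, mᵣ] s' s ∧ s'.reg jᵣ = j ∧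
      RunningBest (optCostFirst p d (s.reg startᵣ) A) {i | i ∈ A ∧ j ≤ i} s')
    (fun j s' hs' => hs'.2.2.1) (fun s' hs' => ⟨hs'.1.withinBounds.1,
      hs'.1.withinBounds.2.mono h.le_right⟩)
    (fun j hjn s' ⟨hs', hagree, hj', hbest'⟩ => ?_) ⟨hs, .refl _ _, hj, ?_⟩).mono
      (hlo ▸ Nat.le_mul_of_pos_left _ hA.card_pos) le_rfl
      fun s' ⟨hs', hagree, _, hbest'⟩ => ⟨hs', hagree, by simpa using hbest'⟩
  · have hstart : s'.reg startᵣ = s.reg startᵣ := hagree.reg _ (by decide)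
    rw [← hstart] at h₀ hle hbest' ⊢
    exact (hs'.runs_tryJob h (by simpa using hj') hjn h₀ hle hbest').mono le_rfl le_rfl
      fun s'' ⟨hs'', hagree', h'⟩ => ⟨hs'', hagree'.trans hagree, h'⟩
  · rw [hempty]
    exact ⟨by simp [hbest, runningMin_empty], by simp [hbest]⟩

theorem Frame.of_agreeOff {F : List ℕ} (hs : Frame n p d t A 0 0 0 M s) (h : AgreeOff F s' s)
    (hF : ∀ r ∈ F, 11 ≤ r ∧ r < 16) (hmem : s'.mem = s.mem) : Frame n p d t A 0 0 0 M s' := by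
  have hreg : ∀ r, 16 ≤ r → s'.reg r = s.reg r := fun r hr => h r fun hrF =>
    absurd (hF r hrF).2 hr.not_gt
  exact { hs.toLoaded.of_agreeOff h (fun r hr => (hF r hr).1) (hmem ▸ hs.mem) with
    clean := fun r hr => by rw [hreg r (by omega), hs.clean r hr]
    stores := hs.stores
    subset := hs.subset
    le := hs.le
    reg_st := by rw [hreg _ (by norm_num), hs.reg_st]
    reg_b := by rw [hreg _ (by norm_num), hs.reg_b]
    reg_h := by rw [hreg _ (by norm_num), hs.reg_h]
    reg_m := by rw [hreg _ (by norm_num), hs.reg_m] }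

theorem Idle.runs_beginPosition (h : Setting n p d B C) (hs : Idle n p d A B inp ν s) :
    Runs (WithinBounds (memSize n) C) beginPosition s 0 (chunkCost.eval n) fun s' =>
      Idle n p d A B inp ν s' ∧ AgreeOff [bestᵣ, jᵣ] s' s ∧ s'.reg bestᵣ = 0 ∧ s'.reg jᵣ = n := by
  obtain ⟨⟨t, M, hM, rfl, rfl⟩, hsB⟩ := hs
  have hnB := h.add_one_le
  refine (runs_chunk_of_agreeOff (by simp [chunks]) (by omega) h.pow_mul_le hsB
    (wp_beginPosition hM.toLoaded) (fun s' ⟨_, hbest', hj'⟩ => ?_) fun s' ⟨hmem, _⟩ =>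
      ⟨M, hmem ▸ hM.mem, hM.mem.bounded hsB.2⟩).mono le_rfl le_rfl
    fun s' ⟨hs'B, hagree, hmem, hbest', hj'⟩ =>
      ⟨⟨⟨t, M, hM.of_agreeOff hagree (by decide) hmem, rfl, rfl⟩, hs'B⟩, hagree, hbest', hj'⟩
  simp [hbest', hj']
  omega

theorem Idle.runs_fillPosition (h : Setting n p d B C) (hs : Idle n p d A B inp ν s)
    (hA : A.Nonempty) (hk : s.reg posᵣ = k + 1) (hkn : k < n) (h₀ : 0 ≤ s.reg startᵣ)
    (hle : s.reg startᵣ + ∑ i ∈ A, p i ≤ ∑ i ∈ Finset.range n, p i) :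
    Runs (WithinBounds (memSize n) C) fillPosition s (minRounds p (A.card - 1))
      ((3 + 10 * n) * (2 ^ n * (1 + chunkCost.eval n))) fun s' => ∃ j ∈ A,
        optCostFirst p d (s.reg startᵣ) A j = optCost p d (s.reg startᵣ) A ∧
          Idle n p d (A.erase j) B (Function.update inp (3 * n - (k + 1)) (ν j)) ν s' ∧
            s'.reg startᵣ = s.reg startᵣ + p j ∧ s'.reg posᵣ = k := by
  have hpow : 1 + chunkCost.eval n ≤ 2 ^ n * (1 + chunkCost.eval n) :=
    Nat.le_mul_of_pos_left _ (by positivity)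
  refine ((hs.runs_beginPosition h).seq fun s₁ ⟨hs₁, h₁, hbest₁, hj₁⟩ => Runs.seq
    (lo := minRounds p (A.card - 1)) (hi := 1 + n * (1 + 9 * (2 ^ n * (1 + chunkCost.eval n))))
    (lo' := 0) (hi' := chunkCost.eval n)
    (P := fun s' => Idle n p d A B inp ν s' ∧ AgreeOff [jᵣ, bestᵣ, bestjᵣ, stᵣ, bᵣ, hᵣ, mᵣ] s' s ∧
      RunningBest (optCostFirst p d (s.reg startᵣ) A) A s') ?_
    fun s₂ ⟨⟨⟨t, M, hM, hinp, hν⟩, hs₂B⟩, h₂, hbest₂⟩ => ?_).mono (by omega) ?_ fun _ => id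
  · have hstart : s₁.reg startᵣ = s.reg startᵣ := h₁.reg _ (by decide)
    rw [← hstart] at h₀ hle ⊢
    exact (hs₁.runs_tryJobs h hA hj₁ hbest₁ h₀ hle).mono le_rfl le_rfl fun s₂ ⟨hs₂, h₂, hbest₂⟩ =>
      ⟨hs₂, h₂.trans (h₁.mono (by simp)), hbest₂⟩
  · have hmin := hbest₂.min.isLeast (hA.to_set.image _)
    have hopt := hmin.unique (isLeast_optCostFirst p d _ hA)
    have hopt₀ := optCost_nonneg p d (s.reg startᵣ) A
    obtain ⟨j, hjA, hj, hval⟩ := hbest₂.arg (by omega)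
    have hstart : s₂.reg startᵣ = s.reg startᵣ := h₂.reg _ (by decide)
    rw [← hstart] at h₀ hle
    refine (hM.runs_chooseBest h hs₂B hj hjA (by rw [h₂.reg _ (by decide), hk]) hkn h₀ hle).mono
      le_rfl le_rfl fun s₃ ⟨hs₃, hstart₃, hpos₃⟩ => ⟨j, hjA, by omega, ?_, ?_, hpos₃⟩
    · rwa [hinp, hν] at hs₃
    · rw [hstart₃, hstart]
  · have := Nat.le_mul_of_pos_right n (hpow.trans_lt' (by omega))
    linarith

end FillPosition

section Filled

variable {n k : ℕ} {p d : ℕ → ℤ} {B C : ℤ} {A : Finset ℕ} {l : List ℕ} {s : RamState} {ν : ℕ → ℤ}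

/-- The jobs `l` fill the first positions, and some optimal sequence of all jobs begins with `l` and
continues with the alive jobs `A`. The number of job `j` is `ν j`. -/
structure Filled (n : ℕ) (p d : ℕ → ℤ) (B : ℤ) (ν : ℕ → ℤ) (l : List ℕ) (A : Finset ℕ)
    (s : RamState) : Prop where
  idle : ∃ inp, Idle n p d A B inp ν s ∧ ∀ i (hi : i < l.length), inp (2 * n + i) = ν l[i]
  enumerates : ∀ l', Enumerates A l' → Enumerates (Finset.range n) (l ++ l')
  cost : seqCost p d 0 l + optCost p d (l.map p).sum A = optCost p d 0 (Finset.range n)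
  reg_start : s.reg startᵣ = (l.map p).sum
  reg_pos : s.reg posᵣ = A.card

theorem Filled.runs_fillPosition (h : Setting n p d B C) (hs : Filled n p d B ν l A s)
    (hA : A.card = k + 1) :
    Runs (WithinBounds (memSize n) C) fillPosition s (minRounds p k)
      ((3 + 10 * n) * (2 ^ n * (1 + chunkCost.eval n))) fun s' => ∃ j ∈ A,
        Filled n p d B ν (l ++ [j]) (A.erase j) s' := by
  obtain ⟨inp, hidle, hinp⟩ := hs.idle
  have hall := hs.enumerates _ (enumerates_toList A)
  have hlen : l.length + (k + 1) = n := by simpa [hA] using hall.length_eq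
  have hsum : (l.map p).sum + ∑ i ∈ A, p i = ∑ i ∈ Finset.range n, p i := by
    simpa [(enumerates_toList A).sum_map p] using hall.sum_map p
  have hstart := hs.reg_start
  refine (hidle.runs_fillPosition (k := k) h (Finset.card_pos.1 (by omega))
    (by rw [hs.reg_pos, hA]; push_cast; rfl) (by omega)
    (hstart ▸ sum_map_nonneg h.nonneg l) (by rw [hstart, hsum])).mono
      (by rw [hA, Nat.add_sub_cancel]) le_rfl
    fun s' ⟨j, hjA, hj, hidle', hstart', hpos'⟩ => ⟨j, hjA, ?_⟩
  have hcard := Finset.card_erase_of_mem hjA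
  exact {
    idle := ⟨_, hidle', fun i hi => by
      have hout : 3 * n - (k + 1) = 2 * n + l.length := by omega
      rcases (Nat.lt_succ_iff.1 (by simpa using hi)).lt_or_eq with hi' | rfl
      · rw [Function.update_of_ne (by omega), hinp i hi', List.getElem_append_left hi']
      · simp [hout]⟩
    enumerates := fun l' hl' => by simpa using hs.enumerates _ (hl'.cons_of_erase hjA)
    cost := by
      rw [hstart, optCostFirst] at hj
      rw [seqCost_append, ← hs.cost, ← hj]
      simp [seqCost, add_assoc]
    reg_start := by simp [hstart', hstart]
    reg_pos := by simp [hpos', hcard, hA] }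

theorem Filled.runs_loop (h : Setting n p d B C) (hs : Filled n p d B ν [] (Finset.range n) s) :
    Runs (WithinBounds (memSize n) C) (.loop posᵣ fillPosition) s
      (∑ k ∈ Finset.range n, minRounds p k)
      (1 + n * (1 + (3 + 10 * n) * (2 ^ n * (1 + chunkCost.eval n)))) fun s' =>
        WithinBounds (memSize n) C s' ∧ ∃ l, Enumerates (Finset.range n) l ∧
          seqCost p d 0 l = optCost p d 0 (Finset.range n) ∧
          ∀ i (hi : i < l.length), s'.mem (2 * n + i) = ν l[i] := by
  have hG : ∀ s l A, Filled n p d B ν l A s → WithinBounds (memSize n) C s := fun s l A hs =>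
    let ⟨inp, hidle, _⟩ := hs.idle
    ⟨hidle.withinBounds.1, hidle.withinBounds.2.mono h.le_right⟩
  refine (Runs.loop (Inv := fun k s => ∃ l A, A.card = k ∧ Filled n p d B ν l A s)
    (fun k s ⟨l, A, hA, hs⟩ => hA ▸ hs.reg_pos) (fun s ⟨l, A, _, hs⟩ => hG s l A hs)
    (fun k _ s ⟨l, A, hA, hs⟩ => (hs.runs_fillPosition h hA).mono le_rfl le_rfl
      fun s' ⟨j, hjA, hs'⟩ => ⟨_, _, by rw [Finset.card_erase_of_mem hjA, hA]; rfl, hs'⟩)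
    ⟨[], _, Finset.card_range n, hs⟩).mono le_rfl le_rfl fun s' ⟨l, A, hA, hs'⟩ => ?_
  obtain rfl := Finset.card_eq_zero.1 hA
  obtain ⟨inp, ⟨⟨t, M, hM, rfl, -⟩, -⟩, hinp⟩ := hs'.idle
  have hl : Enumerates (Finset.range n) l := by simpa using hs'.enumerates [] rfl
  refine ⟨hG s' l ∅ hs', l, hl, by simpa [optCost_empty] using hs'.cost, fun i hi => ?_⟩
  have hlen := hl.length_eq
  rw [Finset.card_range] at hlen
  rw [hM.mem.inp _ (by omega), hinp i hi]

end Filled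

/-! ### Sorting the jobs by due date -/

section Sorting

variable {n k : ℕ}

theorem sort_lt_iff {α : Type*} [LinearOrder α] (f : Fin n → α) {i j : Fin n} :
    f (Tuple.sort f i) < f (Tuple.sort f j) ∨
      f (Tuple.sort f i) = f (Tuple.sort f j) ∧ Tuple.sort f i < Tuple.sort f j ↔ i < j :=
  Prod.Lex.lt_iff.symm.trans ((Tuple.eq_sort_iff'.1 rfl).lt_iff_lt (a := i) (b := j))

theorem card_filter_eq_sort_symm {α : Type*} [LinearOrder α] (f : Fin n → α) (j : Fin n) :
    Finset.card {i | f i < f j ∨ f i = f j ∧ i < j} = ((Tuple.sort f).symm j : ℕ) := by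
  rw [← Fin.card_Iio, ← Finset.card_map (Tuple.sort f).toEmbedding (s := Finset.Iio _)]
  congr 1
  ext i
  rw [Finset.mem_map_equiv, Finset.mem_Iio, ← sort_lt_iff f]
  simp

theorem card_filter_le_and {P : Fin n → Prop} [DecidablePred P] (i : Fin n) :
    Finset.card {j : Fin n | i ≤ j ∧ P j} =
      Finset.card {j : Fin n | (i : ℕ) + 1 ≤ j ∧ P j} + if P i then 1 else 0 := by
  have hne : ∀ j, i ≤ j ↔ i = j ∨ (i : ℕ) + 1 ≤ j := fun j => by
    rw [Fin.le_def, Fin.ext_iff]; omega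
  by_cases hi : P i
  · rw [if_pos hi, ← Finset.card_insert_of_notMem (a := i) (by simp)]
    congr 1
    ext j
    have := hne j
    grind
  · rw [if_neg hi, add_zero]
    congr 1
    ext j
    have := hne j
    grind

variable (I : TardinessInstance n)

/-- The numbers `f`, one for each job, in order of due dates: the value for the job in position `k`
of the order, and `0` if there is no such position. -/
def byDueDate (f : Fin n → ℤ) (k : ℕ) : ℤ :=
  if h : k < n then f (Tuple.sort I.d ⟨k, h⟩) else 0

theorem byDueDate_sort_symm (f : Fin n → ℤ) (j : Fin n) :
    byDueDate I f ((Tuple.sort I.d).symm j) = f j := by simp [byDueDate]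

theorem byDueDate_nonneg {f : Fin n → ℤ} (hf : ∀ j, 0 ≤ f j) (k : ℕ) : 0 ≤ byDueDate I f k := by
  rw [byDueDate]
  split_ifs
  exacts [hf _, le_rfl]

theorem monotoneOn_byDueDate : MonotoneOn (byDueDate I I.d) (Finset.range n) := by
  intro i hi j hj hij
  rw [Finset.coe_range, Set.mem_Iio] at hi hj
  rw [byDueDate, byDueDate, dif_pos hi, dif_pos hj]
  exact Tuple.monotone_sort I.d (Fin.mk_le_mk.2 hij)

theorem sum_byDueDate_add_abs (f g : Fin n → ℤ) :
    ∑ i ∈ Finset.range n, (byDueDate I f i + |byDueDate I g i|) = ∑ j, (f j + |g j|) := by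
  rw [Finset.sum_range, ← Equiv.sum_comp (Tuple.sort I.d) fun j => f j + |g j|]
  simp [byDueDate]

end Sorting

namespace Memory

variable {n k c : ℕ} {I : TardinessInstance n} {M : Memory} {B : ℤ}

/-- The contents `M` with the data of a job and the flag of an alive job in position `k` of the
rows. -/
def putJob (M : Memory) (k : ℕ) (p d ν : ℤ) : Memory :=
  (((M.setRow 0 k p).setRow 1 k d).setRow 2 k ν).setRow 3 k 1

/-- The jobs with numbers from `c` on have been sorted into the rows. -/
structure SortedFrom (I : TardinessInstance n) (c : ℕ) (M : Memory) : Prop where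
  inp_p : ∀ j : Fin n, M.inp j = I.p j
  inp_d : ∀ j : Fin n, M.inp (n + j) = I.d j
  line : ∀ u ≤ n, M.row 6 u = rowBase n (7 + u)
  p : ∀ j : Fin n, c ≤ j → M.row 0 ((Tuple.sort I.d).symm j) = I.p j
  d : ∀ j : Fin n, c ≤ j → M.row 1 ((Tuple.sort I.d).symm j) = I.d j
  number : ∀ j : Fin n, c ≤ j → M.row 2 ((Tuple.sort I.d).symm j) = (j : ℕ)
  alive : ∀ j : Fin n, c ≤ j → M.row 3 ((Tuple.sort I.d).symm j) = 1

namespace SortedFrom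

theorem putJob {j : Fin n} (h : M.SortedFrom I (j + 1)) :
    (M.putJob ((Tuple.sort I.d).symm j) (I.p j) (I.d j) (j : ℕ)).SortedFrom I j := by
  have hrow : ∀ i : Fin n, j ≤ i → i = j ∨ (j : ℕ) + 1 ≤ i := fun i hi => by
    rw [Fin.le_def] at hi; rw [Fin.ext_iff]; omega
  constructor
  case inp_p => exact h.inp_p
  case inp_d => exact h.inp_d
  case line => exact fun u hu => by simpa [Memory.putJob, Memory.setRow] using h.line u hu
  all_goals
    intro i hi
    simp only [Memory.putJob, Memory.setRow, Fin.val_inj, EmbeddingLike.apply_eq_iff_eq]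
    obtain rfl | hi := hrow i hi
    · simp
    · have hij : i ≠ j := by rintro rfl; omega
      simp [hij, h.p i hi, h.d i hi, h.number i hi, h.alive i hi]

theorem stores (h : M.SortedFrom I 0) :
    M.Stores n (byDueDate I fun j => I.p j) (byDueDate I I.d) (Finset.range n) := by
  constructor
  case line => exact h.line
  all_goals intro i hi
  · simpa [byDueDate, hi] using h.p (Tuple.sort I.d ⟨i, hi⟩) (Nat.zero_le _)
  · simpa [byDueDate, hi] using h.d (Tuple.sort I.d ⟨i, hi⟩) (Nat.zero_le _)
  · simpa [hi] using h.alive (Tuple.sort I.d ⟨i, hi⟩) (Nat.zero_le _)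

end SortedFrom

theorem Bounded.putJob {p d ν : ℤ} (hM : M.Bounded n B) (hp : |p| ≤ B) (hd : |d| ≤ B)
    (hν : |ν| ≤ B) (hB : 1 ≤ B) : (M.putJob k p d ν).Bounded n B :=
  (((hM.setRow hp).setRow hd).setRow hν).setRow (by simpa)

end Memory

section Prepare

attribute [local simp] RamProg.wp readAt writeAt copy incr decr skip

variable {n N m : ℕ} {M : Memory} {s : RamState} {Q : RamState → Prop} {B : ℤ}

theorem wp_initConstants (hn : s.reg nᵣ = n) (hM : M.Describes n s.mem)
    (hQ : ∀ s', AgreeOff [oneᵣ, zeroᵣ, Pᵣ, Dᵣ, Iᵣ, Aᵣ, Lᵣ, Bᵣ, Xᵣ, wᵣ] s' s → Loaded n M s' →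
      Q s') :
    initConstants.wp m N Q s := by
  refine hQ _ (by simp) ?_
  constructor
  case mem => simpa using hM
  all_goals simp [hn, rowBase]
  all_goals ring

theorem wp_initLines (h : Loaded n M s) (hM : M.Bounded n B) (hB : memSize n ≤ B)
    (hQ : ∀ s' M', AgreeOff [addrᵣ, cuᵣ, uᵣ, ubᵣ] s' s → Loaded n M' s' → M'.Bounded n B →
      M'.inp = M.inp → (∀ u ≤ n, M'.row 6 u = rowBase n (7 + u)) → Q s') :
    initLines.wp (memSize n) n Q s := by
  refine wp_loop (n + 1) (fun k s' => AgreeOff [addrᵣ, cuᵣ, uᵣ, ubᵣ] s' s ∧ s'.reg cuᵣ = k ∧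
      ∃ u, u + k = n + 1 ∧ s'.reg uᵣ = u ∧ s'.reg ubᵣ = rowBase n (7 + u) ∧
        ∃ M', Loaded n M' s' ∧ M'.Bounded n B ∧ M'.inp = M.inp ∧
          ∀ u' < u, M'.row 6 u' = rowBase n (7 + u'))
    le_rfl (fun _ _ h => h.2.1) ⟨by simp, ?_, 0, ?_⟩ ?_ ?_
  · simp [h.reg_zero, h.reg_w]
  · simp only [zero_add, h.reg_X, rowBase, Nat.cast_add, Nat.cast_mul,
      Nat.cast_ofNat, Nat.cast_one, h.reg_w, reg_setReg, Nat.reduceEqDiff, ↓reduceIte,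
      Nat.succ_ne_self, CharP.cast_eq_zero, add_zero, Nat.reduceLeDiff, Loaded.setReg,
      not_lt_zero, IsEmpty.forall_iff, implies_true, and_true, true_and]
    exact ⟨by ring, M, h, hM, rfl⟩
  · rintro k - s₁ ⟨h₁, hk₁, u, hu, hu₁, hub₁, M₁, hM₁, hMB, hinp, hline⟩
    have hlt := rowBase_add_lt (n := n) (r := 7 + u) (by omega) (Nat.zero_le n)
    simp only [wp, writeAt, incr, decr, List.mem_cons, Nat.reduceEqDiff, List.not_mem_nil,
      or_self, or_false, or_true, agreeOff_setReg, reg_setReg, ↓reduceIte, Nat.succ_ne_self,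
      Nat.reduceLeDiff, Loaded.setReg, OfNat.one_ne_ofNat, hM₁.reg_X, hu₁, hub₁, setMem_setReg,
      agreeOff_setMem, reg_setMem, hk₁, Nat.cast_add, Nat.cast_one, hM₁.reg_one,
      add_sub_cancel_right, hM₁.reg_w, true_and]
    refine ⟨toNat_rowBase_add_lt (by omega) (by omega), h₁, u + 1, by omega, by simp,
      by simp [rowBase]; ring, _, hM₁.setMem_row (by norm_num) (by omega) _,
      hMB.setRow (by rw [Nat.abs_cast]; omega), hinp, fun u' hu' => ?_⟩
    obtain rfl | hne := eq_or_ne u' u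
    · simp [Memory.setRow]
    · rw [Memory.setRow_row_of_ne (.inr hne), hline u' (by omega)]
  · rintro s₁ ⟨h₁, -, u, hu, -, -, M₁, hM₁, hMB, hinp, hline⟩
    exact hQ s₁ M₁ h₁ hM₁ hMB hinp fun u' hu' => hline u' (by omega)

theorem wp_computeRank {d : Fin n → ℤ} {c : Fin n} (h : Loaded n M s)
    (hM : ∀ j : Fin n, M.inp (n + j) = d j) (hc : s.reg cuᵣ = (c : ℕ)) (hd : s.reg dlᵣ = d c)
    (hQ : ∀ s', AgreeOff [addrᵣ, uᵣ, yᵣ, iᵣ, sᵣ, zᵣ] s' s → s'.mem = s.mem →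
      s'.reg uᵣ = ((Tuple.sort d).symm c : ℕ) → Q s') :
    computeRank.wp m n Q s := by
  refine wp_loop n (fun k s' => AgreeOff [addrᵣ, uᵣ, yᵣ, iᵣ, sᵣ, zᵣ] s' s ∧ s'.mem = s.mem ∧
      s'.reg iᵣ = k ∧
      s'.reg uᵣ = Finset.card {j : Fin n | k ≤ (j : ℕ) ∧ (d j < d c ∨ d j = d c ∧ j < c)})
    n.le_succ (fun _ _ h => h.2.2.1) ?_ ?_ fun s₁ h₁ => hQ s₁ h₁.1 h₁.2.1 ?_
  · have hnone : ∀ j : Fin n, ¬n ≤ (j : ℕ) := fun j => j.is_lt.not_ge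
    simp [h.reg_zero, h.reg_n, hnone]
  · rintro k hk s₁ ⟨h₁, hm₁, hk₁, hu₁⟩
    obtain ⟨i, rfl⟩ : ∃ i : Fin n, (i : ℕ) = k := ⟨⟨k, hk⟩, rfl⟩
    have hdi : s.mem ((n : ℤ) + (i : ℕ)).toNat = d i := by
      rw [← hM, ← h.mem.inp _ (by omega)]; rfl
    have hcard := card_filter_le_and (P := fun j => d j < d c ∨ d j = d c ∧ j < c) i
    rcases lt_trichotomy (d i) (d c) with hlt | heq | hgt
    · simp [h₁.reg, hm₁, h.reg_one, h.reg_n, hk₁, hu₁, hdi, hd, hlt, hcard, h₁]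
    · by_cases hic : i < c <;>
        simp [h₁.reg, hm₁, h.reg_one, h.reg_n, hk₁, hu₁, hdi, hd, hc, heq, hic, hcard, h₁]
    · simp [h₁.reg, hm₁, h.reg_one, h.reg_n, hk₁, hu₁, hdi, hd, hgt.not_gt, hgt.not_ge, hgt.ne',
        hcard, h₁]
  · rw [h₁.2.2.2, ← card_filter_eq_sort_symm d]
    simp

theorem wp_sortJobs {I : TardinessInstance n} (h : Loaded n M s) (hM : M.SortedFrom I n)
    (hMB : M.Bounded n B) (hB : n + 1 ≤ B)
    (hQ : ∀ s' M', AgreeOff [addrᵣ, cuᵣ, uᵣ, yᵣ, iᵣ, sᵣ, zᵣ, dlᵣ] s' s → Loaded n M' s' →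
      M'.Bounded n B → M'.SortedFrom I 0 → Q s') :
    sortJobs.wp (memSize n) n Q s := by
  refine wp_loop n (fun k s' => AgreeOff [addrᵣ, cuᵣ, uᵣ, yᵣ, iᵣ, sᵣ, zᵣ, dlᵣ] s' s ∧
      s'.reg cuᵣ = k ∧ ∃ M', Loaded n M' s' ∧ M'.Bounded n B ∧ M'.SortedFrom I k)
    n.le_succ (fun _ _ h => h.2.1) ⟨by simp, ?_, M, by simpa, hMB, hM⟩ ?_
    fun s₁ ⟨h₁, _, M₁, hM₁, hMB₁, hsort⟩ => hQ s₁ M₁ h₁ hM₁ hMB₁ hsort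
  · simp [h.reg_zero, h.reg_n]
  · rintro k hk s₁ ⟨h₁, hk₁, M₁, hM₁, hMB₁, hsort⟩
    obtain ⟨j, rfl⟩ : ∃ j : Fin n, (j : ℕ) = k := ⟨⟨k, hk⟩, rfl⟩
    have hd : s₁.mem ((n : ℤ) + (j : ℕ)).toNat = I.d j := by
      rw [← hsort.inp_d, ← hM₁.mem.inp _ (by omega)]; rfl
    have hp : s₁.mem (j : ℕ) = I.p j := by rw [← hsort.inp_p, ← hM₁.mem.inp _ (by omega)]
    simp only [wp, decr, readAt, writeAt, reg_setReg, ↓reduceIte, OfNat.one_ne_ofNat,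
      setMem_setReg, List.mem_cons, Nat.reduceEqDiff, List.not_mem_nil, or_self, or_false,
      agreeOff_setReg, agreeOff_setMem, reg_setMem, Nat.reduceLeDiff, Loaded.setReg, mem_setReg,
      Nat.succ_ne_self, or_true, hk₁, Nat.cast_add, Nat.cast_one, hM₁.reg_one,
      add_sub_cancel_right, OfNat.zero_ne_ofNat, hM₁.reg_n, hd]
    refine wp_computeRank (d := I.d) (c := j) (by simpa using hM₁) hsort.inp_d (by simp) (by simp)
      fun s₂ h₂ hm₂ hu₂ => ?_
    have hM₂ : Loaded n M₁ s₂ := by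
      refine Loaded.of_agreeOff (s := _) (by simpa using hM₁) h₂ (by decide) (hm₂ ▸ ?_)
      simpa using hM₁.mem
    have hrow : ∀ r < 7, ((rowBase n r : ℤ) + ((Tuple.sort I.d).symm j : ℕ)).toNat < memSize n :=
      fun r hr => toNat_rowBase_add_lt (by omega) (by omega)
    have hc₂ : s₂.reg cuᵣ = (j : ℕ) := by simp [h₂.reg]
    have hd₂ : s₂.reg dlᵣ = I.d j := by simp [h₂.reg]
    simp only [hM₂.reg_P, hu₂, Nat.ofNat_pos, hrow, hM₂.reg_D, Nat.one_lt_ofNat, hM₂.reg_I,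
      Nat.reduceLT, hM₂.reg_A, hc₂, hM₂.reg_zero, zero_add, Int.toNat_natCast, hm₂, mem_setReg, hp,
      hd₂, hM₂.reg_one, true_and]
    have hlt : ((Tuple.sort I.d).symm j : ℕ) ≤ n := by omega
    refine ⟨?_, _, (((hM₂.setMem_row (by norm_num) hlt _).setMem_row (by norm_num) hlt
      _).setMem_row (by norm_num) hlt _).setMem_row (by norm_num) hlt _,
      hMB₁.putJob ?_ ?_ ?_ (by omega), hsort.putJob⟩
    · exact (h₂.mono (by simp)).trans (by simpa using h₁)
    · rw [← hsort.inp_p]; exact hMB₁.inp _ (by omega)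
    · rw [← hsort.inp_d]; exact hMB₁.inp _ (by omega)
    · rw [Nat.abs_cast]; omega

end Prepare

section Prepare

variable {n : ℕ} {M : Memory} {s : RamState} {Q : RamState → Prop} {B C : ℤ}
  {I : TardinessInstance n}

theorem wp_prepare (h₀ : ∀ r, 20 ≤ r → s.reg r = 0) (hn : s.reg nᵣ = n)
    (hM : M.Describes n s.mem) (hMB : M.Bounded n B) (hB : memSize n ≤ B)
    (hp : ∀ j : Fin n, M.inp j = I.p j) (hd : ∀ j : Fin n, M.inp (n + j) = I.d j)
    (hQ : ∀ s' M', AgreeOff [oneᵣ, zeroᵣ, Pᵣ, Dᵣ, Iᵣ, Aᵣ, Lᵣ, Bᵣ, Xᵣ, wᵣ, posᵣ] s' s →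
      s'.reg posᵣ = n → Loaded n M' s' → M'.Bounded n B → M'.SortedFrom I 0 → Q s') :
    prepare.wp (memSize n) n Q s := by
  have hnB : n + 1 ≤ memSize n := by rw [memSize, rowBase]; nlinarith
  simp only [prepare, copy, RamProg.wp]
  refine wp_initConstants hn hM fun s₁ h₁ hM₁ =>
    wp_initLines hM₁ hMB hB fun s₂ M₂ h₂ hM₂ hMB₂ hinp hline => ?_
  have hunsorted : M₂.SortedFrom I n := by
    constructor
    case inp_p => exact fun j => by rw [hinp, hp]
    case inp_d => exact fun j => by rw [hinp, hd]
    case line => exact hline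
    all_goals exact fun j hj => absurd hj j.is_lt.not_ge
  refine wp_sortJobs hM₂ hunsorted hMB₂ (by omega) fun s₃ M₃ h₃ hM₃ hMB₃ hsort => ?_
  have hpos : s₃.reg nᵣ + s₃.reg zeroᵣ = n := by rw [hM₃.reg_n, hM₃.reg_zero, add_zero]
  refine wp_resetScratch h₀ (s := s₃.setReg posᵣ (s₃.reg nᵣ + s₃.reg zeroᵣ)) ?_
    fun s₄ h₄ hm₄ hr₄ => hQ s₄ M₃ h₄ ?_ ?_ hMB₃ hsort
  · exact (agreeOff_setReg (by decide)).2 <|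
      ((h₃.mono (by decide)).trans (h₂.mono (by decide))).trans (h₁.mono (by decide))
  · rw [hr₄ _ (by norm_num), hpos]
    simp
  · have hM₄ : Loaded n M₃ (s₃.setReg posᵣ (s₃.reg nᵣ + s₃.reg zeroᵣ)) := by simpa using hM₃
    constructor
    case mem => exact hm₄ ▸ hM₄.mem
    all_goals rw [hr₄ _ (by norm_num)]
    exacts [hM₄.reg_n, hM₄.reg_one, hM₄.reg_zero, hM₄.reg_P, hM₄.reg_D, hM₄.reg_I, hM₄.reg_A,
      hM₄.reg_L, hM₄.reg_B, hM₄.reg_X, hM₄.reg_w]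

/-- The bound on the absolute values of all numbers at the checkpoints of the run on `I` with
parameters `args`. -/
def numBound (args : List ℕ) (I : TardinessInstance n) : ℤ :=
  memSize n + (n + 1) * ∑ j, (I.p j + |I.d j|) + args.sum

variable {args : List ℕ}

theorem memSize_le_numBound : memSize n ≤ numBound args I := by
  have : 0 ≤ ∑ j, ((I.p j : ℤ) + |I.d j|) := by positivity
  rw [numBound]
  nlinarith

theorem initState_reg_of_length_lt {r : ℕ} (hr : args.length < r) :
    (initState args I).reg r = 0 :=
  congrArg Nat.cast (List.getD_eq_default (n :: args) 0 (Nat.succ_le_of_lt hr))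

theorem getD_zero_le_sum (l : List ℕ) (r : ℕ) : l.getD r 0 ≤ l.sum := by
  rcases lt_or_ge r l.length with hr | hr
  · rw [List.getD_eq_getElem _ _ hr]
    exact List.le_sum_of_mem (List.getElem_mem hr)
  · rw [List.getD_eq_default _ _ hr]
    exact Nat.zero_le _

theorem initState_mem_p (j : Fin n) : (initState args I).mem j = I.p j := by simp [initState]

theorem initState_mem_d (j : Fin n) : (initState args I).mem (n + j) = I.d j := by simp [initState]

theorem initState_mem_of_le {a : ℕ} (ha : 2 * n ≤ a) : (initState args I).mem a = 0 := by
  have : ¬a < n ∧ ¬a - n < n := by omega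
  simp [initState, this]

theorem withinBounds_initState : WithinBounds (memSize n) (numBound args I) (initState args I) := by
  have hmem : 2 * n ≤ memSize n := by rw [memSize, rowBase]; nlinarith
  have hle : ∀ j, (I.p j : ℤ) + |I.d j| ≤ numBound args I := fun j => by
    have := Finset.single_le_sum (f := fun j => (I.p j : ℤ) + |I.d j|)
      (fun j _ => by positivity) (Finset.mem_univ j)
    have := (add_nonneg (I.p j).cast_nonneg (abs_nonneg _)).trans this
    rw [numBound]
    nlinarith
  have := (Nat.cast_le (α := ℤ)).2 hmem
  have hB := memSize_le_numBound (args := args) (I := I)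
  refine ⟨fun a ha => initState_mem_of_le (hmem.trans ha), fun r => ?_, fun a => ?_⟩
  · have hreg := getD_zero_le_sum (n :: args) r
    rw [List.sum_cons, ← Nat.cast_le (α := ℤ), Nat.cast_add] at hreg
    have : 0 ≤ ∑ j, ((I.p j : ℤ) + |I.d j|) := by positivity
    rw [initState, Nat.abs_cast, numBound]
    nlinarith
  · simp only [initState]
    split_ifs with h h'
    · rw [Nat.abs_cast]
      linarith [hle ⟨a, h⟩, abs_nonneg (I.d ⟨a, h⟩)]
    · linarith [hle ⟨a - n, h'⟩, (I.p ⟨a - n, h'⟩).cast_nonneg (α := ℤ)]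
    · rw [abs_zero]
      omega

theorem setting_byDueDate (hC : 2 ^ chunkCost.eval n * numBound args I ≤ C) :
    Setting n (byDueDate I fun j => I.p j) (byDueDate I I.d) (numBound args I) C where
  nonneg := byDueDate_nonneg I fun j => (I.p j).cast_nonneg
  monotoneOn := monotoneOn_byDueDate I
  le := by
    rw [sum_byDueDate_add_abs, numBound]
    exact le_add_of_nonneg_right (by positivity)
  pow_mul_le := hC

theorem runs_prepare (hargs : args.length ≤ 1)
    (hC : 2 ^ chunkCost.eval n * numBound args I ≤ C) :
    Runs (WithinBounds (memSize n) C) prepare (initState args I) 0 (chunkCost.eval n) fun s' =>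
      ∃ ν : ℕ → ℤ, (∀ j : Fin n, ν ((Tuple.sort I.d).symm j) = (j : ℕ)) ∧
        Filled n (byDueDate I fun j => I.p j) (byDueDate I I.d) (numBound args I) ν []
          (Finset.range n) s' := by
  have hs : WithinBounds (memSize n) (numBound args I) (initState args I) := withinBounds_initState
  have hset := setting_byDueDate hC
  set M : Memory := ⟨(initState args I).mem, 0, 0⟩
  have hM : M.Describes n (initState args I).mem := by
    refine ⟨fun _ _ => rfl, fun r _ i _ => initState_mem_of_le ?_,
      fun u _ v _ => initState_mem_of_le ?_⟩ <;> rw [rowBase] <;> omega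
  refine (runs_chunk_of_agreeOff (by simp [chunks]) (by linarith [hset.add_one_le]) hC hs
    (wp_prepare (fun r hr => initState_reg_of_length_lt (by omega)) rfl hM (hM.bounded hs.2)
      hset.memSize_le (initState_mem_p (args := args)) (initState_mem_d (args := args))
      (Q := fun s' => AgreeOff _ s' _ ∧ s'.reg posᵣ = n ∧ ∃ M' : Memory, Loaded n M' s' ∧
        M'.Bounded n (numBound args I) ∧ M'.SortedFrom I 0)
      fun s' M' h hpos hM' hMB' hsort => ⟨h, hpos, M', hM', hMB', hsort⟩) ?_ ?_).mono le_rfl le_rfl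
        fun s' ⟨hsB', h', hpos', M', hM', _, hsort'⟩ =>
          ⟨M'.row 2, fun j => hsort'.number j j.val.zero_le, ?_⟩
  · have hn := hset.add_one_le
    have hrow : ∀ r < 7, (rowBase n r : ℤ) ≤ numBound args I := fun r hr => by
      have := rowBase_add_lt (n := n) (r := r) (by omega) n.zero_le
      exact hset.memSize_le.trans' (by omega)
    rintro s' ⟨hpos, M', hM', -, -⟩
    simp only [List.mem_cons, List.not_mem_nil, or_false, forall_eq_or_imp, hM'.reg_one,
      abs_one, hM'.reg_zero, abs_zero, hM'.reg_P, Nat.abs_cast, Nat.ofNat_pos, hrow, hM'.reg_D,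
      Nat.one_lt_ofNat, hM'.reg_I, Nat.reduceLT, hM'.reg_A, hM'.reg_L, hM'.reg_B, hM'.reg_X,
      Nat.lt_add_one, hM'.reg_w, forall_eq, hpos, true_and]
    rw [abs_of_nonneg] <;> omega
  · exact fun s' ⟨_, M', hM', hMB', _⟩ => ⟨M', hM'.mem, hMB'⟩
  · have hreg : ∀ r, 12 ≤ r → s'.reg r = 0 := fun r hr => by
      rw [h', initState_reg_of_length_lt (by omega)]
      simp
      omega
    refine
      { idle := ⟨M'.inp, ⟨⟨0, M',
          { toLoaded := hM'
            clean := fun r hr => hreg r (by omega)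
            stores := hsort'.stores
            subset := subset_rfl
            le := n.zero_le
            reg_st := hreg _ (by norm_num)
            reg_b := hreg _ (by norm_num)
            reg_h := hreg _ (by norm_num)
            reg_m := hreg _ (by norm_num) }, rfl, rfl⟩, hsB'⟩, by simp⟩
        enumerates := fun l' hl' => hl'
        cost := by simp [seqCost]
        reg_start := hreg _ (by norm_num)
        reg_pos := by rw [hpos', Finset.card_range] }

end Prepare

section TotalTardiness

theorem seqCost_ofFn {ι : Type*} {n : ℕ} (p d : ι → ℤ) (t : ℤ) (f : Fin n → ι) :
    seqCost p d t (List.ofFn f) =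
      ∑ i, max (t + ∑ j ∈ Finset.univ.filter (· ≤ i), p (f j) - d (f i)) 0 := by
  induction n generalizing t with
  | zero => rfl
  | succ n ih =>
    have hfilter : ∀ i : Fin n, ∑ j ∈ Finset.univ.filter (· ≤ i.succ), p (f j) =
        p (f 0) + ∑ j ∈ Finset.univ.filter (· ≤ i), p (f j.succ) := fun i => by
      simp [Finset.sum_filter, Fin.sum_univ_succ]
    have hzero : ∑ j ∈ Finset.univ.filter (· ≤ (0 : Fin (n + 1))), p (f j) = p (f 0) := by
      simp [Finset.sum_filter]
    rw [List.ofFn_succ, seqCost, ih, Fin.sum_univ_succ, hzero]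
    simp only [hfilter, add_assoc]

theorem enumerates_range_iff {n : ℕ} {l : List ℕ} :
    Enumerates (Finset.range n) l ↔
      ∃ σ : Equiv.Perm (Fin n), l = List.ofFn fun i => (σ i : ℕ) := by
  refine ⟨fun h => ?_, ?_⟩
  · have hlen : l.length = n := h.length_eq.trans (Finset.card_range n)
    have hnodup : l.Nodup := Multiset.coe_nodup.1 (h ▸ Finset.nodup _)
    have hlt : ∀ i : Fin n, l[i] < n := fun i =>
      Finset.mem_range.1 (h.mem_iff.1 (List.getElem_mem (by omega)))
    have hinj : Function.Injective fun i : Fin n => (⟨l[i], hlt i⟩ : Fin n) := fun i j hij =>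
      Fin.ext (hnodup.getElem_inj_iff.1 (Fin.mk.inj hij))
    exact ⟨.ofBijective _ (Finite.injective_iff_bijective.1 hinj),
      List.ext_getElem (by simp [hlen]) fun i _ _ => by simp⟩
  · rintro ⟨σ, rfl⟩
    have hcomp : (fun i => (σ i : ℕ)) = Fin.val ∘ σ := rfl
    rw [Enumerates, hcomp, ← Fin.univ_val_map, ← Multiset.map_map, Multiset.map_univ_val_equiv,
      Fin.univ_val_map, Finset.range_val, Multiset.range, Multiset.coe_eq_coe]
    exact .of_eq (List.ext_getElem (by simp) fun i _ _ => by simp)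

variable {n : ℕ} (I : TardinessInstance n)

theorem seqCost_byDueDate (σ : Equiv.Perm (Fin n)) :
    seqCost (byDueDate I fun j => I.p j) (byDueDate I I.d) 0
      (List.ofFn fun i => ((Tuple.sort I.d).symm (σ i) : ℕ)) = I.totalTardiness σ := by
  simp [seqCost_ofFn, byDueDate_sort_symm, TardinessInstance.totalTardiness,
    TardinessInstance.completionTime]

theorem exists_isOptimal_of_seqCost_eq {l : List ℕ} (hl : Enumerates (Finset.range n) l)
    (hcost : seqCost (byDueDate I fun j => I.p j) (byDueDate I I.d) 0 l =
      optCost (byDueDate I fun j => I.p j) (byDueDate I I.d) 0 (Finset.range n)) :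
    ∃ σ, I.IsOptimal σ ∧ l = List.ofFn fun i => ((Tuple.sort I.d).symm (σ i) : ℕ) := by
  obtain ⟨σ, rfl⟩ := enumerates_range_iff.1 hl
  refine ⟨σ.trans (Tuple.sort I.d), fun τ => ?_, by simp⟩
  rw [← seqCost_byDueDate, ← seqCost_byDueDate]
  have hτ := enumerates_range_iff.2 ⟨τ.trans (Tuple.sort I.d).symm, rfl⟩
  simpa [hcost] using optCost_le_seqCost _ _ 0 hτ

end TotalTardiness

/-! ### The algorithm -/

section Solution

variable {n : ℕ} {args : List ℕ} (I : TardinessInstance n)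

/-- A polynomial `q` such that `tardinessProgram` halts after at most `q(n) * 2 ^ n` steps. -/
noncomputable def timeFactor : Polynomial ℕ :=
  (10 * Polynomial.X ^ 2 + 4 * Polynomial.X + 2) * (1 + chunkCost)

theorem runs_tardinessProgram (hargs : args.length ≤ 1) :
    Runs (WithinBounds (memSize n) (2 ^ chunkCost.eval n * numBound args I)) tardinessProgram
      (initState args I)
      (1 + ∑ k ∈ Finset.range n, minRounds (byDueDate I fun j => I.p j) k)
      (timeFactor.eval n * 2 ^ n) fun s' =>
        WithinBounds (memSize n) (2 ^ chunkCost.eval n * numBound args I) s' ∧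
          ∃ σ, I.IsOptimal σ ∧ ∀ i : Fin n, s'.mem (2 * n + i) = ((σ i : ℕ) : ℤ) := by
  have hpow : 1 ≤ 2 ^ n := Nat.one_le_two_pow
  obtain ⟨s₁, t₁, he₁, -, ht₁, ν, hν, hs₁⟩ := runs_prepare (I := I) hargs le_rfl
  obtain ⟨s₂, t₂, he₂, hlo, hhi, hs₂, l, hl, hcost, hout⟩ :=
    hs₁.runs_loop (setting_byDueDate le_rfl)
  obtain ⟨σ, hσ, rfl⟩ := exists_isOptimal_of_seqCost_eq I hl hcost
  refine ⟨s₂, _, he₁.seq he₂, by omega, ?_, hs₂, σ, hσ,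
    fun i => by simpa [hν] using hout i (by simp)⟩
  simp only [timeFactor, Polynomial.eval_mul, Polynomial.eval_add, Polynomial.eval_pow,
    Polynomial.eval_X, Polynomial.eval_ofNat, Polynomial.eval_one]
  have hκ := Nat.mul_le_mul hpow (Nat.le_add_right 1 (chunkCost.eval n))
  have hκ' := Nat.mul_le_mul_right (chunkCost.eval n) hpow
  nlinarith [Nat.mul_le_mul_left n hκ]

variable {I}

theorem haltsWithin_tardinessProgram (hargs : args.length ≤ 1) {t : ℕ}
    (ht : timeFactor.eval n * 2 ^ n ≤ t) : tardinessProgram.HaltsWithin args I t := by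
  obtain ⟨s', t', he, -, ht', -⟩ := runs_tardinessProgram I hargs
  exact he.haltsWithin_iff.2 (ht'.trans ht)

theorem two_pow_le_of_haltsWithin (hargs : args.length ≤ 1) (hI : ∀ j, I.p j = 0) {t : ℕ}
    (ht : tardinessProgram.HaltsWithin args I t) : 2 ^ n ≤ t := by
  obtain ⟨s', t', he, ht', -⟩ := runs_tardinessProgram I hargs
  have hp : ∀ k, byDueDate I (fun j => I.p j) k = 0 := fun k => by simp [byDueDate, hI]
  have hgeom : 1 + ∑ k ∈ Finset.range n, 2 ^ k = 2 ^ n := by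
    rw [Nat.geomSum_eq le_rfl, Nat.div_one, Nat.add_sub_cancel' Nat.one_le_two_pow]
  simp only [minRounds, hp, implies_true, if_true, hgeom] at ht'
  exact ht'.trans (he.haltsWithin_iff.1 ht)

theorem solvesTotalTardiness_tardinessProgram (hargs : args.length ≤ 1) :
    tardinessProgram.SolvesTotalTardiness args := by
  intro n I
  obtain ⟨s', t, he, -, -, -, σ, hσ, hout⟩ := runs_tardinessProgram I hargs
  exact ⟨t, he.haltsWithin_iff.2 le_rfl, σ, hσ, fun i => by rw [he.run_of_le le_rfl, hout]⟩

theorem runsInOStar_tardinessProgram (hargs : args.length ≤ 1) :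
    tardinessProgram.RunsInOStar args 2 :=
  ⟨timeFactor, fun _ _ =>
    ⟨_, haltsWithin_tardinessProgram hargs le_rfl, by push_cast; exact le_rfl⟩⟩

theorem worstCaseLPTEqEDD_tardinessProgram (hargs : args.length ≤ 1) :
    tardinessProgram.WorstCaseLPTEqEDD args :=
  ⟨timeFactor, fun n I => ⟨⟨0, 0⟩, ⟨1, by simp [TardinessInstance.IsLPT],
    by simp [TardinessInstance.IsEDD]⟩, fun t ht => haltsWithin_tardinessProgram hargs
      (Nat.mul_le_mul_left _ (two_pow_le_of_haltsWithin hargs (fun _ => rfl) ht))⟩⟩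

end Solution

section Space

theorem monotone_eval (q : Polynomial ℕ) : Monotone fun n => q.eval n := fun m n h => by
  simp only [Polynomial.eval_eq_sum_range]
  gcongr

variable {n : ℕ} (I : TardinessInstance n)

theorem sum_add_abs_lt_two_pow_bitSize : ∑ j, ((I.p j : ℤ) + |I.d j|) < 2 ^ I.bitSize := by
  have hsum : ∀ s : Finset (Fin n), ∑ j ∈ s, (I.p j + (I.d j).natAbs) <
      2 ^ ∑ j ∈ s, (Nat.size (I.p j) + Nat.size (I.d j).natAbs) := fun s => by
    induction s using Finset.cons_induction with
    | empty => simp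
    | cons j s hj ih =>
      have hp := Nat.lt_size_self (I.p j)
      have hd := Nat.lt_size_self (I.d j).natAbs
      have hadd : ∀ {a b x y : ℕ}, a < x → b < y → a + b < x * y := fun {a b x y} ha hb => by
        nlinarith [Nat.mul_le_mul (Nat.succ_le_of_lt ha) (Nat.succ_le_of_lt hb)]
      rw [Finset.sum_cons, Finset.sum_cons, pow_add, pow_add]
      exact hadd (hadd hp hd) ih
  have hn := Nat.pow_le_pow_right two_pos (Nat.le_add_left
    (∑ j, (Nat.size (I.p j) + Nat.size (I.d j).natAbs)) n)
  simp only [← Int.natCast_natAbs]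
  exact_mod_cast (hsum Finset.univ).trans_le hn

/-- A bound, in terms of the length of the instance, for the number of bits that
`tardinessProgram` needs for its numbers. -/
noncomputable def numBits (args : List ℕ) : Polynomial ℕ :=
  chunkCost + (3 * Polynomial.X + (Polynomial.X + 8) * (Polynomial.X + 1)) + (Polynomial.X + 1) +
    (args.sum : Polynomial ℕ) + Polynomial.X

theorem eval_numBits (args : List ℕ) (n : ℕ) :
    (numBits args).eval n = chunkCost.eval n + (memSize n + (n + 1) + args.sum) + n := by
  simp only [numBits, memSize, rowBase, Polynomial.eval_add, Polynomial.eval_mul,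
    Polynomial.eval_X, Polynomial.eval_ofNat, Polynomial.eval_one, Polynomial.eval_natCast,
    Nat.cast_id]
  ring

theorem two_pow_mul_numBound_lt (args : List ℕ) :
    2 ^ chunkCost.eval n * numBound args I < 2 ^ (numBits args).eval I.bitSize := by
  set L := I.bitSize
  have hn : n ≤ L := Nat.le_add_right n _
  have hmem : (memSize n : ℤ) ≤ memSize L := by
    unfold memSize rowBase
    gcongr
  have hpow : (1 : ℤ) ≤ 2 ^ L := one_le_pow₀ one_le_two
  have hlt : ((memSize L + (L + 1) + args.sum : ℕ) : ℤ) <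
    2 ^ (memSize L + (L + 1) + args.sum) := mod_cast Nat.lt_two_pow_self
  have hB : numBound args I ≤ (memSize L + (L + 1) + args.sum : ℕ) * 2 ^ L := by
    have := mul_le_mul (by omega : (n + 1 : ℤ) ≤ L + 1) (sum_add_abs_lt_two_pow_bitSize I).le
      (by positivity) (by positivity)
    rw [numBound]
    simp only [Nat.cast_add, Nat.cast_one]
    nlinarith [(memSize L).cast_nonneg (α := ℤ), args.sum.cast_nonneg (α := ℤ)]
  rw [eval_numBits, add_assoc, pow_add, pow_add]
  calc (2 : ℤ) ^ chunkCost.eval n * numBound args I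
      ≤ 2 ^ chunkCost.eval L * ((memSize L + (L + 1) + args.sum : ℕ) * 2 ^ L) := by
        have hκ := pow_le_pow_right₀ (one_le_two (α := ℤ)) (monotone_eval chunkCost hn)
        exact mul_le_mul hκ hB (memSize_le_numBound.trans' (Int.natCast_nonneg _)) (by positivity)
    _ < _ := by gcongr

theorem usesPolySpace_tardinessProgram {args : List ℕ} (hargs : args.length ≤ 1) :
    tardinessProgram.UsesPolySpace args := by
  refine ⟨numBits args, fun n I t => ?_⟩
  obtain ⟨s', _, he, -, -, hs', -⟩ := runs_tardinessProgram I hargs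
  obtain ⟨hsupp, hreg, hmem⟩ := he.guard_run hs' t
  have hbits : ∀ v : ℤ, |v| ≤ 2 ^ chunkCost.eval n * numBound args I →
      v.natAbs < 2 ^ (numBits args).eval I.bitSize := fun v hv => by
    have := hv.trans_lt (two_pow_mul_numBound_lt I args)
    rw [Int.abs_eq_natAbs] at this
    exact_mod_cast this
  refine ⟨fun a ha => ?_, fun a => hbits _ (hmem a), fun r => hbits _ (hreg r)⟩
  have := lt_of_not_ge fun hle => ha (hsupp a hle)
  rw [eval_numBits]
  omega

end Space

section Recurrence

/-- The differences of a polynomial have a smaller degree than the polynomial. -/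
theorem exists_mul_eval_add_succ_le (f : Polynomial ℕ) (c k : ℕ) :
    ∃ N, ∀ x ≥ N, c * f.eval (x + k + 1) ≤ c * f.eval (x + k) + f.eval x := by
  rcases eq_or_ne f 0 with rfl | hf
  · simp
  set g := f.map (Nat.castRingHom ℝ)
  have hg : g ≠ 0 := (Polynomial.map_ne_zero_iff Nat.cast_injective).2 hf
  have hdeg : (Polynomial.taylor (k + 1 : ℝ) g - Polynomial.taylor (k : ℝ) g).degree <
      g.degree := by
    refine (Polynomial.degree_sub_lt_left ?_ ?_ ?_).trans_le (Polynomial.degree_taylor g _).le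
    · rw [Polynomial.degree_taylor, Polynomial.degree_taylor]
    · exact (Polynomial.taylor_eq_zero _ _).not.2 hg
    · rw [Polynomial.leadingCoeff_taylor, Polynomial.leadingCoeff_taylor]
  have hlittle := (Polynomial.isLittleO_atTop_of_degree_lt _ _ hdeg).bound
    (c := (c + 1 : ℝ)⁻¹) (by positivity)
  obtain ⟨N, hN⟩ := Filter.eventually_atTop.1 (tendsto_natCast_atTop_atTop.eventually hlittle)
  refine ⟨N, fun x hx => ?_⟩
  have h := hN x hx
  have hcast : ∀ y : ℕ, g.eval (y : ℝ) = f.eval y := fun y => by simp [g]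
  rw [Polynomial.eval_sub, Polynomial.taylor_eval, Polynomial.taylor_eval] at h
  have h₁ := hcast (x + k + 1)
  have h₂ := hcast (x + k)
  push_cast [← add_assoc] at h h₁ h₂
  rw [h₁, h₂, hcast] at h
  rw [Real.norm_natCast, inv_mul_eq_div, le_div_iff₀ (by positivity)] at h
  have habs := le_abs_self (((f.eval (x + k + 1) : ℕ) : ℝ) - (f.eval (x + k) : ℕ))
  have : c * ((f.eval (x + k + 1) : ℕ) : ℝ) ≤ c * (f.eval (x + k) : ℕ) + (f.eval x : ℕ) := by
    rw [Real.norm_eq_abs] at h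
    nlinarith [c.cast_nonneg (α := ℝ),
      abs_nonneg (((f.eval (x + k + 1) : ℕ) : ℝ) - (f.eval (x + k) : ℕ))]
  exact_mod_cast this

/-- `timeFactor n * 2 ^ n` with a shift that makes the first factor grow slowly from the start. -/
noncomputable def shiftedTime (N n : ℕ) : ℕ := timeFactor.eval (n + N) * 2 ^ n

theorem timeBoundedBy_shiftedTime {args : List ℕ} (hargs : args.length ≤ 1) (N : ℕ) :
    tardinessProgram.TimeBoundedBy args (shiftedTime N) := fun n _ =>
  haltsWithin_tardinessProgram hargs
    (Nat.mul_le_mul_right _ (monotone_eval timeFactor (Nat.le_add_right n N)))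

theorem exists_shiftedTime_le (k : ℕ) : ∃ N, ∀ n > k,
    shiftedTime N n ≤ 2 * shiftedTime N (n - 1) + shiftedTime N (n - k - 1) := by
  obtain ⟨N, hN⟩ := exists_mul_eval_add_succ_le timeFactor (2 ^ (k + 1)) k
  refine ⟨N, fun n hn => ?_⟩
  obtain ⟨a, rfl⟩ := Nat.exists_eq_add_of_le' (Nat.succ_le_of_lt hn)
  have h := Nat.mul_le_mul_left (2 ^ a) (hN (a + N) (Nat.le_add_left N a))
  have hk : a + (k + 1) + N = a + N + k + 1 := by omega
  have hk' : a + k + N = a + N + k := by omega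
  simp only [shiftedTime, Nat.add_succ_sub_one, Nat.sub_sub, Nat.add_sub_cancel, hk, hk']
  calc timeFactor.eval (a + N + k + 1) * 2 ^ (a + (k + 1))
      = 2 ^ a * (2 ^ (k + 1) * timeFactor.eval (a + N + k + 1)) := by ring
    _ ≤ _ := h
    _ = _ := by ring

end Recurrence

end Tardiness

theorem mainTheorem1_general : ∃ A : RamProg, ∀ args : List ℕ, args.length ≤ 1 →
    A.SolvesTotalTardiness args ∧ A.UsesPolySpace args ∧ A.RunsInOStar args 2 ∧
      A.WorstCaseLPTEqEDD args ∧ ∀ k : ℕ, ∃ T : ℕ → ℕ, A.TimeBoundedBy args T ∧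
        ∀ n > k, T n ≤ 2 * T (n - 1) + T (n - k - 1) :=
  ⟨Tardiness.tardinessProgram, fun _ hargs =>
    ⟨Tardiness.solvesTotalTardiness_tardinessProgram hargs,
      Tardiness.usesPolySpace_tardinessProgram hargs,
      Tardiness.runsInOStar_tardinessProgram hargs,
      Tardiness.worstCaseLPTEqEDD_tardinessProgram hargs, fun k =>
        let ⟨N, hN⟩ := Tardiness.exists_shiftedTime_le k
        ⟨_, Tardiness.timeBoundedBy_shiftedTime hargs N, hN⟩⟩⟩

theorem RamProg.RunsInOStar.mono {A : RamProg} {args : List ℕ} {c c' : ℝ} (hc : 0 ≤ c)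
    (hcc' : c ≤ c') (h : A.RunsInOStar args c) : A.RunsInOStar args c' := by
  obtain ⟨q, hq⟩ := h
  refine ⟨q, fun n I => ?_⟩
  obtain ⟨t, ht, htq⟩ := hq n I
  exact ⟨t, ht, htq.trans (by gcongr)⟩

theorem mainTheorem1 :
    (∃ (A : RamProg) (e : ℕ → ℝ), Filter.Tendsto e Filter.atTop (nhds 0) ∧
      ∀ k : ℕ, 2 ≤ k →
        A.SolvesTotalTardiness [k] ∧
        A.UsesPolySpace [k] ∧
        A.RunsInOStar [k] (2 + e k) ∧
        A.WorstCaseLPTEqEDD [k] ∧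
        ∃ (T : ℕ → ℕ) (q : Polynomial ℕ), A.TimeBoundedBy [k] T ∧
          ∀ n : ℕ, 2 * k ≤ n →
            T n ≤ 2 * T (n - 1) + (5 * k - 1) * T (n - k - 1) + q.eval n) ∧
    (∀ ε : ℝ, 0 < ε → ∃ A : RamProg,
      A.SolvesTotalTardiness [] ∧
      A.UsesPolySpace [] ∧
      A.RunsInOStar [] (2 + ε)) := by
  obtain ⟨A, hA⟩ := mainTheorem1_general
  refine ⟨⟨A, fun _ => 0, tendsto_const_nhds, fun k hk => ?_⟩, fun ε hε => ⟨A, ?_⟩⟩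
  · obtain ⟨hsolve, hspace, htime, hworst, hrec⟩ := hA [k] le_rfl
    obtain ⟨T, hT, hT'⟩ := hrec k
    refine ⟨hsolve, hspace, by simpa using htime, hworst, T, 0, hT, fun n hn => ?_⟩
    have hmul := Nat.le_mul_of_pos_left (T (n - k - 1)) (by omega : 0 < 5 * k - 1)
    exact (hT' n (by omega)).trans (by rw [Polynomial.eval_zero]; omega)
  · obtain ⟨hsolve, hspace, htime, -⟩ := hA [] zero_le_one
    exact ⟨hsolve, hspace, htime.mono zero_le_two (le_add_of_nonneg_right hε.le)⟩
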